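/- Let $G$ be a compactly generated locally compact (Hausdorff) group with a fixed left Haar measure, let $S\subset G$ be a compact symmetric generating set containing the identity, and let $\ell(g)=\min\{n : g\in S^n\}$ be the associated word length. A representation $(\pi,E)$ of $G$ is a homomorphism $\pi$ from $G$ to the bounded invertible operators on a complex Banach space $E$ such that $g\mapsto\pi(g)x$ is continuous for every $x\in E$; write $E^\pi$ for its space of invariant vectors and $\pi(f)x=\int_G f(g)\,\pi(g)x\,dg$ for $f\in C_c(G)$. For $\varepsilon>0$ let $\mathcal E(\varepsilon)$ be the class of all complex Banach spaces $E$ with $$\tfrac12\left(\|x+y\|^2+\|x-y\|^2\right)\le(1+\varepsilon)\left(\|x\|^2+\|y\|^2\right)\qquad\text{for all }x,y\in E.$$ For a class $\mathcal E$ of Banach spaces and $c>0$ let $\mathcal F(\mathcal E,c\ell)$ be the class of all representations $(\pi,E)$ of $G$ with $E\in\mathcal E$ and $\|\pi(g)\|\le e^{c\ell(g)}$ for all $g\in G$. For $\mathcal F=\mathcal F(\mathcal E,c\ell)$ let $\mathcal C_{\mathcal F}(G)$ be the Banach algebra obtained by completing the convolution algebra $C_c(G)$ for the seminorm $\|f\|_{\mathcal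 F}=\sup_{(\pi,E)\in\mathcal F}\|\pi(f)\|$; each $(\pi,E)\in\mathcal F$ extends to $\mathcal C_{\mathcal F}(G)$ by continuity. A Kazhdan projection in $\mathcal C_{\mathcal F}(G)$ is an idempotent $p$ in the closure of $\{f\in C_c(G):\int f=1\}$ such that $\pi(p)$ is a projection onto $E^\pi$ for every $(\pi,E)\in\mathcal F$; it is central if it lies in the center of $\mathcal C_{\mathcal F}(G)$. The group $G$ has robust property (T) with respect to $\mathcal E$ if $\mathcal C_{\mathcal F(\mathcal E,s\ell)}(G)$ has a Kazhdan projection for some $s>0$. 1. If $G$ has Kazhdan's property (T), then there exists $\varepsilon>0$ such that $\mathcal C_{\mathcal F(\mathcal E(\varepsilon),\varepsilon\ell)}(G)$ contains a central Kazhdan projection, and every continuous affine action of $G$ on a Banach space with linear part in $\mathcal F(\mathcal E(\varepsilon),\varepsilon\ell)$ has a fixed point. 2. $G$ has property (T) if and only if there exists $\varepsilon>0$ such that $G$ has robust property (T) with respect to $\mathcal E(\varepsilon)$. -/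

import Mathlib

open scoped Pointwise CompactlySupported

universe u v

set_option linter.unusedSectionVars false

namespace KazhdanRobust

noncomputable section

/-! ### Groups and word length -/

/-- A compact symmetric generating set of `G` containing the identity. -/
structure IsCompactGeneratingSet {G : Type u} [Group G] [TopologicalSpace G] (S : Set G) :
    Prop where
  isCompact : IsCompact S
  one_mem : (1 : G) ∈ S
  inv_mem : ∀ g ∈ S, g⁻¹ ∈ S
  closure_eq_top : Subgroup.closure S = ⊤

/-- The word length `ℓ(g) = min {n | g ∈ Sⁿ}`. -/
def wordLength {G : Type u} [Group G] (S : Set G) (g : G) : ℕ :=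
  sInf {n : ℕ | g ∈ S ^ n}

/-! ### Representations on Banach spaces -/

/-- A strongly continuous representation of `G` on a complex Banach space. As `G` is a group, the
operators `π g` are automatically invertible. -/
structure BanachRep (G : Type u) [Group G] [TopologicalSpace G] : Type (max u (v + 1)) where
  E : Type v
  [normedAddCommGroup : NormedAddCommGroup E]
  [normedSpace : NormedSpace ℂ E]
  [completeSpace : CompleteSpace E]
  π : G →* (E →L[ℂ] E)
  continuous_orbit : ∀ x : E, Continuous fun g => π g x

attribute [instance] BanachRep.normedAddCommGroup BanachRep.normedSpace BanachRep.completeSpace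

section Group

variable {G : Type u} [Group G] [TopologicalSpace G]

/-- The space `E^π` of invariant vectors. -/
def BanachRep.invariants (ρ : BanachRep.{u, v} G) : Submodule ℂ ρ.E where
  carrier := {x | ∀ g, ρ.π g x = x}
  add_mem' := fun ha hb g => by rw [map_add, ha g, hb g]
  zero_mem' := fun g => map_zero _
  smul_mem' := fun c x hx g => by rw [map_smul, hx g]

/-- A continuous affine action of `G` on `E` with linear part `(π, E)`. -/
structure AffineAction (ρ : BanachRep.{u, v} G) where
  σ : G →* (ρ.E ≃ᵃ[ℂ] ρ.E)
  linear_eq : ∀ g x, (σ g).linear x = ρ.π g x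
  continuous_orbit : ∀ x : ρ.E, Continuous fun g => σ g x

/-- The affine action has a fixed point. -/
def AffineAction.HasFixedPoint {ρ : BanachRep.{u, v} G} (a : AffineAction ρ) : Prop :=
  ∃ x : ρ.E, ∀ g, a.σ g x = x

theorem BanachRep.exists_bound (ρ : BanachRep.{u, v} G) {K : Set G} (hK : IsCompact K) :
    ∃ C, ∀ g ∈ K, ‖ρ.π g‖ ≤ C := by
  have h : ∀ x, ∃ C, ∀ i : K, ‖ρ.π i x‖ ≤ C := by
    intro x
    obtain ⟨C, hC⟩ := hK.exists_bound_of_continuousOn (ρ.continuous_orbit x).continuousOn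
    exact ⟨C, fun i => hC i i.2⟩
  obtain ⟨C, hC⟩ := banach_steinhaus h
  exact ⟨C, fun g hg => hC ⟨g, hg⟩⟩

variable [IsTopologicalGroup G] [MeasurableSpace G] [BorelSpace G]
  (μ : MeasureTheory.Measure G) [μ.IsHaarMeasure]

theorem BanachRep.integrable_orbit (ρ : BanachRep.{u, v} G) (f : C_c(G, ℂ)) (x : ρ.E) :
    MeasureTheory.Integrable (fun g => f g • ρ.π g x) μ :=
  (f.continuous.smul (ρ.continuous_orbit x)).integrable_of_hasCompactSupport
    f.hasCompactSupport.smul_right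

theorem norm_integral_orbit_le (ρ : BanachRep.{u, v} G) (f : C_c(G, ℂ)) {C : ℝ}
    (hC : ∀ g ∈ tsupport f, ‖ρ.π g‖ ≤ C) (x : ρ.E) :
    ‖∫ g, f g • ρ.π g x ∂μ‖ ≤ (C * ∫ g, ‖f g‖ ∂μ) * ‖x‖ := by
  have hf : MeasureTheory.Integrable (fun g => ‖f g‖) μ :=
    (f.continuous.integrable_of_hasCompactSupport f.hasCompactSupport).norm
  calc ‖∫ g, f g • ρ.π g x ∂μ‖ ≤ ∫ g, ‖f g‖ * (C * ‖x‖) ∂μ := by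
        refine MeasureTheory.norm_integral_le_of_norm_le (hf.mul_const _) (.of_forall fun g => ?_)
        by_cases hg : g ∈ tsupport f
        · rw [norm_smul]
          exact mul_le_mul_of_nonneg_left ((ρ.π g).le_of_opNorm_le (hC g hg) x) (norm_nonneg _)
        · simp [image_eq_zero_of_notMem_tsupport hg]
    _ = (C * ∫ g, ‖f g‖ ∂μ) * ‖x‖ := by
        rw [MeasureTheory.integral_mul_const]; ring

/-- The operator `π(f) x = ∫ f(g) π(g) x dg` for `f ∈ C_c(G)`. -/
def BanachRep.integrate (ρ : BanachRep.{u, v} G) (f : C_c(G, ℂ)) : ρ.E →L[ℂ] ρ.E :=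
  LinearMap.mkContinuousOfExistsBound
    { toFun := fun x => ∫ g, f g • ρ.π g x ∂μ
      map_add' := fun x y => by
        simp only [map_add, smul_add]
        exact MeasureTheory.integral_add (ρ.integrable_orbit μ f x) (ρ.integrable_orbit μ f y)
      map_smul' := fun c x => by
        simp only [map_smul, RingHom.id_apply, smul_comm _ c]
        exact MeasureTheory.integral_smul c _ }
    (by
      obtain ⟨C, hC⟩ := ρ.exists_bound f.hasCompactSupport
      exact ⟨_, norm_integral_orbit_le μ ρ f hC⟩)

theorem BanachRep.integrate_apply (ρ : BanachRep.{u, v} G) (f : C_c(G, ℂ)) (x : ρ.E) :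
    ρ.integrate μ f x = ∫ g, f g • ρ.π g x ∂μ := rfl

theorem BanachRep.integrate_add (ρ : BanachRep.{u, v} G) (f h : C_c(G, ℂ)) :
    ρ.integrate μ (f + h) = ρ.integrate μ f + ρ.integrate μ h := by
  ext x
  simp only [_root_.add_apply, BanachRep.integrate_apply,
    CompactlySupportedContinuousMap.add_apply, add_smul]
  exact MeasureTheory.integral_add (ρ.integrable_orbit μ f x) (ρ.integrable_orbit μ h x)

theorem BanachRep.integrate_smul (ρ : BanachRep.{u, v} G) (c : ℂ) (f : C_c(G, ℂ)) :
    ρ.integrate μ (c • f) = c • ρ.integrate μ f := by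
  ext x
  simp only [_root_.smul_apply, BanachRep.integrate_apply,
    CompactlySupportedContinuousMap.smul_apply, smul_assoc]
  exact MeasureTheory.integral_smul c _

/-! ### Convolution on `C_c(G)` -/

/-- The convolution `(f ∗ h)(x) = ∫ f(y) h(y⁻¹ x) dy` on `C_c(G)`. -/
def convolution [T2Space G] (f h : C_c(G, ℂ)) : C_c(G, ℂ) where
  toFun := fun x => ∫ y, f y * h (y⁻¹ * x) ∂μ
  continuous_toFun := by
    rw [← continuousOn_univ]
    refine continuousOn_integral_of_compact_support (k := tsupport f)
      f.hasCompactSupport ?_ ?_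
    · have hf := f.continuous
      have hh := h.continuous
      exact Continuous.continuousOn (by unfold Function.uncurry; fun_prop)
    · intro p x _ hx
      simp [image_eq_zero_of_notMem_tsupport hx]
  hasCompactSupport' := by
    refine HasCompactSupport.intro
      (IsCompact.mul f.hasCompactSupport h.hasCompactSupport) fun x hx => ?_
    refine MeasureTheory.integral_eq_zero_of_ae (.of_forall fun y => ?_)
    by_cases hy : y ∈ tsupport f
    · have : y⁻¹ * x ∉ tsupport h := fun hh => hx ⟨y, hy, y⁻¹ * x, hh, by group⟩
      simp [image_eq_zero_of_notMem_tsupport this]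
    · simp [image_eq_zero_of_notMem_tsupport hy]

theorem convolution_apply [T2Space G] (f h : C_c(G, ℂ)) (x : G) :
    convolution μ f h x = ∫ y, f y * h (y⁻¹ * x) ∂μ := rfl

theorem integrable_convolution [T2Space G] (f h : C_c(G, ℂ)) (x : G) :
    MeasureTheory.Integrable (fun y => f y * h (y⁻¹ * x)) μ := by
  have hf := f.continuous
  have hh := h.continuous
  exact Continuous.integrable_of_hasCompactSupport (by fun_prop) f.hasCompactSupport.mul_right

theorem hasCompactSupport_aux {E : Type*} [NormedAddCommGroup E] [T2Space G] (f h : C_c(G, ℂ))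
    (F : G → G → E) (hF : ∀ y x, f y = 0 ∨ h (y⁻¹ * x) = 0 → F x y = 0) :
    HasCompactSupport (Function.uncurry F) := by
  refine HasCompactSupport.intro
    ((IsCompact.mul f.hasCompactSupport h.hasCompactSupport).prod f.hasCompactSupport) ?_
  rintro ⟨x, y⟩ hxy
  refine hF y x ?_
  by_contra hcon
  push Not at hcon
  have h1 : y ∈ tsupport f := subset_tsupport _ hcon.1
  have h2 : y⁻¹ * x ∈ tsupport h := subset_tsupport _ hcon.2
  exact hxy ⟨⟨y, h1, y⁻¹ * x, h2, by group⟩, h1⟩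

/-- `π(f ∗ h) = π(f) π(h)`. -/
theorem BanachRep.integrate_convolution [T2Space G] (ρ : BanachRep.{u, v} G) (f h : C_c(G, ℂ)) :
    ρ.integrate μ (convolution μ f h) = ρ.integrate μ f * ρ.integrate μ h := by
  ext x
  have hf := f.continuous
  have hh := h.continuous
  have hρ := ρ.continuous_orbit x
  have hsupp : HasCompactSupport
      (Function.uncurry fun z y : G => (f y * h (y⁻¹ * z)) • ρ.π z x) := by
    refine hasCompactSupport_aux f h _ fun y z hyz => ?_
    rcases hyz with h0 | h0 <;> simp [h0]
  calc ρ.integrate μ (convolution μ f h) x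
      = ∫ z, ∫ y, (f y * h (y⁻¹ * z)) • ρ.π z x ∂μ ∂μ := by
        rw [BanachRep.integrate_apply]
        refine MeasureTheory.integral_congr_ae (.of_forall fun z => ?_)
        simp only [convolution_apply]
        rw [integral_smul_const]
    _ = ∫ y, ∫ z, (f y * h (y⁻¹ * z)) • ρ.π z x ∂μ ∂μ :=
        MeasureTheory.integral_integral_swap_of_hasCompactSupport
          (by unfold Function.uncurry; fun_prop) hsupp
    _ = ∫ y, f y • ρ.π y (∫ z, h z • ρ.π z x ∂μ) ∂μ := by
        refine MeasureTheory.integral_congr_ae (.of_forall fun y => ?_)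
        dsimp only
        rw [← ContinuousLinearMap.integral_comp_comm _ (ρ.integrable_orbit μ h x),
          ← MeasureTheory.integral_smul,
          ← MeasureTheory.integral_mul_left_eq_self _ y]
        refine MeasureTheory.integral_congr_ae (.of_forall fun z => ?_)
        simp [mul_smul]
    _ = (ρ.integrate μ f * ρ.integrate μ h) x := rfl

theorem convolution_assoc [T2Space G] (f h k : C_c(G, ℂ)) :
    convolution μ (convolution μ f h) k = convolution μ f (convolution μ h k) := by
  ext x
  have hf := f.continuous
  have hh := h.continuous
  have hk := k.continuous
  have hsupp : HasCompactSupport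
      (Function.uncurry fun z y : G => (f y * h (y⁻¹ * z)) * k (z⁻¹ * x)) := by
    refine hasCompactSupport_aux f h _ fun y z hyz => ?_
    rcases hyz with h0 | h0 <;> simp [h0]
  calc convolution μ (convolution μ f h) k x
      = ∫ z, ∫ y, (f y * h (y⁻¹ * z)) * k (z⁻¹ * x) ∂μ ∂μ := by
        rw [convolution_apply]
        refine MeasureTheory.integral_congr_ae (.of_forall fun z => ?_)
        simp only [convolution_apply]
        rw [MeasureTheory.integral_mul_const]
    _ = ∫ y, ∫ z, (f y * h (y⁻¹ * z)) * k (z⁻¹ * x) ∂μ ∂μ :=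
        MeasureTheory.integral_integral_swap_of_hasCompactSupport
          (by unfold Function.uncurry; fun_prop) hsupp
    _ = ∫ y, f y * ∫ z, h z * k (z⁻¹ * (y⁻¹ * x)) ∂μ ∂μ := by
        refine MeasureTheory.integral_congr_ae (.of_forall fun y => ?_)
        dsimp only
        rw [← MeasureTheory.integral_const_mul,
          ← MeasureTheory.integral_mul_left_eq_self _ y]
        refine MeasureTheory.integral_congr_ae (.of_forall fun z => ?_)
        simp [mul_assoc]
    _ = convolution μ f (convolution μ h k) x := rfl

end Group

/-! ### Families of representations and the algebra `C_F(G)` -/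

/-- A class `F` of representations for which `sup_{(π,E) ∈ F} ‖π(g)‖` is bounded on compact
subsets of `G`. -/
structure RepFamily (G : Type u) [Group G] [TopologicalSpace G] : Type (max u (v + 1)) where
  carrier : Set (BanachRep.{u, v} G)
  bounded : ∀ K : Set G, IsCompact K → ∃ C, ∀ ρ ∈ carrier, ∀ g ∈ K, ‖ρ.π g‖ ≤ C

section Algebra

variable {G : Type u} [Group G] [TopologicalSpace G] [IsTopologicalGroup G] [T2Space G]
  [LocallyCompactSpace G] [MeasurableSpace G] [BorelSpace G]
  (μ : MeasureTheory.Measure G) [μ.IsHaarMeasure] (F : RepFamily.{u, v} G)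

/-- `‖f‖_F = sup {‖π(f)‖ | (π,E) ∈ F}`. -/
def familyNorm (f : C_c(G, ℂ)) : ℝ :=
  ⨆ ρ : F.carrier, ‖ρ.1.integrate μ f‖

theorem bddAbove_familyNorm (f : C_c(G, ℂ)) :
    BddAbove (Set.range fun ρ : F.carrier => ‖ρ.1.integrate μ f‖) := by
  obtain ⟨C, hC⟩ := F.bounded _ f.hasCompactSupport
  refine ⟨max C 0 * ∫ g, ‖f g‖ ∂μ, ?_⟩
  rintro _ ⟨ρ, rfl⟩
  have h0 : 0 ≤ ∫ g, ‖f g‖ ∂μ := MeasureTheory.integral_nonneg fun _ => norm_nonneg _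
  exact ContinuousLinearMap.opNorm_le_bound _ (mul_nonneg (le_max_right _ _) h0)
    (norm_integral_orbit_le μ ρ.1 f fun g hg => (hC ρ.1 ρ.2 g hg).trans (le_max_left _ _))

theorem familyNorm_nonneg (f : C_c(G, ℂ)) : 0 ≤ familyNorm μ F f :=
  Real.iSup_nonneg fun _ => norm_nonneg _

variable {F} in
theorem norm_integrate_le_familyNorm {ρ : BanachRep.{u, v} G} (hρ : ρ ∈ F.carrier)
    (f : C_c(G, ℂ)) : ‖ρ.integrate μ f‖ ≤ familyNorm μ F f :=
  le_ciSup (bddAbove_familyNorm μ F f) (⟨ρ, hρ⟩ : F.carrier)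

theorem familyNorm_le (f : C_c(G, ℂ)) {c : ℝ} (hc : 0 ≤ c)
    (h : ∀ ρ ∈ F.carrier, ‖ρ.integrate μ f‖ ≤ c) : familyNorm μ F f ≤ c :=
  Real.iSup_le (fun ρ => h ρ.1 ρ.2) hc

/-- `‖·‖_F` as a seminorm on `C_c(G)`. -/
def familySeminorm : Seminorm ℂ C_c(G, ℂ) :=
  Seminorm.ofSMulLE (familyNorm μ F)
    (le_antisymm (familyNorm_le μ F 0 le_rfl fun ρ _ => by
      have := ρ.integrate_smul μ 0 0
      rw [zero_smul, zero_smul] at this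
      rw [this, norm_zero]) (familyNorm_nonneg μ F 0))
    (fun f h => familyNorm_le μ F _
      (add_nonneg (familyNorm_nonneg μ F f) (familyNorm_nonneg μ F h)) fun ρ hρ => by
        rw [ρ.integrate_add μ]
        exact (norm_add_le _ _).trans (add_le_add (norm_integrate_le_familyNorm μ hρ f)
          (norm_integrate_le_familyNorm μ hρ h)))
    (fun c f => familyNorm_le μ F _
      (mul_nonneg (norm_nonneg _) (familyNorm_nonneg μ F f)) fun ρ hρ => by
        rw [ρ.integrate_smul μ, norm_smul]
        exact mul_le_mul_of_nonneg_left (norm_integrate_le_familyNorm μ hρ f) (norm_nonneg _))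

/-- `C_c(G)` with the convolution product and the seminorm `‖·‖_F`. -/
@[nolint unusedArguments]
def PreAlgebra (_μ : MeasureTheory.Measure G) [_μ.IsHaarMeasure] (_F : RepFamily.{u, v} G) :
    Type u :=
  C_c(G, ℂ)

/-- The identity `C_c(G) → PreAlgebra`. -/
def PreAlgebra.of (f : C_c(G, ℂ)) : PreAlgebra μ F := f

variable {μ F} in
/-- The identity `PreAlgebra → C_c(G)`. -/
def PreAlgebra.out (f : PreAlgebra μ F) : C_c(G, ℂ) := f

instance : AddCommGroup (PreAlgebra μ F) := inferInstanceAs (AddCommGroup C_c(G, ℂ))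

instance : Module ℂ (PreAlgebra μ F) := inferInstanceAs (Module ℂ C_c(G, ℂ))

instance : SeminormedAddCommGroup (PreAlgebra μ F) :=
  AddGroupSeminorm.toSeminormedAddCommGroup (E := PreAlgebra μ F)
    (familySeminorm μ F).toAddGroupSeminorm

theorem PreAlgebra.norm_def (f : PreAlgebra μ F) : ‖f‖ = familyNorm μ F f.out := rfl

instance : NormedSpace ℂ (PreAlgebra μ F) where
  norm_smul_le c f := (map_smul_eq_mul (familySeminorm μ F) c f.out).le

instance : NonUnitalSeminormedRing (PreAlgebra μ F) where
  __ := (inferInstance : SeminormedAddCommGroup (PreAlgebra μ F))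
  mul f h := PreAlgebra.of μ F (convolution μ f.out h.out)
  left_distrib f h k := by
    refine CompactlySupportedContinuousMap.ext (α := G) (β := ℂ) fun x => ?_
    change ∫ y, f.out y * (h.out (y⁻¹ * x) + k.out (y⁻¹ * x)) ∂μ
      = (∫ y, f.out y * h.out (y⁻¹ * x) ∂μ) + ∫ y, f.out y * k.out (y⁻¹ * x) ∂μ
    simp only [mul_add]
    exact MeasureTheory.integral_add (integrable_convolution μ _ _ x)
      (integrable_convolution μ _ _ x)
  right_distrib f h k := by
    refine CompactlySupportedContinuousMap.ext (α := G) (β := ℂ) fun x => ?_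
    change ∫ y, (f.out y + h.out y) * k.out (y⁻¹ * x) ∂μ
      = (∫ y, f.out y * k.out (y⁻¹ * x) ∂μ) + ∫ y, h.out y * k.out (y⁻¹ * x) ∂μ
    simp only [add_mul]
    exact MeasureTheory.integral_add (integrable_convolution μ _ _ x)
      (integrable_convolution μ _ _ x)
  zero_mul f := by
    refine CompactlySupportedContinuousMap.ext (α := G) (β := ℂ) fun x => ?_
    change ∫ y, (0 : ℂ) * f.out (y⁻¹ * x) ∂μ = 0
    simp
  mul_zero f := by
    refine CompactlySupportedContinuousMap.ext (α := G) (β := ℂ) fun x => ?_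
    change ∫ y, f.out y * (0 : ℂ) ∂μ = 0
    simp
  mul_assoc f h k := convolution_assoc μ f.out h.out k.out
  norm_mul_le f h := by
    refine familyNorm_le μ F _
      (mul_nonneg (familyNorm_nonneg μ F f.out) (familyNorm_nonneg μ F h.out)) fun ρ hρ => ?_
    change ‖ρ.integrate μ (convolution μ f.out h.out)‖ ≤ familyNorm μ F f.out * familyNorm μ F h.out
    rw [ρ.integrate_convolution μ]
    exact (norm_mul_le _ _).trans (mul_le_mul (norm_integrate_le_familyNorm μ hρ _)
      (norm_integrate_le_familyNorm μ hρ _) (norm_nonneg _) (familyNorm_nonneg μ F _))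

/-- The Banach algebra `C_F(G)`: the completion of `C_c(G)` for `‖·‖_F`. -/
abbrev CF : Type u := UniformSpace.Completion (PreAlgebra μ F)

/-- The canonical map `C_c(G) → C_F(G)`. -/
def CF.of (f : C_c(G, ℂ)) : CF μ F :=
  ((PreAlgebra.of μ F f : PreAlgebra μ F) : UniformSpace.Completion (PreAlgebra μ F))

/-- The product of `C_F(G)`, extending the convolution by continuity. -/
instance : Mul (CF μ F) :=
  ⟨Function.curry <| (UniformSpace.Completion.isDenseInducing_coe.prodMap
    UniformSpace.Completion.isDenseInducing_coe).extend
      ((↑) ∘ Function.uncurry fun f h : PreAlgebra μ F => f * h)⟩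

theorem CF.coe_mul (f h : PreAlgebra μ F) : ((f * h : PreAlgebra μ F) : CF μ F) = f * h :=
  ((UniformSpace.Completion.isDenseInducing_coe.prodMap
    UniformSpace.Completion.isDenseInducing_coe).extend_eq
      ((UniformSpace.Completion.continuous_coe _).comp
        (continuous_mul (M := PreAlgebra μ F))) (f, h)).symm

instance : ContinuousMul (CF μ F) where
  continuous_mul := by
    let m := (AddMonoidHom.mul : PreAlgebra μ F →+ PreAlgebra μ F →+ PreAlgebra μ F).compr₂
      UniformSpace.Completion.toCompl
    have : Continuous fun p : PreAlgebra μ F × PreAlgebra μ F => m p.1 p.2 :=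
      (UniformSpace.Completion.continuous_coe _).comp continuous_mul
    have di : IsDenseInducing (UniformSpace.Completion.toCompl : PreAlgebra μ F → CF μ F) :=
      UniformSpace.Completion.isDenseInducing_coe
    exact (di.extend_Z_bilin di this :)

instance : NonUnitalNormedRing (CF μ F) where
  __ := (inferInstance : NormedAddCommGroup (CF μ F))
  __ := (inferInstance : Mul (CF μ F))
  zero_mul a := UniformSpace.Completion.induction_on a
    (isClosed_eq (by fun_prop) continuous_const)
    fun a => by rw [← UniformSpace.Completion.coe_zero, ← CF.coe_mul, zero_mul]
  mul_zero a := UniformSpace.Completion.induction_on a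
    (isClosed_eq (by fun_prop) continuous_const)
    fun a => by rw [← UniformSpace.Completion.coe_zero, ← CF.coe_mul, mul_zero]
  mul_assoc a b c := UniformSpace.Completion.induction_on₃ a b c
    (isClosed_eq (by fun_prop) (by fun_prop))
    fun a b c => by rw [← CF.coe_mul, ← CF.coe_mul, ← CF.coe_mul, ← CF.coe_mul, mul_assoc]
  left_distrib a b c := UniformSpace.Completion.induction_on₃ a b c
    (isClosed_eq (by fun_prop) (by fun_prop))
    fun a b c => by
      rw [← UniformSpace.Completion.coe_add, ← CF.coe_mul, ← CF.coe_mul, ← CF.coe_mul,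
        ← UniformSpace.Completion.coe_add, mul_add]
  right_distrib a b c := UniformSpace.Completion.induction_on₃ a b c
    (isClosed_eq (by fun_prop) (by fun_prop))
    fun a b c => by
      rw [← UniformSpace.Completion.coe_add, ← CF.coe_mul, ← CF.coe_mul, ← CF.coe_mul,
        ← UniformSpace.Completion.coe_add, add_mul]
  norm_mul_le a b := by
    induction a, b using UniformSpace.Completion.induction_on₂ with
    | hp => apply isClosed_le <;> fun_prop
    | ih a b => simpa only [← CF.coe_mul, UniformSpace.Completion.norm_coe] using norm_mul_le a b

theorem uniformContinuous_integrate {ρ : BanachRep.{u, v} G} (hρ : ρ ∈ F.carrier) :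
    UniformContinuous fun f : PreAlgebra μ F => ρ.integrate μ f.out := by
  refine LipschitzWith.uniformContinuous (K := 1) (LipschitzWith.of_dist_le_mul fun f h => ?_)
  have hadd := ρ.integrate_add μ (f - h).out h.out
  have heq : (f - h).out + h.out = f.out := sub_add_cancel f h
  rw [heq] at hadd
  rw [dist_eq_norm, dist_eq_norm, hadd, add_sub_cancel_right, NNReal.coe_one, one_mul]
  exact norm_integrate_le_familyNorm μ hρ (f - h).out

variable {F} in
/-- For `(π,E) ∈ F`, the extension of `f ↦ π(f)` to `C_F(G)` by (uniform) continuity. -/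
def CF.rep (ρ : F.carrier) : CF μ F → (ρ.1.E →L[ℂ] ρ.1.E) :=
  UniformSpace.Completion.extension fun f : PreAlgebra μ F => ρ.1.integrate μ f.out

variable {F} in
theorem CF.rep_of (ρ : F.carrier) (f : C_c(G, ℂ)) :
    CF.rep μ ρ (CF.of μ F f) = ρ.1.integrate μ f :=
  UniformSpace.Completion.extension_coe (uniformContinuous_integrate μ F ρ.2) _

variable {F} in
theorem CF.continuous_rep (ρ : F.carrier) : Continuous (CF.rep μ ρ) :=
  UniformSpace.Completion.continuous_extension

variable {μ F}

/-- A Kazhdan projection in `C_F(G)`: an idempotent in the closure of `{f ∈ C_c(G) | ∫ f = 1}`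
such that `π(p)` is a projection onto `E^π` for all `(π,E) ∈ F`. -/
structure IsKazhdanProjection (p : CF μ F) : Prop where
  idempotent : IsIdempotentElem p
  mem_closure : p ∈ closure (CF.of μ F '' {f : C_c(G, ℂ) | ∫ g, f g ∂μ = 1})
  rep_idempotent : ∀ ρ : F.carrier, IsIdempotentElem (CF.rep μ ρ p)
  range_rep : ∀ ρ : F.carrier, Set.range (CF.rep μ ρ p) = ρ.1.invariants

/-- A Kazhdan projection in the center of `C_F(G)`. -/
structure IsCentralKazhdanProjection (p : CF μ F) : Prop extends IsKazhdanProjection p where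
  central : p ∈ Set.center (CF μ F)

end Algebra

/-! ### The classes `F(𝓔, m)` -/

/-- A class of complex Banach spaces. -/
abbrev BanachClass : Type (v + 1) :=
  ∀ (E : Type v) [NormedAddCommGroup E] [NormedSpace ℂ E] [CompleteSpace E], Prop

/-- The class `𝓔(ε)` of Banach spaces satisfying the `ε`-approximate parallelogram inequality. -/
def nearHilbert (ε : ℝ) : BanachClass.{v} := fun E _ _ _ =>
  ∀ x y : E, (1 / 2 : ℝ) * (‖x + y‖ ^ 2 + ‖x - y‖ ^ 2) ≤ (1 + ε) * (‖x‖ ^ 2 + ‖y‖ ^ 2)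

section WordLength

variable {G : Type u} [Group G] [TopologicalSpace G]

theorem IsCompactGeneratingSet.exists_mem_pow {S : Set G} (hS : IsCompactGeneratingSet S) (g : G) :
    ∃ n : ℕ, g ∈ S ^ n := by
  have hg : g ∈ Subgroup.closure S := by rw [hS.closure_eq_top]; trivial
  induction hg using Subgroup.closure_induction with
  | mem x hx => exact ⟨1, by simpa using hx⟩
  | one => exact ⟨0, by simp⟩
  | mul x y _ _ hx hy =>
    obtain ⟨n, hn⟩ := hx
    obtain ⟨m, hm⟩ := hy
    exact ⟨n + m, by rw [pow_add]; exact Set.mul_mem_mul hn hm⟩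
  | inv x _ hx =>
    obtain ⟨n, hn⟩ := hx
    have hinv : S⁻¹ = S := by
      ext s
      exact ⟨fun h => by simpa using hS.inv_mem _ h, fun h => hS.inv_mem _ h⟩
    refine ⟨n, ?_⟩
    rw [← hinv, inv_pow]
    simpa using hn

theorem wordLength_le {S : Set G} {g : G} {n : ℕ} (h : g ∈ S ^ n) : wordLength S g ≤ n :=
  Nat.sInf_le h

/-- The word length is bounded on compact sets. -/
theorem IsCompactGeneratingSet.wordLength_bounded [IsTopologicalGroup G] [T2Space G]
    [LocallyCompactSpace G] {S : Set G} (hS : IsCompactGeneratingSet S) {K : Set G}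
    (hK : IsCompact K) : ∃ N : ℕ, ∀ g ∈ K, wordLength S g ≤ N := by
  have hcomp : ∀ n : ℕ, IsCompact (S ^ n) := fun n => by
    induction n with
    | zero => simp
    | succ n ih => rw [pow_succ]; exact ih.mul hS.isCompact
  obtain ⟨n, x, hx⟩ := nonempty_interior_of_iUnion_of_closed
    (fun n => (hcomp n).isClosed) (Set.iUnion_eq_univ_iff.2 hS.exists_mem_pow)
  let U : G → Set G := fun g => (fun y => x * g⁻¹ * y) ⁻¹' interior (S ^ n)
  obtain ⟨t, ht⟩ := hK.elim_finite_subcover U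
    (fun g => isOpen_interior.preimage (continuous_const_mul _))
    (fun g _ => Set.mem_iUnion.2 ⟨g, by simpa [U] using hx⟩)
  choose N hN using fun g : G => hS.exists_mem_pow (g * x⁻¹)
  refine ⟨t.sup N + n, fun y hy => ?_⟩
  obtain ⟨g, hgt, hgy⟩ := Set.mem_iUnion₂.1 (ht hy)
  have hmem : y ∈ S ^ (N g + n) := by
    rw [pow_add]
    exact ⟨g * x⁻¹, hN g, x * g⁻¹ * y, interior_subset hgy, by group⟩
  exact (wordLength_le hmem).trans (Nat.add_le_add_right (Finset.le_sup hgt) n)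

/-- The class `F(𝓔, cℓ)` of all representations `(π,E)` with `E ∈ 𝓔` and
`‖π(g)‖ ≤ exp (c ℓ(g))` for all `g`. -/
def repFamily [IsTopologicalGroup G] [T2Space G] [LocallyCompactSpace G] {S : Set G}
    (hS : IsCompactGeneratingSet S) (𝓔 : BanachClass.{v}) (c : ℝ) : RepFamily.{u, v} G where
  carrier := {ρ | 𝓔 ρ.E ∧ ∀ g, ‖ρ.π g‖ ≤ Real.exp (c * wordLength S g)}
  bounded := fun K hK => by
    obtain ⟨N, hN⟩ := hS.wordLength_bounded hK
    refine ⟨Real.exp (|c| * N), fun ρ hρ g hg => (hρ.2 g).trans (Real.exp_le_exp.2 ?_)⟩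
    exact mul_le_mul (le_abs_self c) (by exact_mod_cast hN g hg) (Nat.cast_nonneg _) (abs_nonneg c)

end WordLength

/-! ### Property (T) and robust property (T) -/

/-- Kazhdan's property (T): there are a compact set `Q` and `δ > 0` such that every strongly
continuous unitary representation on a complex Hilbert space that has a `(Q, δ)`-invariant vector
has a nonzero invariant vector. -/
def PropertyT (G : Type u) [Group G] [TopologicalSpace G] : Prop :=
  ∃ Q : Set G, IsCompact Q ∧ ∃ δ : ℝ, 0 < δ ∧
    ∀ (H : Type v) [NormedAddCommGroup H] [InnerProductSpace ℂ H] [CompleteSpace H]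
      (π : G →* unitary (H →L[ℂ] H)),
      (∀ x : H, Continuous fun g => (π g : H →L[ℂ] H) x) →
      (∃ x : H, x ≠ 0 ∧ ∀ g ∈ Q, ‖(π g : H →L[ℂ] H) x - x‖ < δ * ‖x‖) →
      ∃ y : H, y ≠ 0 ∧ ∀ g, (π g : H →L[ℂ] H) y = y

/-- Robust property (T) with respect to `𝓔`: for some `s > 0`, `C_{F(𝓔, sℓ)}(G)` has a Kazhdan
projection. -/
def RobustPropertyT {G : Type u} [Group G] [TopologicalSpace G] [IsTopologicalGroup G] [T2Space G]
    [LocallyCompactSpace G] [MeasurableSpace G] [BorelSpace G] (μ : MeasureTheory.Measure G)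
    [μ.IsHaarMeasure] {S : Set G} (hS : IsCompactGeneratingSet S) (𝓔 : BanachClass.{v}) : Prop :=
  ∃ s : ℝ, 0 < s ∧ ∃ p : CF μ (repFamily hS 𝓔 s), IsKazhdanProjection p

end

end KazhdanRobust

open KazhdanRobust

/-! Everything in the forward direction follows from one uniform contraction statement,
`IsKazhdanPair.exists_displacement_contraction`. Given a Kazhdan pair, there are `φ ∈ C_c(G)` with
integral 1 and `ε > 0` such that, for every affine action with linear part in `F(𝓔(ε), εℓ)`, moving
the base point to its `φ`-average halves the displacement under `S`.

The contraction is proved by compactness. If a fixed `φ = f ∗ ⋯ ∗ f ∗ h` failed for every `ε`, there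
would be counterexamples with `ε = 1/(n+1)`. In their limit along an ultrafilter the parallelogram
inequality becomes an identity and the operators become isometries (`exists_unitary_limit`), so the
counterexamples yield a cocycle of a unitary representation. Convolving with `h` makes the cocycles
equicontinuous, so that the limit cocycle is continuous. By property (T) that cocycle is a
coboundary: it is bounded, by means of Gaussian kernels (`IsKazhdanPair.bounded_cocycle`), and a
bounded orbit has a center. The spectral gap of `π(f)` (`IsKazhdanPair.exists_spectral_gap`) then
drives the iterated averages close to a fixed point. The number of factors `f` can be fixed in
advance because all estimates are uniform, and the small displacement in the limit contradicts the
failure.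

Iterating the contraction on an arbitrary cocycle produces a fixed point. Iterating it on
coboundaries shows that the convolution powers of `φ` are Cauchy in `C_F(G)`; their limit maps into
the invariant vectors and is a Kazhdan projection. Centrality comes from duality: `𝓔(ε)` is stable
under passing to the dual (`nearHilbert_dual`), so the same projection acts on the contragredient
representation and supplies enough invariant functionals to separate invariant vectors.

Conversely, unitary representations lie in every family `F(𝓔(ε), sℓ)`. If `f ∈ C_c(G)` approximates
the projection `p`, a vector almost fixed by the support of `f` is almost fixed by `π(f)`, so `π(p)`
cannot kill it. -/

namespace KazhdanRobust

noncomputable section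

open Filter Topology MeasureTheory

/-! ### Continuous vectors, restrictions and completions of representations -/

section Linear

variable {G : Type u} [Group G] {E : Type v} [NormedAddCommGroup E] [NormedSpace ℂ E]

/-- The restriction of a linear representation to an invariant subspace. -/
def restrictHom (π : G →* (E →L[ℂ] E)) (W : Submodule ℂ E) (hW : ∀ g, ∀ x ∈ W, π g x ∈ W) :
    G →* (W →L[ℂ] W) where
  toFun g := (π g).restrict (hW g)
  map_one' := by ext x; simp
  map_mul' g h := by ext x; simp

theorem map_inv_apply_apply (π : G →* (E →L[ℂ] E)) (g : G) (x : E) : π g⁻¹ (π g x) = x := by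
  rw [← mul_apply_eq_comp, ← map_mul, inv_mul_cancel, map_one,
    one_apply_eq_self]

theorem map_apply_inv_apply (π : G →* (E →L[ℂ] E)) (g : G) (x : E) : π g (π g⁻¹ x) = x := by
  simpa using map_inv_apply_apply π g⁻¹ x

variable [TopologicalSpace G] [IsTopologicalGroup G]

theorem continuous_orbit_of_tendsto_one (π : G →* (E →L[ℂ] E)) {x : E}
    (h : Tendsto (fun g => π g x) (𝓝 1) (𝓝 x)) : Continuous fun g => π g x := by
  refine continuous_iff_continuousAt.2 fun g₀ => ?_
  have h1 : Tendsto (fun g => g₀⁻¹ * g) (𝓝 g₀) (𝓝 1) := by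
    have : Continuous fun g => g₀⁻¹ * g := by fun_prop
    simpa using this.tendsto g₀
  have h2 := ((π g₀).continuous.tendsto x).comp (h.comp h1)
  refine h2.congr fun g => ?_
  simp only [Function.comp_apply]
  rw [← mul_apply_eq_comp, ← map_mul, mul_inv_cancel_left]

/-- The space of vectors with continuous orbits. -/
def continuousVectors (π : G →* (E →L[ℂ] E)) : Submodule ℂ E where
  carrier := {x | Continuous fun g => π g x}
  add_mem' ha hb := by
    simp only [Set.mem_ofPred_eq, map_add] at ha hb ⊢
    exact ha.add hb
  zero_mem' := by simpa using continuous_const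
  smul_mem' c x hx := by
    simp only [Set.mem_ofPred_eq, map_smul] at hx ⊢
    exact hx.const_smul c

theorem mem_continuousVectors {π : G →* (E →L[ℂ] E)} {x : E} :
    x ∈ continuousVectors π ↔ Continuous fun g => π g x := Iff.rfl

theorem map_mem_continuousVectors (π : G →* (E →L[ℂ] E)) (g : G) {x : E}
    (hx : x ∈ continuousVectors π) : π g x ∈ continuousVectors π := by
  rw [mem_continuousVectors] at hx ⊢
  have : Continuous fun k : G => π (k * g) x := hx.comp (by fun_prop)
  simpa using this

/-- A norm bound near the identity makes the operators equicontinuous there, so continuity of orbits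
survives limits of vectors. Closedness is what makes the continuous vectors a Banach space. -/
theorem isClosed_continuousVectors (π : G →* (E →L[ℂ] E)) {C : ℝ}
    (hC : ∀ᶠ g in 𝓝 1, ‖π g‖ ≤ C) : IsClosed (continuousVectors π : Set E) := by
  rw [← closure_subset_iff_isClosed]
  intro x hx
  refine continuous_orbit_of_tendsto_one π ?_
  have hC0 : 0 ≤ C := by
    obtain ⟨g, hg⟩ := hC.exists
    exact (norm_nonneg _).trans hg
  rw [Metric.tendsto_nhds]
  intro η hη
  obtain ⟨y, hy, hxy⟩ := Metric.mem_closure_iff.1 hx (η / (2 * (C + 1))) (by positivity)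
  have hy1 : Tendsto (fun g => π g y) (𝓝 1) (𝓝 y) := by
    have h := (mem_continuousVectors.1 hy).tendsto 1
    rwa [map_one] at h
  filter_upwards [hC, Metric.tendsto_nhds.1 hy1 (η / 2) (by positivity)] with g hg hgy
  rw [dist_eq_norm] at hxy hgy ⊢
  have h1 : π g x - x = π g (x - y) + (π g y - y) - (x - y) := by rw [map_sub]; abel
  have h2 : ‖π g (x - y)‖ ≤ C * ‖x - y‖ := (π g).le_of_opNorm_le hg _
  have h3 : (C + 1) * ‖x - y‖ < η / 2 := by
    rw [lt_div_iff₀ (by positivity)] at hxy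
    linarith
  calc ‖π g x - x‖ ≤ ‖π g (x - y)‖ + ‖π g y - y‖ + ‖x - y‖ := by
        rw [h1]; exact (norm_sub_le _ _).trans (add_le_add_left (norm_add_le _ _) _)
    _ < η := by linarith

/-- The representation on the space of continuous vectors. -/
def continuousPart [CompleteSpace E] (π : G →* (E →L[ℂ] E)) {C : ℝ}
    (hC : ∀ᶠ g in 𝓝 1, ‖π g‖ ≤ C) : BanachRep.{u, v} G :=
  haveI : CompleteSpace (continuousVectors π) :=
    (isClosed_continuousVectors π hC).completeSpace_coe
  { E := continuousVectors π
    π := restrictHom π _ fun g _ hx => map_mem_continuousVectors π g hx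
    continuous_orbit := fun x => Continuous.subtype_mk x.2 _ }

end Linear

section Unitary

variable {G : Type u} [Group G] [TopologicalSpace G]

/-- The representation is unitary: the norm is Hilbertian and invariant. -/
structure BanachRep.IsUnitary (ρ : BanachRep.{u, v} G) : Prop where
  parallelogram : ∀ x y : ρ.E,
    ‖x + y‖ * ‖x + y‖ + ‖x - y‖ * ‖x - y‖ = 2 * (‖x‖ * ‖x‖ + ‖y‖ * ‖y‖)
  norm_map : ∀ g x, ‖ρ.π g x‖ = ‖x‖

variable [IsTopologicalGroup G]

/-- An isometric action on a seminormed space with a Hilbertian seminorm extends to a unitary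
representation on the completion. -/
theorem exists_unitary_completion {X : Type v} [SeminormedAddCommGroup X] [NormedSpace ℂ X]
    (hX : ∀ x y : X, ‖x + y‖ * ‖x + y‖ + ‖x - y‖ * ‖x - y‖ = 2 * (‖x‖ * ‖x‖ + ‖y‖ * ‖y‖))
    (π : G →* (X →L[ℂ] X)) (hπ : ∀ g x, ‖π g x‖ = ‖x‖)
    (hc : ∀ x, Continuous fun g => π g x) :
    ∃ ρ : BanachRep.{u, v} G, ρ.IsUnitary ∧
      ∃ T : X →ₗᵢ[ℂ] ρ.E, ∀ g x, T (π g x) = ρ.π g (T x) := by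
  let Y := UniformSpace.Completion X
  have hcoe : ∀ g (x : X), (π g).completion (x : Y) = (π g x : X) := fun g x =>
    UniformSpace.Completion.map_coe (π g).uniformContinuous x
  let πY : G →* (Y →L[ℂ] Y) :=
    { toFun := fun g => (π g).completion
      map_one' := by
        ext x
        induction x using UniformSpace.Completion.induction_on with
        | hp => exact isClosed_eq (ContinuousLinearMap.continuous _) continuous_id
        | ih x => rw [hcoe]; simp
      map_mul' := fun g h => by
        ext x
        induction x using UniformSpace.Completion.induction_on with
        | hp => exact isClosed_eq (ContinuousLinearMap.continuous _)
                  (ContinuousLinearMap.continuous _)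
        | ih x => rw [hcoe, mul_apply_eq_comp, hcoe, hcoe]; simp }
  have hπY : ∀ g (x : X), πY g (x : Y) = (π g x : X) := hcoe
  have hnorm : ∀ g (x : Y), ‖πY g x‖ = ‖x‖ := fun g x => by
    induction x using UniformSpace.Completion.induction_on with
    | hp => exact isClosed_eq (ContinuousLinearMap.continuous _).norm continuous_norm
    | ih x => rw [hπY, UniformSpace.Completion.norm_coe, UniformSpace.Completion.norm_coe, hπ]
  have hbd : ∀ᶠ g in 𝓝 (1 : G), ‖πY g‖ ≤ 1 := .of_forall fun g =>
    ContinuousLinearMap.opNorm_le_bound _ zero_le_one fun x => by rw [hnorm, one_mul]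
  have hmem : ∀ y : Y, y ∈ continuousVectors πY := fun y => by
    induction y using UniformSpace.Completion.induction_on with
    | hp => exact isClosed_continuousVectors πY hbd
    | ih x =>
      rw [mem_continuousVectors]
      simp only [hπY]
      exact (UniformSpace.Completion.continuous_coe X).comp (hc x)
  have hpar : ∀ x y : Y,
      ‖x + y‖ * ‖x + y‖ + ‖x - y‖ * ‖x - y‖ = 2 * (‖x‖ * ‖x‖ + ‖y‖ * ‖y‖) := fun x y => by
    induction x, y using UniformSpace.Completion.induction_on₂ with
    | hp => exact isClosed_eq (by fun_prop) (by fun_prop)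
    | ih x y =>
      rw [← UniformSpace.Completion.coe_add, ← UniformSpace.Completion.coe_sub]
      rw [UniformSpace.Completion.norm_coe, UniformSpace.Completion.norm_coe,
        UniformSpace.Completion.norm_coe, UniformSpace.Completion.norm_coe]
      exact hX x y
  exact ⟨{ E := Y, π := πY, continuous_orbit := hmem }, ⟨hpar, hnorm⟩,
    UniformSpace.Completion.toComplₗᵢ, fun g x => (hπY g x).symm⟩

/-- The normed space structure defined by a seminorm, on a copy of the space. -/
@[nolint unusedArguments]
def WithSeminorm {E : Type v} [AddCommGroup E] [Module ℂ E] (_p : Seminorm ℂ E) : Type v := E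

instance {E : Type v} [AddCommGroup E] [Module ℂ E] (p : Seminorm ℂ E) :
    AddCommGroup (WithSeminorm p) := inferInstanceAs (AddCommGroup E)

instance {E : Type v} [AddCommGroup E] [Module ℂ E] (p : Seminorm ℂ E) :
    Module ℂ (WithSeminorm p) := inferInstanceAs (Module ℂ E)

instance {E : Type v} [AddCommGroup E] [Module ℂ E] (p : Seminorm ℂ E) :
    SeminormedAddCommGroup (WithSeminorm p) :=
  AddGroupSeminorm.toSeminormedAddCommGroup (E := WithSeminorm p) p.toAddGroupSeminorm

instance {E : Type v} [AddCommGroup E] [Module ℂ E] (p : Seminorm ℂ E) :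
    NormedSpace ℂ (WithSeminorm p) where
  norm_smul_le c x := (map_smul_eq_mul p c (show E from x)).le

/-- A linear action preserving a Hilbertian seminorm, with orbits continuous for the seminorm,
gives rise to a unitary representation. -/
theorem exists_unitary_of_seminorm {E : Type v} [AddCommGroup E] [Module ℂ E] (p : Seminorm ℂ E)
    (hp : ∀ x y, p (x + y) * p (x + y) + p (x - y) * p (x - y) = 2 * (p x * p x + p y * p y))
    (π : G →* (E →ₗ[ℂ] E)) (hπ : ∀ g x, p (π g x) = p x)
    (hc : ∀ x, Tendsto (fun g => p (π g x - x)) (𝓝 1) (𝓝 0)) :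
    ∃ ρ : BanachRep.{u, v} G, ρ.IsUnitary ∧
      ∃ T : E →ₗ[ℂ] ρ.E, (∀ x, ‖T x‖ = p x) ∧ ∀ g x, T (π g x) = ρ.π g (T x) := by
  let X := WithSeminorm p
  let toX : E →ₗ[ℂ] X := LinearMap.id
  let πX : G →* (X →L[ℂ] X) :=
    { toFun := fun g => LinearMap.mkContinuous (E := X) (F := X) (π g) 1 fun x => by
        rw [one_mul]
        exact (hπ g x).le
      map_one' := by
        ext x
        change π 1 x = x
        rw [map_one]; rfl
      map_mul' := fun g h => by
        ext x
        change π (g * h) x = π g (π h x)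
        rw [map_mul]; rfl }
  have hadd : ∀ g h (x : X), πX (g * h) x = πX g (πX h x) := fun g h x => by
    rw [map_mul]; rfl
  have hcont : ∀ x : X, Continuous fun g => πX g x := by
    intro x
    refine continuous_iff_continuousAt.2 fun g₀ => ?_
    have h1 : Tendsto (fun g => g₀⁻¹ * g) (𝓝 g₀) (𝓝 1) := by
      have : Continuous fun g => g₀⁻¹ * g := by fun_prop
      simpa using this.tendsto g₀
    refine tendsto_iff_norm_sub_tendsto_zero.2 (((hc x).comp h1).congr fun g => ?_)
    have h2 : πX g x - πX g₀ x = πX g₀ (πX (g₀⁻¹ * g) x - x) := by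
      rw [map_sub, ← hadd, mul_inv_cancel_left]
    rw [h2]
    exact (hπ g₀ _).symm
  obtain ⟨ρ, hρ, T, hT⟩ := exists_unitary_completion (X := X) hp πX hπ hcont
  exact ⟨ρ, hρ, T.toLinearMap ∘ₗ toX, fun x => T.norm_map _, fun g x => hT g x⟩

end Unitary

/-! ### Kazhdan pairs and the spectral gap of unitary representations -/

section KazhdanPair

variable {G : Type u} [Group G] [TopologicalSpace G]

/-- `(Q, δ)` is a Kazhdan pair: every unitary representation with a `(Q, δ)`-invariant vector has a
nonzero invariant vector. -/
def IsKazhdanPair (Q : Set G) (δ : ℝ) : Prop :=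
  ∀ (H : Type v) [NormedAddCommGroup H] [InnerProductSpace ℂ H] [CompleteSpace H]
    (π : G →* unitary (H →L[ℂ] H)),
    (∀ x : H, Continuous fun g => (π g : H →L[ℂ] H) x) →
    (∃ x : H, x ≠ 0 ∧ ∀ g ∈ Q, ‖(π g : H →L[ℂ] H) x - x‖ < δ * ‖x‖) →
    ∃ y : H, y ≠ 0 ∧ ∀ g, (π g : H →L[ℂ] H) y = y

theorem inner_map_map_of_isometric {H : Type v} [NormedAddCommGroup H] [InnerProductSpace ℂ H]
    (π : G →* (H →L[ℂ] H)) (hπ : ∀ g x, ‖π g x‖ = ‖x‖) (g : G) (x y : H) :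
    inner ℂ (π g x) (π g y) = inner ℂ x y :=
  (⟨(π g).toLinearMap, hπ g⟩ : H →ₗᵢ[ℂ] H).inner_map_map x y

theorem inner_map_left_of_isometric {H : Type v} [NormedAddCommGroup H] [InnerProductSpace ℂ H]
    (π : G →* (H →L[ℂ] H)) (hπ : ∀ g x, ‖π g x‖ = ‖x‖) (g : G) (x y : H) :
    inner ℂ (π g x) y = inner ℂ x (π g⁻¹ y) := by
  rw [← inner_map_map_of_isometric π hπ g x, map_apply_inv_apply]

/-- An isometric linear action on a Hilbert space is unitary. -/
def unitaryHom {H : Type v} [NormedAddCommGroup H] [InnerProductSpace ℂ H] [CompleteSpace H]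
    (π : G →* (H →L[ℂ] H)) (hπ : ∀ g x, ‖π g x‖ = ‖x‖) : G →* unitary (H →L[ℂ] H) :=
  have hstar : ∀ g, star (π g) = π g⁻¹ := fun g => by
    rw [ContinuousLinearMap.star_eq_adjoint, eq_comm, ContinuousLinearMap.eq_adjoint_iff]
    intro x y
    rw [inner_map_left_of_isometric π hπ, inv_inv]
  { toFun := fun g => ⟨π g, by
      rw [Unitary.mem_iff, hstar, ← map_mul, ← map_mul, inv_mul_cancel, mul_inv_cancel, map_one]
      exact ⟨rfl, rfl⟩⟩
    map_one' := Subtype.ext (map_one π)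
    map_mul' := fun g h => Subtype.ext (map_mul π g h) }

/-- `W` is the orthogonal complement of the invariant vectors. If some nonzero vector of `W` were
moved too little, the Kazhdan pair applied to `W` would give a nonzero invariant vector orthogonal
to itself. The inner product is recovered from the parallelogram law, since a `BanachRep` carries
only a norm. -/
theorem IsKazhdanPair.exists_complement {Q : Set G} {δ : ℝ} (hQ : IsKazhdanPair.{u, v} Q δ)
    {ρ : BanachRep.{u, v} G} (hρ : ρ.IsUnitary) :
    ∃ W : Submodule ℂ ρ.E, IsClosed (W : Set ρ.E) ∧ (∀ g, ∀ x ∈ W, ρ.π g x ∈ W) ∧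
      (∀ x, ∃ z ∈ ρ.invariants, x - z ∈ W) ∧
      ∀ x ∈ W, x ≠ 0 → ∃ g ∈ Q, δ * ‖x‖ ≤ ‖ρ.π g x - x‖ := by
  let _ : InnerProductSpace ℂ ρ.E := InnerProductSpace.ofNorm ℂ hρ.parallelogram
  have hclosed : IsClosed (ρ.invariants : Set ρ.E) := by
    have : (ρ.invariants : Set ρ.E) = ⋂ g, {x | ρ.π g x = x} := by
      ext x; simp [BanachRep.invariants]
    rw [this]
    exact isClosed_iInter fun g => isClosed_eq (ρ.π g).continuous continuous_id
  have : CompleteSpace ρ.invariants := hclosed.completeSpace_coe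
  have hinv : ∀ g, ∀ x ∈ ρ.invariantsᗮ, ρ.π g x ∈ ρ.invariantsᗮ := by
    intro g x hx
    rw [Submodule.mem_orthogonal'] at hx ⊢
    intro z hz
    rw [inner_map_left_of_isometric ρ.π hρ.norm_map, hz g⁻¹, hx z hz]
  refine ⟨ρ.invariantsᗮ, Submodule.isClosed_orthogonal _, hinv, fun x => ?_, fun x hx hx0 => ?_⟩
  · obtain ⟨y, hy, z, hz, h⟩ := ρ.invariants.exists_add_mem_mem_orthogonal x
    exact ⟨y, hy, by rwa [h, add_sub_cancel_left]⟩
  · by_contra! hcon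
    obtain ⟨y, hy0, hy⟩ := hQ ρ.invariantsᗮ
      (unitaryHom (restrictHom ρ.π _ hinv) fun g x => hρ.norm_map g x)
      (fun x => Continuous.subtype_mk (ρ.continuous_orbit x) _)
      ⟨⟨x, hx⟩, by simpa using hx0, hcon⟩
    have hy' : (y : ρ.E) ∈ ρ.invariants := fun g => congrArg Subtype.val (hy g)
    have : inner ℂ (y : ρ.E) (y : ρ.E) = 0 := (Submodule.mem_orthogonal _ _).1 y.2 _ hy'
    exact hy0 (Subtype.ext (inner_self_eq_zero.1 this))

theorem IsKazhdanPair.exists_invariant_near {Q : Set G} {δ : ℝ} (hQ : IsKazhdanPair.{u, v} Q δ)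
    {ρ : BanachRep.{u, v} G} (hρ : ρ.IsUnitary) {x : ρ.E} {r : ℝ} (hr : 0 ≤ r)
    (hx : ∀ g ∈ Q, ‖ρ.π g x - x‖ ≤ r) : ∃ z ∈ ρ.invariants, δ * ‖x - z‖ ≤ r := by
  obtain ⟨W, -, -, h1, h2⟩ := hQ.exists_complement hρ
  obtain ⟨z, hz, hzW⟩ := h1 x
  refine ⟨z, hz, ?_⟩
  by_cases h0 : x - z = 0
  · simpa [h0] using hr
  · obtain ⟨g, hg, hle⟩ := h2 _ hzW h0
    rw [map_sub, hz g, sub_sub_sub_cancel_right] at hle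
    exact hle.trans (hx g hg)

end KazhdanPair

section Gap

variable {G : Type u} [Group G] [TopologicalSpace G] [IsTopologicalGroup G] [T2Space G]
  [LocallyCompactSpace G] [MeasurableSpace G] [BorelSpace G]
  (μ : Measure G) [μ.IsHaarMeasure]

theorem BanachRep.map_integrate {ρ ρ' : BanachRep.{u, v} G} (T : ρ.E →L[ℂ] ρ'.E)
    (hT : ∀ g x, T (ρ.π g x) = ρ'.π g (T x)) (f : C_c(G, ℂ)) (x : ρ.E) :
    T (ρ.integrate μ f x) = ρ'.integrate μ f (T x) := by
  rw [BanachRep.integrate_apply, BanachRep.integrate_apply,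
    ← ContinuousLinearMap.integral_comp_comm _ (ρ.integrable_orbit μ f x)]
  simp [hT]

/-- The variance identity: `y` is the `χ`-weighted mean of points on a sphere of radius `r`. If the
mean is almost as long as the radius, the points are concentrated near it. -/
theorem integral_norm_sub_mean_sq {H : Type v} [NormedAddCommGroup H] [CompleteSpace H]
    [InnerProductSpace ℝ H] {χ : G → ℝ} (hχ : Continuous χ) (hχc : HasCompactSupport χ)
    {F : G → H} (hF : Continuous F) {r A : ℝ} (hr : ∀ g, ‖F g‖ = r) (hA : ∫ g, χ g ∂μ = A)
    {y : H} (hy : A • y = ∫ g, χ g • F g ∂μ) :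
    ∫ g, χ g * ‖F g - y‖ ^ 2 ∂μ = A * (r ^ 2 - ‖y‖ ^ 2) := by
  have hi : Integrable χ μ := hχ.integrable_of_hasCompactSupport hχc
  have hi2 : Integrable (fun g => χ g • F g) μ :=
    (hχ.smul hF).integrable_of_hasCompactSupport hχc.smul_right
  have hi3 : Integrable (fun g => inner ℝ y (χ g • F g)) μ := hi2.const_inner y
  have h1 : ∀ g, χ g * ‖F g - y‖ ^ 2 =
      χ g * (r ^ 2 + ‖y‖ ^ 2) - 2 * inner ℝ y (χ g • F g) := fun g => by
    rw [norm_sub_sq_real, hr, inner_smul_right, real_inner_comm]; ring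
  simp only [h1]
  rw [integral_sub (hi.mul_const _) (hi3.const_mul 2), integral_mul_const, integral_const_mul,
    integral_inner hi2, ← hy, inner_smul_right, real_inner_self_eq_norm_sq, hA]
  ring

theorem exists_nonneg_bump {K : Set G} (hK : IsCompact K) :
    ∃ χ : C_c(G, ℝ), (∀ g ∈ K, χ g = 1) ∧ ∀ g, 0 ≤ χ g ∧ χ g ≤ 1 := by
  obtain ⟨f, h1, -, h2, h3⟩ := exists_continuous_one_zero_of_isCompact hK isClosed_empty
    (Set.disjoint_empty K)
  exact ⟨⟨f, h2⟩, fun g hg => h1 hg, h3⟩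

theorem integral_pos_of_one {χ : C_c(G, ℝ)} (h : ∀ g, 0 ≤ χ g) {g₀ : G} (h1 : χ g₀ = 1) :
    0 < ∫ g, χ g ∂μ :=
  χ.continuous.integral_pos_of_hasCompactSupport_nonneg_nonzero χ.hasCompactSupport h
    (x := g₀) (by rw [h1]; exact one_ne_zero)

/-- The function `c χ`, as a complex-valued function. -/
def toComplexBump (c : ℝ) (χ : C_c(G, ℝ)) : C_c(G, ℂ) where
  toFun g := ((c * χ g : ℝ) : ℂ)
  continuous_toFun := by have := χ.continuous; fun_prop
  hasCompactSupport' := by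
    refine χ.hasCompactSupport.mono fun g hg => ?_
    simp only [Function.mem_support] at hg ⊢
    intro h0
    simp [h0] at hg

theorem toComplexBump_apply (c : ℝ) (χ : C_c(G, ℝ)) (g : G) :
    toComplexBump c χ g = ((c * χ g : ℝ) : ℂ) := rfl

theorem integral_toComplexBump (c : ℝ) (χ : C_c(G, ℝ)) :
    ∫ g, toComplexBump c χ g ∂μ = ((c * ∫ g, χ g ∂μ : ℝ) : ℂ) := by
  simp only [toComplexBump_apply]
  rw [integral_complex_ofReal, integral_const_mul]

theorem exists_integral_eq_one : ∃ h : C_c(G, ℂ), ∫ g, h g ∂μ = 1 := by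
  obtain ⟨χ, h1, h2⟩ := exists_nonneg_bump (isCompact_singleton (x := (1 : G)))
  refine ⟨toComplexBump (∫ g, χ g ∂μ)⁻¹ χ, ?_⟩
  rw [integral_toComplexBump, inv_mul_cancel₀ (integral_pos_of_one μ (fun g => (h2 g).1)
    (h1 1 rfl)).ne', Complex.ofReal_one]

theorem integrate_toComplexBump (ρ : BanachRep.{u, v} G) (c : ℝ) (χ : C_c(G, ℝ)) (x : ρ.E) :
    ρ.integrate μ (toComplexBump c χ) x = c • ∫ g, χ g • ρ.π g x ∂μ := by
  rw [BanachRep.integrate_apply, ← integral_smul]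
  refine integral_congr_ae (.of_forall fun g => ?_)
  simp only [toComplexBump_apply]
  rw [Complex.coe_smul, mul_smul]

theorem integrable_bump_smul (ρ : BanachRep.{u, v} G) (χ : C_c(G, ℝ)) (x : ρ.E) :
    Integrable (fun g => χ g • ρ.π g x) μ :=
  (χ.continuous.smul (ρ.continuous_orbit x)).integrable_of_hasCompactSupport
    χ.hasCompactSupport.smul_right

/-- By left invariance, `π(q)` turns the `u`-average of the orbit into the average against a
translate of `u`, which is dominated by `χ`. The inequality `s ≤ τ/2 + s²/(2τ)` converts the
quadratic bound `J` into a bound on the mean distance to `y`. -/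
theorem norm_map_average_sub_le (ρ : BanachRep.{u, v} G) {χ u : C_c(G, ℝ)} (hu : ∀ g, 0 ≤ u g)
    {q : G} (hq : ∀ g, u (q⁻¹ * g) ≤ χ g) {a : ℝ} (ha : 0 < a) (hua : ∫ g, u g ∂μ = a)
    (x y : ρ.E) {τ J : ℝ} (hτ : 0 < τ) (hJ : ∫ g, χ g * ‖ρ.π g x - y‖ ^ 2 ∂μ ≤ J) :
    ‖ρ.π q (ρ.integrate μ (toComplexBump a⁻¹ u) x) - y‖ ≤ τ / 2 + J / (2 * τ * a) := by
  have huc := u.continuous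
  have hcont := ρ.continuous_orbit x
  have hsupp : HasCompactSupport fun g => u (q⁻¹ * g) :=
    u.hasCompactSupport.comp_homeomorph (Homeomorph.mulLeft q⁻¹)
  have hi1 : Integrable (fun g => u (q⁻¹ * g)) μ :=
    Continuous.integrable_of_hasCompactSupport (by fun_prop) hsupp
  have hi2 : Integrable (fun g => u (q⁻¹ * g) • ρ.π g x) μ :=
    Continuous.integrable_of_hasCompactSupport (by fun_prop) hsupp.smul_right
  have hi3 : Integrable (fun g => u (q⁻¹ * g) * ‖ρ.π g x - y‖ ^ 2) μ :=
    Continuous.integrable_of_hasCompactSupport (by fun_prop) hsupp.mul_right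
  have hi4 : Integrable (fun g => χ g * ‖ρ.π g x - y‖ ^ 2) μ :=
    Continuous.integrable_of_hasCompactSupport (by have := χ.continuous; fun_prop)
      χ.hasCompactSupport.mul_right
  have h_integ : ∫ g, u (q⁻¹ * g) ∂μ = a := by
    rw [integral_mul_left_eq_self (fun g => u g) q⁻¹, hua]
  have h1 : ρ.π q (ρ.integrate μ (toComplexBump a⁻¹ u) x)
      = a⁻¹ • ∫ g, u (q⁻¹ * g) • ρ.π g x ∂μ := by
    rw [integrate_toComplexBump, ContinuousLinearMap.map_smul_of_tower,
      ← ContinuousLinearMap.integral_comp_comm _ (integrable_bump_smul μ ρ u x),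
      ← integral_mul_left_eq_self (fun g => u (q⁻¹ * g) • ρ.π g x) q]
    congr 1
    refine integral_congr_ae (.of_forall fun g => ?_)
    simp
  have h2 : ρ.π q (ρ.integrate μ (toComplexBump a⁻¹ u) x) - y
      = a⁻¹ • ∫ g, u (q⁻¹ * g) • (ρ.π g x - y) ∂μ := by
    simp only [smul_sub]
    rw [integral_sub hi2 (hi1.smul_const y), integral_smul_const, h_integ, smul_sub, h1,
      inv_smul_smul₀ ha.ne']
  have h3 : ‖∫ g, u (q⁻¹ * g) • (ρ.π g x - y) ∂μ‖ ≤ τ / 2 * a + J / (2 * τ) := by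
    calc ‖∫ g, u (q⁻¹ * g) • (ρ.π g x - y) ∂μ‖
        ≤ ∫ g, (u (q⁻¹ * g) * (τ / 2) + (χ g * ‖ρ.π g x - y‖ ^ 2) * (1 / (2 * τ))) ∂μ := by
          refine norm_integral_le_of_norm_le ((hi1.mul_const _).add (hi4.mul_const _))
            (.of_forall fun g => ?_)
          rw [norm_smul, Real.norm_of_nonneg (hu _)]
          set s := ‖ρ.π g x - y‖
          have hs : s ≤ τ / 2 + s ^ 2 * (1 / (2 * τ)) := by
            rw [mul_one_div, div_add_div _ _ two_ne_zero (by positivity), le_div_iff₀ (by positivity)]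
            nlinarith [sq_nonneg (s - τ)]
          calc u (q⁻¹ * g) * s ≤ u (q⁻¹ * g) * (τ / 2 + s ^ 2 * (1 / (2 * τ))) :=
                mul_le_mul_of_nonneg_left hs (hu _)
            _ = u (q⁻¹ * g) * (τ / 2) + u (q⁻¹ * g) * (s ^ 2 * (1 / (2 * τ))) := by ring
            _ ≤ u (q⁻¹ * g) * (τ / 2) + χ g * (s ^ 2 * (1 / (2 * τ))) := by
                gcongr; exact hq g
            _ = _ := by ring
      _ ≤ _ := by
          rw [integral_add (hi1.mul_const _) (hi4.mul_const _), integral_mul_const,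
            integral_mul_const, h_integ, mul_comm a, mul_one_div]
          gcongr
  rw [h2, norm_smul, norm_inv, Real.norm_of_nonneg ha.le, inv_mul_le_iff₀ ha]
  refine h3.trans (le_of_eq ?_)
  field_simp

/-- If every nonzero vector is moved by `Q` by a definite amount, a suitable average is a strict
contraction. -/
theorem exists_contracting_average {Q : Set G} (hQ : IsCompact Q) {δ : ℝ} (hδ : 0 < δ) :
    ∃ f : C_c(G, ℂ), ∫ g, f g ∂μ = 1 ∧ ∃ κ : ℝ, 0 < κ ∧ κ < 1 ∧
      ∀ ρ : BanachRep.{u, v} G, ρ.IsUnitary →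
        (∀ x : ρ.E, x ≠ 0 → ∃ g ∈ Q, δ * ‖x‖ ≤ ‖ρ.π g x - x‖) →
        ∀ x, ‖ρ.integrate μ f x‖ ≤ (1 - κ) * ‖x‖ := by
  -- The average is taken against `χ`, which dominates every translate of the small bump `u` by `Q ∪
  -- {1}`. If the `χ`-mean `y` of the orbit of `x` were nearly as long as `x`, the `u`-mean `y₀` and
  -- all its translates by `Q` would be close to `y`, hence `y₀` would hardly move.
  obtain ⟨u, hu1, hu⟩ := exists_nonneg_bump (isCompact_singleton (x := (1 : G)))
  obtain ⟨χ, hχ1, hχ⟩ := exists_nonneg_bump ((hQ.insert 1).mul u.hasCompactSupport)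
  have huχ : ∀ q ∈ insert 1 Q, ∀ g, u (q⁻¹ * g) ≤ χ g := by
    intro q hq g
    by_cases hg : q⁻¹ * g ∈ tsupport u
    · rw [hχ1 g ⟨q, hq, q⁻¹ * g, hg, by group⟩]
      exact (hu _).2
    · rw [image_eq_zero_of_notMem_tsupport hg]
      exact (hχ g).1
  set a := ∫ g, u g ∂μ with ha_def
  set A := ∫ g, χ g ∂μ with hA_def
  have ha : 0 < a := integral_pos_of_one μ (fun g => (hu g).1) (hu1 1 rfl)
  have haA : a ≤ A := by
    refine integral_mono (u.continuous.integrable_of_hasCompactSupport u.hasCompactSupport)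
      (χ.continuous.integrable_of_hasCompactSupport χ.hasCompactSupport) fun g => ?_
    simpa using huχ 1 (Set.mem_insert _ _) g
  have hA : 0 < A := ha.trans_le haA
  set θ := min (1 / 8) (δ / 8)
  have hθ : 0 < θ := by positivity
  have hθ1 : θ ≤ 1 / 8 := min_le_left _ _
  have hθ2 : θ ≤ δ / 8 := min_le_right _ _
  -- With variance `J = 2Aκ‖x‖²` and `τ = θ‖x‖`, this value makes the two terms `τ/2` and `J/(2τa)`
  -- equal. The bound `θ ≤ δ/8` serves the final contradiction: `y₀` has norm at least `‖x‖/2` but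
  -- moves by at most `2θ‖x‖`.
  set κ := θ ^ 2 * a / (2 * A) with hκ_def
  have hκ : 0 < κ := by positivity
  have hκ1 : κ ≤ 1 / 8 := by
    have h1 : θ ^ 2 ≤ 1 / 64 := by nlinarith
    rw [hκ_def, div_le_iff₀ (by positivity)]
    nlinarith [mul_le_mul h1 haA ha.le (by norm_num)]
  refine ⟨toComplexBump A⁻¹ χ, ?_, κ, hκ, by linarith, fun ρ hρ hmove x => ?_⟩
  · rw [integral_toComplexBump, ← hA_def, inv_mul_cancel₀ hA.ne', Complex.ofReal_one]
  by_contra! hcon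
  set y := ρ.integrate μ (toComplexBump A⁻¹ χ) x with hy
  have hx : 0 < ‖x‖ := by
    rw [norm_pos_iff]
    rintro rfl
    simp [hy] at hcon
  have hJ : ∫ g, χ g * ‖ρ.π g x - y‖ ^ 2 ∂μ ≤ A * (2 * κ * ‖x‖ ^ 2) := by
    let _ : InnerProductSpace ℝ ρ.E := InnerProductSpace.ofNorm ℝ hρ.parallelogram
    have h := integral_norm_sub_mean_sq μ (χ := fun g => χ g) χ.continuous χ.hasCompactSupport (ρ.continuous_orbit x)
      (r := ‖x‖) (fun g => hρ.norm_map g x) hA_def.symm (y := y)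
      (by rw [hy, integrate_toComplexBump, smul_inv_smul₀ hA.ne'])
    rw [h]
    refine mul_le_mul_of_nonneg_left ?_ hA.le
    have h1 := pow_le_pow_left₀ (mul_nonneg (by linarith) hx.le) hcon.le 2
    nlinarith [mul_nonneg (sq_nonneg κ) (sq_nonneg ‖x‖)]
  set y₀ := ρ.integrate μ (toComplexBump a⁻¹ u) x
  have hclose : ∀ q ∈ insert 1 Q, ‖ρ.π q y₀ - y‖ ≤ θ * ‖x‖ := by
    intro q hq
    refine (norm_map_average_sub_le μ ρ (fun g => (hu g).1) (huχ q hq) ha rfl x y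
      (τ := θ * ‖x‖) (by positivity) hJ).trans (le_of_eq ?_)
    rw [hκ_def]
    field_simp
    ring
  have h1 : ‖y₀ - y‖ ≤ θ * ‖x‖ := by simpa using hclose 1 (Set.mem_insert _ _)
  have h2 : ‖x‖ / 2 ≤ ‖y₀‖ := by
    have : ‖y‖ ≤ ‖y₀‖ + ‖y₀ - y‖ := by
      calc ‖y‖ = ‖y₀ - (y₀ - y)‖ := by rw [sub_sub_cancel]
        _ ≤ _ := norm_sub_le _ _
    nlinarith
  obtain ⟨q, hq, hq'⟩ := hmove y₀ (norm_pos_iff.1 (by linarith))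
  have h3 : ‖ρ.π q y₀ - y₀‖ ≤ 2 * (θ * ‖x‖) := by
    calc ‖ρ.π q y₀ - y₀‖ = ‖(ρ.π q y₀ - y) - (y₀ - y)‖ := by rw [sub_sub_sub_cancel_right]
      _ ≤ ‖ρ.π q y₀ - y‖ + ‖y₀ - y‖ := norm_sub_le _ _
      _ ≤ _ := by linarith [hclose q (Set.mem_insert_of_mem _ hq)]
  nlinarith

/-- The restriction of a representation to a closed invariant subspace. -/
def BanachRep.subrep (ρ : BanachRep.{u, v} G) (W : Submodule ℂ ρ.E)
    (hW : IsClosed (W : Set ρ.E)) (hinv : ∀ g, ∀ x ∈ W, ρ.π g x ∈ W) : BanachRep.{u, v} G :=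
  haveI : CompleteSpace W := hW.completeSpace_coe
  { E := W
    π := restrictHom ρ.π W hinv
    continuous_orbit := fun x => Continuous.subtype_mk (ρ.continuous_orbit x) _ }

/-- The spectral gap: `π(f)` contracts a complement of the space of invariant vectors. -/
theorem IsKazhdanPair.exists_spectral_gap {Q : Set G} {δ : ℝ} (hK : IsKazhdanPair.{u, v} Q δ)
    (hQ : IsCompact Q) (hδ : 0 < δ) :
    ∃ f : C_c(G, ℂ), ∫ g, f g ∂μ = 1 ∧ ∃ κ : ℝ, 0 < κ ∧ κ < 1 ∧
      ∀ ρ : BanachRep.{u, v} G, ρ.IsUnitary → ∀ x : ρ.E, ∃ z ∈ ρ.invariants,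
        (∃ r, (r = 0 ∨ ∃ g ∈ Q, r = ‖ρ.π g x - x‖) ∧ δ * ‖x - z‖ ≤ r) ∧
        ∀ m : ℕ, ‖(ρ.integrate μ f ^ m) (x - z)‖ ≤ (1 - κ) ^ m * ‖x - z‖ := by
  obtain ⟨f, hf, κ, hκ, hκ1, hgap⟩ := exists_contracting_average.{u, v} μ hQ hδ
  refine ⟨f, hf, κ, hκ, hκ1, fun ρ hρ x => ?_⟩
  obtain ⟨W, hW, hinv, h1, h2⟩ := hK.exists_complement hρ
  obtain ⟨z, hz, hxz⟩ := h1 x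
  -- The integral over the subrepresentation `W` maps to the integral in `E` under the inclusion,
  -- which shows both that `π(f)` preserves `W` and that it contracts there.
  have hgapW : ∀ w ∈ W, ρ.integrate μ f w ∈ W ∧
      ‖ρ.integrate μ f w‖ ≤ (1 - κ) * ‖w‖ := by
    intro w hw
    let ρW := ρ.subrep W hW hinv
    have hu : ρW.IsUnitary := ⟨fun x y => hρ.parallelogram (x : W).1 (y : W).1,
      fun g x => hρ.norm_map g (x : W).1⟩
    have h := hgap ρW hu (fun x hx => h2 (x : W).1 (x : W).2 fun h0 => hx (Subtype.ext h0))
      (⟨w, hw⟩ : W)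
    have hmap := BanachRep.map_integrate μ (ρ := ρW) (ρ' := ρ) W.subtypeL (fun g x => rfl) f
      (⟨w, hw⟩ : W)
    obtain ⟨w', hw', hle⟩ : ∃ w' : W, (w' : ρ.E) = ρ.integrate μ f w ∧
        ‖(w' : ρ.E)‖ ≤ (1 - κ) * ‖w‖ := ⟨ρW.integrate μ f (⟨w, hw⟩ : W), hmap, h⟩
    rw [← hw']
    exact ⟨w'.2, hle⟩
  refine ⟨z, hz, ?_, ?_⟩
  · by_cases h0 : x - z = 0
    -- The alternative `r = 0` is needed because `Q` may be empty.
    · exact ⟨0, Or.inl rfl, by simp [h0]⟩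
    · obtain ⟨g, hg, hle⟩ := h2 _ hxz h0
      rw [map_sub, hz g, sub_sub_sub_cancel_right] at hle
      exact ⟨_, Or.inr ⟨g, hg, rfl⟩, hle⟩
  · have key : ∀ m : ℕ, (ρ.integrate μ f ^ m) (x - z) ∈ W ∧
        ‖(ρ.integrate μ f ^ m) (x - z)‖ ≤ (1 - κ) ^ m * ‖x - z‖ := by
      intro m
      induction m with
      | zero => simpa using hxz
      | succ m ih =>
        rw [pow_succ', mul_apply_eq_comp]
        refine ⟨(hgapW _ ih.1).1, (hgapW _ ih.1).2.trans ?_⟩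
        rw [pow_succ', mul_assoc]
        exact mul_le_mul_of_nonneg_left ih.2 (by linarith)
    exact fun m => (key m).2

end Gap

/-! ### The Gaussian kernel on a Hilbert space -/

section Kernel

open scoped ComplexOrder Matrix

variable {X : Type v}

theorem posSemidef_of_inner {H : Type*} [NormedAddCommGroup H] [InnerProductSpace ℂ H]
    (w : X → H) : (Matrix.of fun i j => inner ℂ (w i) (w j)).PosSemidef := by
  refine ⟨Matrix.ext fun i j => inner_conj_symm _ _, fun c => ?_⟩
  have h : (c.sum fun i a => c.sum fun j b =>
      star a * (Matrix.of fun i j => inner ℂ (w i) (w j)) i j * b)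
      = inner ℂ (c.sum fun i a => a • w i) (c.sum fun i a => a • w i) := by
    simp only [Finsupp.sum]
    rw [sum_inner]
    refine Finset.sum_congr rfl fun i _ => ?_
    rw [inner_sum]
    refine Finset.sum_congr rfl fun j _ => ?_
    rw [inner_smul_left, inner_smul_right, Matrix.of_apply, RCLike.star_def]
    ring
  rw [h, inner_self_eq_norm_sq_to_K]
  have h0 := Complex.zero_le_real.2 (sq_nonneg ‖c.sum fun i a => a • w i‖)
  rw [Complex.ofReal_pow] at h0
  exact h0

theorem posSemidef_pow_entries {A : Matrix X X ℂ} (hA : A.PosSemidef) (k : ℕ) :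
    (Matrix.of fun i j => A i j ^ k).PosSemidef := by
  induction k with
  | zero =>
    convert posSemidef_of_inner (X := X) (H := ℂ) fun _ => 1 using 1
    ext i j
    simp
  | succ k ih =>
    have h : (Matrix.of fun i j => A i j ^ (k + 1)) = (Matrix.of fun i j => A i j ^ k) ⊙ A := by
      ext i j
      simp [pow_succ]
    rw [h]
    exact ih.hadamard hA

/-- Entrywise powers are positive by the Schur product theorem, hence so are the partial sums of the
exponential series. Positivity passes to entrywise limits because each test vector is finitely
supported. -/
theorem posSemidef_exp_entries {A : Matrix X X ℂ} (hA : A.PosSemidef) :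
    (Matrix.of fun i j => Complex.exp (A i j)).PosSemidef := by
  have hpart : ∀ n : ℕ,
      (∑ k ∈ Finset.range n, ((k.factorial : ℂ)⁻¹) • Matrix.of fun i j => A i j ^ k).PosSemidef :=
    fun n => Matrix.posSemidef_sum _ fun k _ => (posSemidef_pow_entries hA k).smul
      (inv_nonneg.2 (by exact_mod_cast Nat.zero_le _))
  have hent : ∀ i j, Tendsto (fun n : ℕ =>
      (∑ k ∈ Finset.range n, ((k.factorial : ℂ)⁻¹) • Matrix.of fun i j => A i j ^ k) i j) atTop
      (𝓝 (Complex.exp (A i j))) := by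
    intro i j
    have h := (NormedSpace.expSeries_div_hasSum_exp (A i j)).tendsto_sum_nat
    rw [← Complex.exp_eq_exp_ℂ] at h
    refine h.congr fun n => ?_
    rw [Matrix.sum_apply]
    refine Finset.sum_congr rfl fun k _ => ?_
    simp [div_eq_inv_mul]
  refine ⟨Matrix.ext fun i j => ?_, fun c => ?_⟩
  · have h := hA.isHermitian.apply i j
    simp only [Matrix.conjTranspose_apply, Matrix.of_apply]
    rw [← h]
    simp only [RCLike.star_def, Complex.exp_conj]
  · refine ge_of_tendsto' (f := fun n : ℕ => c.sum fun i a => c.sum fun j b => star a *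
      (∑ k ∈ Finset.range n, ((k.factorial : ℂ)⁻¹) • Matrix.of fun i j => A i j ^ k) i j * b)
      (x := atTop) ?_ fun n => (hpart n).2 c
    exact tendsto_finsetSum _ fun i _ => tendsto_finsetSum _ fun j _ =>
      ((hent i j).const_mul _).mul_const _

/-- The Gaussian kernel `exp (-t ‖x - y‖²)`. -/
def gaussianKernel (H : Type v) [NormedAddCommGroup H] (t : ℝ) : Matrix H H ℂ :=
  Matrix.of fun x y => ((Real.exp (-(t * ‖x - y‖ ^ 2)) : ℝ) : ℂ)

/-- Expanding the square, the kernel is the entrywise product of the rank-one kernel `exp(-t‖x‖²)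
exp(-t‖y‖²)` and the entrywise exponential of the positive kernel `t(⟪x,y⟫ + ⟪y,x⟫)`. -/
theorem posSemidef_gaussianKernel (H : Type v) [NormedAddCommGroup H] [InnerProductSpace ℂ H]
    {t : ℝ} (ht : 0 ≤ t) : (gaussianKernel H t).PosSemidef := by
  have h1 := posSemidef_of_inner (X := H) (H := ℂ) fun x => ((Real.exp (-(t * ‖x‖ ^ 2)) : ℝ) : ℂ)
  have h2 := posSemidef_of_inner (X := H) (H := H) id
  have h3 := posSemidef_exp_entries ((h2.add h2.transpose).smul
    (show (0 : ℂ) ≤ (t : ℂ) by exact_mod_cast ht))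
  refine (congrArg Matrix.PosSemidef (Matrix.ext fun x y => ?_)).mpr (h1.hadamard h3)
  have h4 : inner ℂ x y + inner ℂ y x = ((2 * (inner ℂ x y).re : ℝ) : ℂ) := by
    rw [← inner_conj_symm y x, Complex.add_conj]
  simp only [gaussianKernel, Matrix.of_apply, Matrix.hadamard_apply, Matrix.smul_apply,
    Matrix.add_apply, Matrix.transpose_apply, id, h4, smul_eq_mul, RCLike.inner_apply,
    Complex.conj_ofReal]
  rw [← Complex.ofReal_mul, ← Complex.ofReal_mul, ← Complex.ofReal_exp, ← Complex.ofReal_mul,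
    ← Real.exp_add, ← Real.exp_add]
  congr 2
  have := norm_sub_sq (𝕜 := ℂ) x y
  simp only [RCLike.re_to_complex] at this
  rw [this]
  ring

/-- The sesquilinear form defined by a kernel on finitely supported functions. -/
def kernelForm (K : Matrix X X ℂ) (c d : X →₀ ℂ) : ℂ :=
  c.sum fun i a => d.sum fun j b => star a * K i j * b

theorem kernelForm_add_left (K : Matrix X X ℂ) (c d e : X →₀ ℂ) :
    kernelForm K (c + d) e = kernelForm K c e + kernelForm K d e := by
  unfold kernelForm
  rw [Finsupp.sum_add_index'] <;> simp [← Finsupp.sum_add, add_mul]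

theorem kernelForm_add_right (K : Matrix X X ℂ) (c d e : X →₀ ℂ) :
    kernelForm K c (d + e) = kernelForm K c d + kernelForm K c e := by
  unfold kernelForm
  rw [← Finsupp.sum_add]
  refine Finsupp.sum_congr fun i _ => ?_
  rw [Finsupp.sum_add_index'] <;> simp [mul_add]

theorem kernelForm_smul_left (K : Matrix X X ℂ) (r : ℂ) (c d : X →₀ ℂ) :
    kernelForm K (r • c) d = (starRingEnd ℂ) r * kernelForm K c d := by
  unfold kernelForm
  rw [Finsupp.sum_smul_index] <;> simp [Finsupp.mul_sum, mul_assoc]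

theorem kernelForm_single (K : Matrix X X ℂ) (x y : X) (a b : ℂ) :
    kernelForm K (Finsupp.single x a) (Finsupp.single y b) = star a * K x y * b := by
  unfold kernelForm
  rw [Finsupp.sum_single_index, Finsupp.sum_single_index] <;> simp

theorem kernelForm_mapDomain (K : Matrix X X ℂ) {σ : X → X} (hσ : ∀ x y, K (σ x) (σ y) = K x y)
    (c d : X →₀ ℂ) : kernelForm K (c.mapDomain σ) (d.mapDomain σ) = kernelForm K c d := by
  unfold kernelForm
  rw [Finsupp.sum_mapDomain_index (by simp) (by simp [← Finsupp.sum_add, add_mul])]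
  refine Finsupp.sum_congr fun i _ => ?_
  rw [Finsupp.sum_mapDomain_index (by simp) (by simp [mul_add])]
  simp only [hσ]

/-- The GNS construction before separation and completion. Only the seminorm and its parallelogram
law are kept, as that is the input of `exists_unitary_of_seminorm`. -/
theorem exists_kernel_seminorm {K : Matrix X X ℂ} (hK : K.PosSemidef) :
    ∃ p : Seminorm ℂ (X →₀ ℂ), (∀ c, p c * p c = (kernelForm K c c).re) ∧
      ∀ x y, p (x + y) * p (x + y) + p (x - y) * p (x - y) = 2 * (p x * p x + p y * p y) := by
  let core : PreInnerProductSpace.Core ℂ (X →₀ ℂ) :=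
    { inner := kernelForm K
      conj_inner_symm := fun c d => by
        unfold kernelForm
        rw [Finsupp.sum_comm]
        simp only [map_finsuppSum]
        refine Finsupp.sum_congr fun i _ => Finsupp.sum_congr fun j _ => ?_
        rw [← hK.isHermitian.apply i j]
        simp only [RCLike.star_def, map_mul, Complex.conj_conj]
        ring
      re_inner_nonneg := fun c => (Complex.le_def.1 (hK.2 c)).1
      add_left := kernelForm_add_left K
      smul_left := fun c d r => kernelForm_smul_left K r c d }
  let _ : SeminormedAddCommGroup (X →₀ ℂ) := InnerProductSpace.Core.toSeminormedAddCommGroup (𝕜 := ℂ)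
  let _ : InnerProductSpace ℂ (X →₀ ℂ) := .ofCore core
  exact ⟨normSeminorm ℂ (X →₀ ℂ), fun c => (inner_self_eq_norm_mul_norm (𝕜 := ℂ) c).symm,
    fun x y => by
      have h := parallelogram_law_with_norm ℂ x y
      simp only [pow_two] at h
      exact h⟩

theorem kernelForm_single_sub_single {H : Type v} [NormedAddCommGroup H] (t : ℝ) (x y : H)
    (a : ℂ) : (kernelForm (gaussianKernel H t) (Finsupp.single x a - Finsupp.single y a)
      (Finsupp.single x a - Finsupp.single y a)).re
      = ‖a‖ ^ 2 * (2 - 2 * Real.exp (-(t * ‖x - y‖ ^ 2))) := by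
  rw [sub_eq_add_neg, ← Finsupp.single_neg]
  simp only [kernelForm_add_left, kernelForm_add_right, kernelForm_single, gaussianKernel,
    Matrix.of_apply, sub_self, norm_zero]
  rw [norm_sub_rev y x]
  have h : star a * a = ((‖a‖ ^ 2 : ℝ) : ℂ) := by
    rw [RCLike.star_def, Complex.conj_mul']
    push_cast
    rfl
  generalize Real.exp (-(t * ‖x - y‖ ^ 2)) = s
  have h2 : star a * ((Real.exp (-(t * 0 ^ 2)) : ℝ) : ℂ) * a + star (-a) * (s : ℂ) * a +
      (star a * (s : ℂ) * -a + star (-a) * ((Real.exp (-(t * 0 ^ 2)) : ℝ) : ℂ) * -a)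
      = ((‖a‖ ^ 2 * (2 - 2 * s) : ℝ) : ℂ) := by
    push_cast
    rw [star_neg]
    push_cast at h
    norm_num
    rw [RCLike.star_def] at h
    linear_combination (2 - 2 * (s : ℂ)) * h
  rw [h2, Complex.ofReal_re]

end Kernel

/-! ### Cocycles of unitary representations -/

section Cocycle

variable {G : Type u} [Group G] [TopologicalSpace G]

/-- A continuous cocycle of a representation. -/
structure BanachRep.IsCocycle (ρ : BanachRep.{u, v} G) (b : G → ρ.E) : Prop where
  continuous : Continuous b
  map_mul : ∀ g h, b (g * h) = b g + ρ.π g (b h)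

theorem BanachRep.IsCocycle.map_one {ρ : BanachRep.{u, v} G} {b : G → ρ.E}
    (hb : ρ.IsCocycle b) : b 1 = 0 := by
  simpa using hb.map_mul 1 1

/-- A bounded cocycle of a unitary representation is a coboundary. -/
theorem BanachRep.IsUnitary.exists_coboundary_of_bounded {ρ : BanachRep.{u, v} G}
    (hρ : ρ.IsUnitary) {b : G → ρ.E} (hb : ρ.IsCocycle b) {R : ℝ} (hR : ∀ g, ‖b g‖ ≤ R) :
    ∃ x, ∀ g, b g = ρ.π g x - x := by
  -- The median identity. The point sought is the Chebyshev center of the set of values of `b`, and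
  -- this identity forces almost-centers to be close to one another.
  have hmid : ∀ (x y w : ρ.E),
      ‖x - y‖ ^ 2 = 2 * ‖x - w‖ ^ 2 + 2 * ‖y - w‖ ^ 2 - 4 * ‖(1 / 2 : ℂ) • (x + y) - w‖ ^ 2 := by
    intro x y w
    have h := hρ.parallelogram (x - w) (y - w)
    have h1 : x - w + (y - w) = (2 : ℂ) • ((1 / 2 : ℂ) • (x + y) - w) := by
      rw [smul_sub, smul_smul]; norm_num; rw [two_smul]; abel
    rw [h1, norm_smul, sub_sub_sub_cancel_right] at h
    norm_num at h ⊢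
    linarith
  -- Squared radii of balls containing all values of `b`; the infimum `r₀` is the squared
  -- circumradius.
  let D : Set ℝ := {r | ∃ x, ∀ g, ‖x - b g‖ ^ 2 ≤ r}
  have hDne : D.Nonempty := ⟨R ^ 2, 0, fun g => by
    rw [zero_sub, norm_neg]
    exact pow_le_pow_left₀ (norm_nonneg _) (hR g) 2⟩
  have hDbdd : BddBelow D := ⟨0, by
    rintro r ⟨x, hx⟩
    exact (sq_nonneg _).trans (hx 1)⟩
  set r₀ := sInf D
  have hclose : ∀ x y r s, (∀ g, ‖x - b g‖ ^ 2 ≤ r) → (∀ g, ‖y - b g‖ ^ 2 ≤ s) →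
      ‖x - y‖ ^ 2 ≤ 2 * r + 2 * s - 4 * r₀ := by
    intro x y r s hx hy
    have hmem : (2 * r + 2 * s - ‖x - y‖ ^ 2) / 4 ∈ D :=
      ⟨(1 / 2 : ℂ) • (x + y), fun g => by
        have := hmid x y (b g)
        rw [le_div_iff₀ (by norm_num)]
        linarith [hx g, hy g]⟩
    have := csInf_le hDbdd hmem
    rw [le_div_iff₀ (by norm_num)] at this
    linarith
  have hseq : ∀ n : ℕ, ∃ x, ∀ g, ‖x - b g‖ ^ 2 ≤ r₀ + 1 / ((n : ℝ) + 1) := by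
    intro n
    obtain ⟨r, ⟨x, hx⟩, hr⟩ := exists_lt_of_csInf_lt hDne
      (show sInf D < r₀ + 1 / ((n : ℝ) + 1) from lt_add_of_pos_right _ (by positivity))
    exact ⟨x, fun g => (hx g).trans hr.le⟩
  choose x hx using hseq
  have hcauchy : CauchySeq x := by
    rw [Metric.cauchySeq_iff']
    intro η hη
    obtain ⟨N, hN⟩ := exists_nat_one_div_lt (show 0 < η ^ 2 / 4 by positivity)
    refine ⟨N, fun n hn => ?_⟩
    have h1 := hclose _ _ _ _ (hx n) (hx N)
    have h2 : 1 / ((n : ℝ) + 1) ≤ 1 / ((N : ℝ) + 1) := by gcongr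
    rw [dist_eq_norm]
    refine lt_of_pow_lt_pow_left₀ 2 hη.le ?_
    linarith
  obtain ⟨y, hy⟩ := cauchySeq_tendsto_of_complete hcauchy
  have hyr : ∀ g, ‖y - b g‖ ^ 2 ≤ r₀ := by
    intro g
    have h1 : Tendsto (fun n => ‖x n - b g‖ ^ 2) atTop (𝓝 (‖y - b g‖ ^ 2)) :=
      ((hy.sub_const _).norm).pow 2
    have h2 : Tendsto (fun n : ℕ => r₀ + 1 / ((n : ℝ) + 1)) atTop (𝓝 (r₀ + 0)) :=
      tendsto_one_div_add_atTop_nhds_zero_nat.const_add _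
    rw [add_zero] at h2
    exact le_of_tendsto_of_tendsto' h1 h2 fun n => hx n g
  -- The isometry `x ↦ π(g)x + b(g)` permutes the values of `b`, so it carries the center to a
  -- center, and the center is unique.
  have hfix : ∀ g, ρ.π g y + b g = y := by
    intro g
    have h1 : ∀ k, ‖ρ.π g y + b g - b k‖ ^ 2 ≤ r₀ := by
      intro k
      have h2 : b k = b g + ρ.π g (b (g⁻¹ * k)) := by
        rw [← hb.map_mul, mul_inv_cancel_left]
      have h3 : ρ.π g y + b g - b k = ρ.π g (y - b (g⁻¹ * k)) := by
        rw [h2, map_sub]; abel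
      rw [h3, hρ.norm_map]
      exact hyr _
    have h4 := hclose _ _ _ _ h1 hyr
    have h5 : ‖ρ.π g y + b g - y‖ ^ 2 = 0 := le_antisymm (by linarith) (sq_nonneg _)
    exact sub_eq_zero.1 (norm_eq_zero.1 (pow_eq_zero_iff two_ne_zero |>.1 h5))
  refine ⟨-y, fun g => ?_⟩
  rw [map_neg, sub_neg_eq_add, eq_neg_add_iff_add_eq, hfix]

variable [IsTopologicalGroup G]

/-- The isometric affine action defined by `b` preserves the Gaussian kernel, so it becomes a
unitary representation on the Hilbert space of that kernel. For small `t` the vector `ξ` attached to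
the origin is almost invariant under `Q`, hence close to an invariant vector, hence moved little by
all of `G`. The displacement of `ξ` under `g` determines `‖b g‖`, which is therefore bounded. -/
theorem IsKazhdanPair.bounded_cocycle {Q : Set G} {δ : ℝ} (hK : IsKazhdanPair.{u, v} Q δ)
    (hQ : IsCompact Q) (hδ : 0 < δ) {ρ : BanachRep.{u, v} G} (hρ : ρ.IsUnitary) {b : G → ρ.E}
    (hb : ρ.IsCocycle b) : ∃ R : ℝ, ∀ g, ‖b g‖ ≤ R := by
  obtain ⟨B, hB⟩ := hQ.exists_bound_of_continuousOn hb.continuous.continuousOn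
  -- Chosen so that `2 - 2 exp(-t‖b g‖²) ≤ 2t‖b g‖² ≤ (δ/4)²` on `Q`. The summand 1 avoids division
  -- by zero.
  set t : ℝ := δ ^ 2 / (32 * (B ^ 2 + 1)) with ht_def
  have ht : 0 < t := by positivity
  let _ : InnerProductSpace ℂ ρ.E := InnerProductSpace.ofNorm ℂ hρ.parallelogram
  obtain ⟨p, hp, hpar⟩ := exists_kernel_seminorm (posSemidef_gaussianKernel ρ.E ht.le)
  have hps : ∀ (x y : ρ.E) (a : ℂ), p (Finsupp.single x a - Finsupp.single y a) ^ 2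
      = ‖a‖ ^ 2 * (2 - 2 * Real.exp (-(t * ‖x - y‖ ^ 2))) := fun x y a => by
    rw [pow_two, hp, kernelForm_single_sub_single]
  let σ : G → ρ.E → ρ.E := fun g x => ρ.π g x + b g
  have hσ_mul : ∀ g h, σ (g * h) = σ g ∘ σ h := fun g h => by
    funext x
    simp only [σ, Function.comp_apply, hb.map_mul, map_mul, mul_apply_eq_comp, map_add]
    abel
  have hσ_iso : ∀ g x y, ‖σ g x - σ g y‖ = ‖x - y‖ := fun g x y => by
    simp only [σ, add_sub_add_right_eq_sub, ← map_sub, hρ.norm_map]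
  have hσ_cont : ∀ x, Continuous fun g => σ g x := fun x =>
    (ρ.continuous_orbit x).add hb.continuous
  have hσ_one : σ 1 = id := by
    funext x
    simp [σ, hb.map_one]
  let π' : G →* ((ρ.E →₀ ℂ) →ₗ[ℂ] (ρ.E →₀ ℂ)) :=
    { toFun := fun g => Finsupp.lmapDomain ℂ ℂ (σ g)
      map_one' := by rw [hσ_one]; exact Finsupp.lmapDomain_id ℂ ℂ
      map_mul' := fun g h => by rw [hσ_mul]; exact Finsupp.lmapDomain_comp ℂ ℂ _ _ }
  have hπ' : ∀ g x (a : ℂ), π' g (Finsupp.single x a) = Finsupp.single (σ g x) a :=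
    fun g x a => Finsupp.mapDomain_single
  have hinv : ∀ g c, p (π' g c) = p c := by
    intro g c
    have h : p (π' g c) * p (π' g c) = p c * p c := by
      rw [hp, hp]
      change (kernelForm _ (c.mapDomain (σ g)) (c.mapDomain (σ g))).re = _
      rw [kernelForm_mapDomain]
      intro x y
      simp only [gaussianKernel, Matrix.of_apply, hσ_iso]
    exact (mul_self_inj (apply_nonneg p _) (apply_nonneg p _)).1 h
  have hcont : ∀ c, Tendsto (fun g => p (π' g c - c)) (𝓝 1) (𝓝 0) := by
    intro c
    induction c using Finsupp.induction_linear with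
    | zero => simp
    | add c d hc hd =>
      refine squeeze_zero (fun g => apply_nonneg p _) (fun g => ?_) (by simpa using hc.add hd)
      have : π' g (c + d) - (c + d) = (π' g c - c) + (π' g d - d) := by rw [map_add]; abel
      rw [this]
      exact map_add_le_add p _ _
    | single x a =>
      have h1 : ∀ g, p (π' g (Finsupp.single x a) - Finsupp.single x a)
          = √(‖a‖ ^ 2 * (2 - 2 * Real.exp (-(t * ‖σ g x - x‖ ^ 2)))) := fun g => by
        rw [hπ', ← hps, Real.sqrt_sq (apply_nonneg p _)]
      simp only [h1]
      have h2 : Continuous fun g =>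
          √(‖a‖ ^ 2 * (2 - 2 * Real.exp (-(t * ‖σ g x - x‖ ^ 2)))) := by
        have := hσ_cont x
        fun_prop
      have h3 := h2.tendsto 1
      simpa [hσ_one] using h3
  obtain ⟨ρ', hρ', T, hT, hTπ⟩ := exists_unitary_of_seminorm p hpar π' hinv hcont
  set ξ := T (Finsupp.single 0 1)
  have hξ : ∀ g, ‖ρ'.π g ξ - ξ‖ ^ 2 = 2 - 2 * Real.exp (-(t * ‖b g‖ ^ 2)) := by
    intro g
    have h := hps (σ g 0) 0 1
    rw [← hTπ, ← map_sub, hT, hπ', h]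
    simp [σ]
  have hsmall : ∀ g ∈ Q, ‖ρ'.π g ξ - ξ‖ ≤ δ / 4 := by
    intro g hg
    refine le_of_sq_le_sq ?_ (by positivity)
    rw [hξ]
    have h1 := Real.add_one_le_exp (-(t * ‖b g‖ ^ 2))
    have h2 : ‖b g‖ ^ 2 ≤ B ^ 2 + 1 := by
      linarith [pow_le_pow_left₀ (norm_nonneg _) (hB g hg) 2]
    have h3 : t * ‖b g‖ ^ 2 ≤ δ ^ 2 / 32 := by
      calc t * ‖b g‖ ^ 2 ≤ t * (B ^ 2 + 1) := by gcongr
        _ = δ ^ 2 / 32 := by rw [ht_def]; field_simp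
    nlinarith
  obtain ⟨z, hz, hzle⟩ := hK.exists_invariant_near hρ' (by positivity) hsmall
  have hz4 : ‖ξ - z‖ ≤ 1 / 4 := by
    by_contra! h
    nlinarith
  refine ⟨1 / t + 1, fun g => ?_⟩
  have h1 : ‖ρ'.π g ξ - ξ‖ ≤ 1 / 2 := by
    calc ‖ρ'.π g ξ - ξ‖ = ‖ρ'.π g (ξ - z) - (ξ - z)‖ := by
          rw [map_sub, hz g, sub_sub_sub_cancel_right]
      _ ≤ ‖ρ'.π g (ξ - z)‖ + ‖ξ - z‖ := norm_sub_le _ _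
      _ ≤ 1 / 2 := by rw [hρ'.norm_map]; linarith
  have h2 : ‖ρ'.π g ξ - ξ‖ ^ 2 ≤ (1 / 2) ^ 2 := pow_le_pow_left₀ (norm_nonneg _) h1 2
  rw [hξ] at h2
  -- By `h2`, `exp(-t‖b g‖²) ≥ 7/8`, so `exp(t‖b g‖²) ≤ 8/7` and the exponent is at most 1.
  have h3 := Real.add_one_le_exp (t * ‖b g‖ ^ 2)
  have h4 : Real.exp (t * ‖b g‖ ^ 2) * Real.exp (-(t * ‖b g‖ ^ 2)) = 1 := by
    rw [← Real.exp_add, add_neg_cancel, Real.exp_zero]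
  have h5 : t * ‖b g‖ ^ 2 ≤ 1 := by
    have h6 : 0 ≤ t * ‖b g‖ ^ 2 := by positivity
    nlinarith [Real.exp_pos (-(t * ‖b g‖ ^ 2))]
  have h6 : ‖b g‖ ^ 2 ≤ 1 / t := by rw [le_div_iff₀ ht]; linarith
  nlinarith [sq_nonneg (‖b g‖ - 1)]

/-- Every cocycle of a unitary representation of a group with a Kazhdan pair is a coboundary. -/
theorem IsKazhdanPair.exists_coboundary {Q : Set G} {δ : ℝ} (hK : IsKazhdanPair.{u, v} Q δ)
    (hQ : IsCompact Q) (hδ : 0 < δ) {ρ : BanachRep.{u, v} G} (hρ : ρ.IsUnitary) {b : G → ρ.E}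
    (hb : ρ.IsCocycle b) : ∃ x, ∀ g, b g = ρ.π g x - x := by
  obtain ⟨R, hR⟩ := hK.bounded_cocycle hQ hδ hρ hb
  exact hρ.exists_coboundary_of_bounded hb hR

end Cocycle

/-! ### Estimates for cocycles and their averages -/

section CocycleEstimates

variable {G : Type u} [Group G] [TopologicalSpace G]

/-- The change of a cocycle under a change of base point. -/
theorem BanachRep.IsCocycle.shift {ρ : BanachRep.{u, v} G} {b : G → ρ.E} (hb : ρ.IsCocycle b)
    (x : ρ.E) : ρ.IsCocycle fun g => b g + ρ.π g x - x where
  continuous := (hb.continuous.add (ρ.continuous_orbit x)).sub continuous_const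
  map_mul g h := by
    simp only [hb.map_mul, _root_.map_mul, mul_apply_eq_comp, map_add, map_sub]
    abel

theorem BanachRep.isCocycle_coboundary (ρ : BanachRep.{u, v} G) (x : ρ.E) :
    ρ.IsCocycle fun g => ρ.π g x - x where
  continuous := (ρ.continuous_orbit x).sub continuous_const
  map_mul g h := by
    simp only [map_mul, mul_apply_eq_comp, map_sub]
    abel

theorem BanachRep.IsCocycle.norm_le_of_mem_pow {S : Set G} {ρ : BanachRep.{u, v} G} {b : G → ρ.E}
    (hb : ρ.IsCocycle b) {A M : ℝ} (hA : 1 ≤ A) (hπ : ∀ s ∈ S, ‖ρ.π s‖ ≤ A)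
    (hM : ∀ s ∈ S, ‖b s‖ ≤ M) (hM0 : 0 ≤ M) {n : ℕ} {g : G} (hg : g ∈ S ^ n) :
    ‖b g‖ ≤ n * A ^ n * M := by
  induction n generalizing g with
  | zero =>
    rw [pow_zero, Set.mem_one] at hg
    simp [hg, hb.map_one]
  | succ n ih =>
    rw [pow_succ'] at hg
    obtain ⟨s, hs, h, hh, rfl⟩ := hg
    have h1 : ‖b (s * h)‖ ≤ M + A * (n * A ^ n * M) := by
      rw [hb.map_mul]
      refine (norm_add_le _ _).trans (add_le_add (hM s hs) ?_)
      refine ((ρ.π s).le_of_opNorm_le (hπ s hs) _).trans ?_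
      exact mul_le_mul_of_nonneg_left (ih hh) (by linarith)
    refine h1.trans ?_
    have h2 : 1 ≤ A ^ (n + 1) := one_le_pow₀ hA
    push_cast
    have h3 : M ≤ A ^ (n + 1) * M := le_mul_of_one_le_left hM0 h2
    calc M + A * (n * A ^ n * M) ≤ A ^ (n + 1) * M + A * (n * A ^ n * M) := by linarith
      _ = _ := by rw [pow_succ]; ring

variable [IsTopologicalGroup G] [T2Space G] [LocallyCompactSpace G]

/-- The constant depends only on `K`, `S` and `A`, not on the representation or the cocycle. This
uniformity is what permits passing to limits of sequences of representations. -/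
theorem IsCompactGeneratingSet.exists_cocycle_bound {S : Set G} (hS : IsCompactGeneratingSet S)
    {K : Set G} (hK : IsCompact K) {A : ℝ} (hA : 1 ≤ A) :
    ∃ C : ℝ, 0 ≤ C ∧ ∀ (ρ : BanachRep.{u, v} G), (∀ s ∈ S, ‖ρ.π s‖ ≤ A) → ∀ b, ρ.IsCocycle b →
      ∀ M : ℝ, 0 ≤ M → (∀ s ∈ S, ‖b s‖ ≤ M) → ∀ g ∈ K, ‖b g‖ ≤ C * M := by
  obtain ⟨N, hN⟩ := hS.wordLength_bounded hK
  refine ⟨N * A ^ N, by positivity, fun ρ hπ b hb M hM0 hM g hg => ?_⟩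
  have hmem : g ∈ S ^ wordLength S g := Nat.sInf_mem (hS.exists_mem_pow g)
  refine (hb.norm_le_of_mem_pow hA hπ hM hM0 hmem).trans ?_
  have h1 : (wordLength S g : ℝ) ≤ N := by exact_mod_cast hN g hg
  have h2 : A ^ wordLength S g ≤ A ^ N := pow_le_pow_right₀ hA (hN g hg)
  gcongr

theorem IsCompactGeneratingSet.eq_zero_of_cocycle {S : Set G} (hS : IsCompactGeneratingSet S)
    {ρ : BanachRep.{u, v} G} {b : G → ρ.E} (hb : ρ.IsCocycle b) (h : ∀ s ∈ S, b s = 0) (g : G) :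
    b g = 0 := by
  obtain ⟨n, hn⟩ := hS.exists_mem_pow g
  induction n generalizing g with
  | zero =>
    rw [pow_zero, Set.mem_one] at hn
    rw [hn, hb.map_one]
  | succ n ih =>
    rw [pow_succ'] at hn
    obtain ⟨s, hs, k, hk, rfl⟩ := hn
    change b (s * k) = 0
    rw [hb.map_mul, h s hs, ih k hk, map_zero, add_zero]

variable [MeasurableSpace G] [BorelSpace G] (μ : Measure G) [μ.IsHaarMeasure]

theorem integrable_smul_of_continuous {E : Type v} [NormedAddCommGroup E] [NormedSpace ℂ E]
    (f : C_c(G, ℂ)) {b : G → E} (hb : Continuous b) : Integrable (fun g => f g • b g) μ :=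
  (f.continuous.smul hb).integrable_of_hasCompactSupport f.hasCompactSupport.smul_right

theorem norm_integral_smul_le {E : Type v} [NormedAddCommGroup E] [NormedSpace ℂ E]
    (f : C_c(G, ℂ)) {b : G → E} {C : ℝ} (hC : ∀ g ∈ tsupport f, ‖b g‖ ≤ C) :
    ‖∫ g, f g • b g ∂μ‖ ≤ (∫ g, ‖f g‖ ∂μ) * C := by
  have hf : Integrable (fun g => ‖f g‖) μ :=
    (f.continuous.integrable_of_hasCompactSupport f.hasCompactSupport).norm
  rw [← integral_mul_const]
  refine norm_integral_le_of_norm_le (hf.mul_const _) (.of_forall fun g => ?_)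
  by_cases hg : g ∈ tsupport f
  · rw [norm_smul]
    exact mul_le_mul_of_nonneg_left (hC g hg) (norm_nonneg _)
  · simp [image_eq_zero_of_notMem_tsupport hg]

/-- The average of a cocycle. -/
def BanachRep.average (ρ : BanachRep.{u, v} G) (b : G → ρ.E) (f : C_c(G, ℂ)) : ρ.E :=
  ∫ g, f g • b g ∂μ

theorem BanachRep.average_coboundary (ρ : BanachRep.{u, v} G) (x : ρ.E) {f : C_c(G, ℂ)}
    (hf : ∫ g, f g ∂μ = 1) :
    ρ.average μ (fun g => ρ.π g x - x) f = ρ.integrate μ f x - x := by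
  have hi : Integrable f μ := f.continuous.integrable_of_hasCompactSupport f.hasCompactSupport
  simp only [BanachRep.average, smul_sub]
  rw [integral_sub (ρ.integrable_orbit μ f x) (hi.smul_const x), integral_smul_const, hf,
    one_smul, BanachRep.integrate_apply]

theorem BanachRep.IsCocycle.average_shift {ρ : BanachRep.{u, v} G} {b : G → ρ.E}
    (hb : ρ.IsCocycle b) (x : ρ.E) {f : C_c(G, ℂ)} (hf : ∫ g, f g ∂μ = 1) :
    ρ.average μ (fun g => b g + ρ.π g x - x) f
      = ρ.average μ b f + ρ.integrate μ f x - x := by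
  have h := ρ.average_coboundary μ x hf
  rw [BanachRep.average] at h
  have hc : Continuous fun g => ρ.π g x - x := (ρ.continuous_orbit x).sub continuous_const
  simp only [BanachRep.average, add_sub_assoc, smul_add]
  rw [integral_add (integrable_smul_of_continuous μ f hb.continuous)
    (integrable_smul_of_continuous μ f hc), h]

/-- `b g + π(g) b(k) = b(gk)`, so applying `g` to the average merely translates `f`. After rebasing
at the average, the size of the cocycle near 1 is governed by the `L¹` modulus of continuity of `f`
instead of that of `b`. -/
theorem BanachRep.IsCocycle.add_map_average {ρ : BanachRep.{u, v} G} {b : G → ρ.E}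
    (hb : ρ.IsCocycle b) {f : C_c(G, ℂ)} (hf : ∫ g, f g ∂μ = 1) (g : G) :
    b g + ρ.π g (ρ.average μ b f) - ρ.average μ b f = ∫ k, (f (g⁻¹ * k) - f k) • b k ∂μ := by
  have hbc := hb.continuous
  have hfc := f.continuous
  have hi : Integrable f μ := f.continuous.integrable_of_hasCompactSupport f.hasCompactSupport
  have hsupp : HasCompactSupport fun k => f (g⁻¹ * k) :=
    f.hasCompactSupport.comp_homeomorph (Homeomorph.mulLeft g⁻¹)
  have hi2 : Integrable (fun k => f (g⁻¹ * k) • b k) μ :=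
    Continuous.integrable_of_hasCompactSupport (by fun_prop) hsupp.smul_right
  have hi3 := integrable_smul_of_continuous μ f hbc
  have h1 : b g + ρ.π g (ρ.average μ b f) = ∫ k, f (g⁻¹ * k) • b k ∂μ := by
    rw [← integral_mul_left_eq_self (fun k => f (g⁻¹ * k) • b k) g, BanachRep.average,
      ← ContinuousLinearMap.integral_comp_comm _ hi3]
    have h2 : b g = ∫ k, f k • b g ∂μ := by rw [integral_smul_const, hf, one_smul]
    nth_rewrite 1 [h2]
    rw [← integral_add (hi.smul_const _) ((ρ.π g).integrable_comp hi3)]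
    refine integral_congr_ae (.of_forall fun k => ?_)
    simp [hb.map_mul, smul_add]
  simp only [sub_smul]
  rw [integral_sub hi2 hi3, h1, BanachRep.average]

theorem tendsto_integral_norm_translate_sub (f : C_c(G, ℂ)) :
    Tendsto (fun g : G => ∫ k, ‖f (g⁻¹ * k) - f k‖ ∂μ) (𝓝 1) (𝓝 0) := by
  obtain ⟨V, hV, hV1⟩ := exists_compact_mem_nhds (1 : G)
  have hfc := f.continuous
  have hcont : ContinuousOn (fun g : G => ∫ k, ‖f (g⁻¹ * k) - f k‖ ∂μ) V := by
    refine continuousOn_integral_of_compact_support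
      (k := V * tsupport f ∪ tsupport f) ((hV.mul f.hasCompactSupport).union f.hasCompactSupport)
      ?_ ?_
    · exact Continuous.continuousOn (by unfold Function.uncurry; fun_prop)
    · intro g k hg hk
      rw [Set.mem_union, not_or] at hk
      have h1 : g⁻¹ * k ∉ tsupport f := fun h => hk.1 ⟨g, hg, g⁻¹ * k, h, by group⟩
      simp [image_eq_zero_of_notMem_tsupport h1, image_eq_zero_of_notMem_tsupport hk.2]
  have h := (hcont.continuousAt hV1).tendsto
  simpa using h

/-- Since `U` is independent of `ρ` and `b`, smoothed cocycles are equicontinuous at the identity.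
The limit of a sequence of them is then a continuous cocycle. -/
theorem IsCompactGeneratingSet.exists_nhds_smoothed_le {S : Set G}
    (hS : IsCompactGeneratingSet S) {f : C_c(G, ℂ)} (hf : ∫ g, f g ∂μ = 1) {A : ℝ} (hA : 1 ≤ A)
    {η : ℝ} (hη : 0 < η) :
    ∃ U ∈ 𝓝 (1 : G), ∀ (ρ : BanachRep.{u, v} G), (∀ s ∈ S, ‖ρ.π s‖ ≤ A) →
      ∀ b, ρ.IsCocycle b → ∀ M : ℝ, 0 ≤ M → (∀ s ∈ S, ‖b s‖ ≤ M) → ∀ g ∈ U,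
      ‖b g + ρ.π g (ρ.average μ b f) - ρ.average μ b f‖ ≤ η * M := by
  obtain ⟨V, hV, hV1⟩ := exists_compact_mem_nhds (1 : G)
  obtain ⟨C, hC0, hC⟩ := hS.exists_cocycle_bound.{u, v}
    ((hV.mul f.hasCompactSupport).union f.hasCompactSupport) hA
  have hev := (tendsto_integral_norm_translate_sub μ f).eventually
    (gt_mem_nhds (show 0 < η / (C + 1) by positivity))
  refine ⟨_, inter_mem hV1 hev, fun ρ hπ b hb M hM0 hM g hg => ?_⟩
  have hfc := f.continuous
  have hsupp : HasCompactSupport fun k => f (g⁻¹ * k) - f k :=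
    (f.hasCompactSupport.comp_homeomorph (Homeomorph.mulLeft g⁻¹)).sub f.hasCompactSupport
  have hi : Integrable (fun k => f (g⁻¹ * k) - f k) μ :=
    Continuous.integrable_of_hasCompactSupport (by fun_prop) hsupp
  rw [hb.add_map_average μ hf]
  calc ‖∫ k, (f (g⁻¹ * k) - f k) • b k ∂μ‖ ≤ ∫ k, ‖f (g⁻¹ * k) - f k‖ * (C * M) ∂μ := by
        refine norm_integral_le_of_norm_le (hi.norm.mul_const _) (.of_forall fun k => ?_)
        by_cases hk : k ∈ V * tsupport f ∪ tsupport f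
        · rw [norm_smul]
          exact mul_le_mul_of_nonneg_left (hC ρ hπ b hb M hM0 hM k hk) (norm_nonneg _)
        · rw [Set.mem_union, not_or] at hk
          have h1 : g⁻¹ * k ∉ tsupport f := fun h => hk.1 ⟨g, hg.1, g⁻¹ * k, h, by group⟩
          simp [image_eq_zero_of_notMem_tsupport h1, image_eq_zero_of_notMem_tsupport hk.2]
    _ = (∫ k, ‖f (g⁻¹ * k) - f k‖ ∂μ) * (C * M) := integral_mul_const _ _
    _ ≤ η / (C + 1) * (C * M) := by
        have : ∫ k, ‖f (g⁻¹ * k) - f k‖ ∂μ < η / (C + 1) := hg.2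
        gcongr
    _ ≤ η * M := by
        rw [div_mul_eq_mul_div, div_le_iff₀ (by positivity)]
        nlinarith [mul_nonneg hη.le hM0]

theorem BanachRep.integrate_convolution_apply (ρ : BanachRep.{u, v} G) (f h : C_c(G, ℂ))
    (x : ρ.E) : ρ.integrate μ (convolution μ f h) x = ρ.integrate μ f (ρ.integrate μ h x) := by
  rw [ρ.integrate_convolution μ, mul_apply_eq_comp]

/-- The linear representation on `E × ℂ` attached to a cocycle. -/
def BanachRep.affineExtension (ρ : BanachRep.{u, v} G) {b : G → ρ.E} (hb : ρ.IsCocycle b) :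
    BanachRep.{u, v} G where
  E := ρ.E × ℂ
  π :=
    { toFun := fun g => (ρ.π g ∘L ContinuousLinearMap.fst ℂ ρ.E ℂ +
        (ContinuousLinearMap.snd ℂ ρ.E ℂ).smulRight (b g)).prod (ContinuousLinearMap.snd ℂ ρ.E ℂ)
      map_one' := by ext x <;> simp [hb.map_one]
      map_mul' := fun g h => by ext x <;> simp [hb.map_mul, add_comm] }
  continuous_orbit := fun x =>
    ((ρ.continuous_orbit x.1).add (continuous_const.smul hb.continuous)).prodMk continuous_const

theorem BanachRep.affineExtension_integrate (ρ : BanachRep.{u, v} G) {b : G → ρ.E}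
    (hb : ρ.IsCocycle b) (f : C_c(G, ℂ)) (x : ρ.E) (t : ℂ) :
    (ρ.affineExtension hb).integrate μ f ((x, t) : ρ.E × ℂ)
      = ((ρ.integrate μ f x + t • ρ.average μ b f, t * ∫ g, f g ∂μ) : ρ.E × ℂ) := by
  have hi := (ρ.affineExtension hb).integrable_orbit μ f ((x, t) : ρ.E × ℂ)
  have hi1 := ρ.integrable_orbit μ f x
  have hi2 := integrable_smul_of_continuous μ f hb.continuous
  refine Prod.ext ?_ ?_
  · have h := ContinuousLinearMap.integral_comp_comm (ContinuousLinearMap.fst ℂ ρ.E ℂ) hi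
    refine h.symm.trans ?_
    simp only [BanachRep.average]
    rw [BanachRep.integrate_apply, ← integral_smul]
    refine Eq.trans ?_ (integral_add hi1 (hi2.smul t))
    refine integral_congr_ae (.of_forall fun g => ?_)
    change f g • (ρ.π g x + t • b g) = f g • ρ.π g x + t • f g • b g
    rw [smul_add, smul_comm]
  · have h := ContinuousLinearMap.integral_comp_comm (ContinuousLinearMap.snd ℂ ρ.E ℂ) hi
    refine h.symm.trans ?_
    simp only
    rw [← integral_const_mul]
    refine integral_congr_ae (.of_forall fun g => ?_)
    change f g • t = _
    rw [smul_eq_mul, mul_comm]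

/-- This is multiplicativity of `f ↦ π(f)` for the linear representation on `E × ℂ`, evaluated at
`(0, 1)`. -/
theorem BanachRep.IsCocycle.average_convolution {ρ : BanachRep.{u, v} G} {b : G → ρ.E}
    (hb : ρ.IsCocycle b) (f : C_c(G, ℂ)) {h : C_c(G, ℂ)} (hh : ∫ g, h g ∂μ = 1) :
    ρ.average μ b (convolution μ f h)
      = ρ.average μ b f + ρ.integrate μ f (ρ.average μ b h) := by
  have h1 := (ρ.affineExtension hb).integrate_convolution_apply μ f h ((0, 1) : ρ.E × ℂ)
  rw [ρ.affineExtension_integrate μ hb, ρ.affineExtension_integrate μ hb,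
    ρ.affineExtension_integrate μ hb, hh] at h1
  have h2 := congrArg Prod.fst h1
  simp only [map_zero, zero_add, one_smul, mul_one] at h2
  rw [h2, add_comm]

/-- The integral is the operator attached to the trivial representation on `ℂ`, hence
multiplicative. -/
theorem integral_convolution_eq_one {f h : C_c(G, ℂ)} (hf : ∫ g, f g ∂μ = 1)
    (hh : ∫ g, h g ∂μ = 1) : ∫ g, convolution μ f h g ∂μ = 1 := by
  let ρ : BanachRep.{u, 0} G := { E := ℂ, π := 1, continuous_orbit := fun x => continuous_const }
  have h1 : ∀ k : C_c(G, ℂ), ρ.integrate μ k (1 : ℂ) = ∫ g, k g ∂μ := fun k => by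
    rw [BanachRep.integrate_apply]
    refine integral_congr_ae (.of_forall fun g => ?_)
    change k g • (1 : ℂ) = k g
    simp
  have h2 := ρ.integrate_convolution_apply μ f h (1 : ℂ)
  have h3 : ρ.integrate μ h (1 : ℂ) = (1 : ℂ) := (h1 h).trans hh
  rw [h3] at h2
  exact (h1 _).symm.trans (h2.trans ((h1 f).trans hf))

end CocycleEstimates

/-! ### Limits of representations along an ultrafilter -/

section LpMap

open scoped ENNReal

variable {E : ℕ → Type v} [∀ n, NormedAddCommGroup (E n)] [∀ n, NormedSpace ℂ (E n)]

/-- The diagonal operator on bounded sequences defined by a bounded sequence of operators. -/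
def lpMap (A : ∀ n, E n →L[ℂ] E n) (hA : ∃ C, ∀ n, ‖A n‖ ≤ C) : lp E ∞ →L[ℂ] lp E ∞ :=
  LinearMap.mkContinuousOfExistsBound
    { toFun := fun x => ⟨fun n => A n (x n), memℓp_infty (by
        obtain ⟨C, hC⟩ := hA
        refine ⟨C * ‖x‖, ?_⟩
        rintro _ ⟨n, rfl⟩
        exact ((A n).le_of_opNorm_le (hC n) _).trans (mul_le_mul_of_nonneg_left
          (lp.norm_apply_le_norm ENNReal.top_ne_zero x n) ((norm_nonneg _).trans (hC n))))⟩
      map_add' := fun x y => by ext n; exact map_add (A n) _ _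
      map_smul' := fun c x => by ext n; exact map_smul (A n) c _ }
    (by
      obtain ⟨C, hC⟩ := hA
      refine ⟨C, fun x => lp.norm_le_of_forall_le ?_ fun n => ?_⟩
      · exact mul_nonneg ((norm_nonneg _).trans (hC 0)) (norm_nonneg _)
      · exact ((A n).le_of_opNorm_le (hC n) _).trans (mul_le_mul_of_nonneg_left
          (lp.norm_apply_le_norm ENNReal.top_ne_zero x n) ((norm_nonneg _).trans (hC n))))

@[simp]
theorem lpMap_apply (A : ∀ n, E n →L[ℂ] E n) (hA : ∃ C, ∀ n, ‖A n‖ ≤ C) (x : lp E ∞) (n : ℕ) :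
    (lpMap A hA x : ∀ n, E n) n = A n (x n) := rfl

theorem norm_lpMap_le (A : ∀ n, E n →L[ℂ] E n) (hA : ∃ C, ∀ n, ‖A n‖ ≤ C) {C : ℝ}
    (hC : ∀ n, ‖A n‖ ≤ C) : ‖lpMap A hA‖ ≤ C := by
  have hC0 : 0 ≤ C := (norm_nonneg _).trans (hC 0)
  refine ContinuousLinearMap.opNorm_le_bound _ hC0 fun x =>
    lp.norm_le_of_forall_le (mul_nonneg hC0 (norm_nonneg _)) fun n => ?_
  exact ((A n).le_of_opNorm_le (hC n) _).trans (mul_le_mul_of_nonneg_left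
    (lp.norm_apply_le_norm ENNReal.top_ne_zero x n) hC0)

theorem tendsto_limUnder_norm (𝒰 : Ultrafilter ℕ) (x : lp E ∞) :
    Tendsto (fun n => ‖x n‖) 𝒰 (𝓝 (limUnder 𝒰 fun n => ‖x n‖)) := by
  refine tendsto_nhds_limUnder ?_
  obtain ⟨a, -, ha⟩ := (isCompact_Icc (a := (0 : ℝ)) (b := ‖x‖)).ultrafilter_le_nhds
    (𝒰.map fun n => ‖x n‖) (by
      rw [le_principal_iff]
      exact univ_mem' (f := (𝒰 : Filter ℕ)) fun n =>
        ⟨norm_nonneg _, lp.norm_apply_le_norm ENNReal.top_ne_zero x n⟩)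
  exact ⟨a, ha⟩

/-- The limit along an ultrafilter of the norms of a bounded sequence. -/
def ultraSeminorm (𝒰 : Ultrafilter ℕ) : Seminorm ℂ (lp E ∞) :=
  Seminorm.of (fun x => limUnder 𝒰 fun n => ‖x n‖)
    (fun x y => le_of_tendsto_of_tendsto' (tendsto_limUnder_norm 𝒰 (x + y))
      ((tendsto_limUnder_norm 𝒰 x).add (tendsto_limUnder_norm 𝒰 y)) fun n => by
        simpa using norm_add_le (x n) (y n))
    (fun c x => tendsto_nhds_unique (tendsto_limUnder_norm 𝒰 (c • x))
      (((tendsto_limUnder_norm 𝒰 x).const_mul ‖c‖).congr fun n => by simp [norm_smul]))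

theorem tendsto_ultraSeminorm (𝒰 : Ultrafilter ℕ) (x : lp E ∞) :
    Tendsto (fun n => ‖x n‖) 𝒰 (𝓝 (ultraSeminorm 𝒰 x)) := tendsto_limUnder_norm 𝒰 x

theorem ultraSeminorm_le_norm (𝒰 : Ultrafilter ℕ) (x : lp E ∞) : ultraSeminorm 𝒰 x ≤ ‖x‖ :=
  le_of_tendsto' (tendsto_ultraSeminorm 𝒰 x) fun n =>
    lp.norm_apply_le_norm ENNReal.top_ne_zero x n

/-- One inequality is the limit of the approximate ones. The other is the same inequality applied to
`x + y` and `x - y`. -/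
theorem ultraSeminorm_parallelogram [∀ n, CompleteSpace (E n)] {𝒰 : Ultrafilter ℕ}
    (h𝒰 : (𝒰 : Filter ℕ) ≤ atTop) {ε : ℕ → ℝ} (hε : Tendsto ε atTop (𝓝 0))
    (hE : ∀ n, nearHilbert (ε n) (E n)) (x y : lp E ∞) :
    ultraSeminorm 𝒰 (x + y) * ultraSeminorm 𝒰 (x + y) +
      ultraSeminorm 𝒰 (x - y) * ultraSeminorm 𝒰 (x - y) =
      2 * (ultraSeminorm 𝒰 x * ultraSeminorm 𝒰 x + ultraSeminorm 𝒰 y * ultraSeminorm 𝒰 y) := by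
  have hle : ∀ x y : lp E ∞, ultraSeminorm 𝒰 (x + y) * ultraSeminorm 𝒰 (x + y) +
      ultraSeminorm 𝒰 (x - y) * ultraSeminorm 𝒰 (x - y) ≤
      2 * (ultraSeminorm 𝒰 x * ultraSeminorm 𝒰 x + ultraSeminorm 𝒰 y * ultraSeminorm 𝒰 y) := by
    intro x y
    have h1 := tendsto_ultraSeminorm 𝒰 x
    have h2 := tendsto_ultraSeminorm 𝒰 y
    have h3 := tendsto_ultraSeminorm 𝒰 (x + y)
    have h4 := tendsto_ultraSeminorm 𝒰 (x - y)
    have h5 : Tendsto (fun n => 2 * ((1 + ε n) * (‖x n‖ * ‖x n‖ + ‖y n‖ * ‖y n‖))) 𝒰 (𝓝 (2 *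
        ((1 + 0) * (ultraSeminorm 𝒰 x * ultraSeminorm 𝒰 x +
          ultraSeminorm 𝒰 y * ultraSeminorm 𝒰 y)))) :=
      (((hε.mono_left h𝒰).const_add 1).mul ((h1.mul h1).add (h2.mul h2))).const_mul 2
    rw [add_zero, one_mul] at h5
    refine le_of_tendsto_of_tendsto' ((h3.mul h3).add (h4.mul h4)) h5 fun n => ?_
    have h := hE n (x n) (y n)
    simp only [lp.coeFn_add, lp.coeFn_sub, Pi.add_apply, Pi.sub_apply]
    simp only [pow_two] at h
    linarith
  refine le_antisymm (hle x y) ?_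
  have h := hle (x + y) (x - y)
  have h1 : x + y + (x - y) = (2 : ℂ) • x := by rw [two_smul]; abel
  have h2 : x + y - (x - y) = (2 : ℂ) • y := by rw [two_smul]; abel
  rw [h1, h2, map_smul_eq_mul, map_smul_eq_mul] at h
  norm_num at h
  linarith

end LpMap

section Limit

open scoped ENNReal

variable {G : Type u} [Group G] [TopologicalSpace G] [IsTopologicalGroup G]

/-- A sequence of representations on spaces that are closer and closer to Hilbert spaces, by
operators that are closer and closer to isometries, has a unitary limit. The representation `X`
consists of bounded sequences of vectors, with coordinates `ev n`. -/
theorem exists_unitary_limit (ρ : ℕ → BanachRep.{u, v} G) {ε : ℕ → ℝ}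
    (hε : Tendsto ε atTop (𝓝 0)) (hE : ∀ n, nearHilbert (ε n) (ρ n).E)
    (hloc : ∃ C, ∀ᶠ g in 𝓝 (1 : G), ∀ n, ‖(ρ n).π g‖ ≤ C)
    (hbd : ∀ g, ∃ C, ∀ n, ‖(ρ n).π g‖ ≤ C)
    (hiso : ∀ g, ∃ r : ℕ → ℝ, Tendsto r atTop (𝓝 1) ∧ ∀ n, ‖(ρ n).π g‖ ≤ r n)
    {𝒰 : Ultrafilter ℕ} (h𝒰 : (𝒰 : Filter ℕ) ≤ atTop) :
    ∃ (X : BanachRep.{u, v} G) (ev : ∀ n, X.E →L[ℂ] (ρ n).E),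
      (∀ n g x, ev n (X.π g x) = (ρ n).π g (ev n x)) ∧
      (∀ n x, ‖ev n x‖ ≤ ‖x‖) ∧
      (∀ b : ∀ n, G → (ρ n).E, (∀ n, (ρ n).IsCocycle (b n)) →
        (∀ g, ∃ C, ∀ n, ‖b n g‖ ≤ C) →
        (∀ η : ℝ, 0 < η → ∀ᶠ g in 𝓝 (1 : G), ∀ n, ‖b n g‖ ≤ η) →
        ∃ c : G → X.E, X.IsCocycle c ∧ ∀ n g, ev n (c g) = b n g) ∧
      ∃ ρ' : BanachRep.{u, v} G, ρ'.IsUnitary ∧ ∃ T : X.E →L[ℂ] ρ'.E,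
        (∀ g x, T (X.π g x) = ρ'.π g (T x)) ∧
        ∀ x, Tendsto (fun n => ‖ev n x‖) 𝒰 (𝓝 ‖T x‖) := by
  let E : ℕ → Type v := fun n => (ρ n).E
  let π : G →* (lp E ∞ →L[ℂ] lp E ∞) :=
    { toFun := fun g => lpMap (E := E) (fun n => (ρ n).π g) (hbd g)
      map_one' := by ext x n; simp
      map_mul' := fun g h => by ext x n; simp }
  have hπ : ∀ g (x : lp E ∞) n, (π g x : ∀ n, E n) n = (ρ n).π g (x n) := fun g x n => rfl
  obtain ⟨C, hC⟩ := hloc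
  have hC' : ∀ᶠ g in 𝓝 (1 : G), ‖π g‖ ≤ C := hC.mono fun g hg => norm_lpMap_le _ (hbd g) hg
  -- The null sequences are not yet divided out, so the coordinates `ev n` remain defined on `X`;
  -- the quotient is formed only in `ρ'`. Restricting to continuous vectors is necessary because
  -- orbits of arbitrary bounded sequences need not be continuous.
  let X := continuousPart π hC'
  let ι : X.E →L[ℂ] lp E ∞ := (continuousVectors π).subtypeL
  have hιnorm : ∀ x, ‖ι x‖ = ‖x‖ := fun x => rfl
  have hιπ : ∀ g x, ι (X.π g x) = π g (ι x) := fun g x => rfl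
  let ev₀ : ∀ n, lp E ∞ →L[ℂ] E n := fun n => LinearMap.mkContinuous
    { toFun := fun x => x n, map_add' := fun x y => rfl, map_smul' := fun c x => rfl } 1
    fun x => by rw [one_mul]; exact lp.norm_apply_le_norm ENNReal.top_ne_zero x n
  let ev : ∀ n, X.E →L[ℂ] (ρ n).E := fun n => ev₀ n ∘L ι
  have hev : ∀ n x, ev n x = (ι x : ∀ n, E n) n := fun n x => rfl
  refine ⟨X, ev, fun n g x => rfl, fun n x => ?_, fun b hb hbbd hbeq => ?_, ?_⟩
  · rw [hev, ← hιnorm]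
    exact lp.norm_apply_le_norm ENNReal.top_ne_zero _ n
  · let c₀ : G → lp E ∞ := fun g => ⟨fun n => b n g, memℓp_infty (by
      obtain ⟨C, hC⟩ := hbbd g
      exact ⟨C, by rintro _ ⟨n, rfl⟩; exact hC n⟩)⟩
    have hc₀ : ∀ g n, (c₀ g : ∀ n, E n) n = b n g := fun g n => rfl
    have hmul : ∀ g h, c₀ (g * h) = c₀ g + π g (c₀ h) := fun g h => by
      ext n
      rw [lp.coeFn_add, Pi.add_apply, hc₀, hπ, hc₀, hc₀, (hb n).map_mul]
    have h1 : Tendsto c₀ (𝓝 1) (𝓝 0) := by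
      rw [tendsto_zero_iff_norm_tendsto_zero, Metric.tendsto_nhds]
      intro η hη
      filter_upwards [hbeq (η / 2) (by positivity)] with g hg
      rw [Real.dist_eq, sub_zero, abs_of_nonneg (norm_nonneg _)]
      exact (lp.norm_le_of_forall_le (by positivity) hg).trans_lt (by linarith)
    have hcont : Continuous c₀ := by
      refine continuous_iff_continuousAt.2 fun g₀ => ?_
      have h2 : Tendsto (fun g => g₀⁻¹ * g) (𝓝 g₀) (𝓝 1) := by
        have : Continuous fun g => g₀⁻¹ * g := by fun_prop
        simpa using this.tendsto g₀
      have h3 := (((π g₀).continuous.tendsto 0).comp (h1.comp h2)).const_add (c₀ g₀)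
      rw [map_zero, add_zero] at h3
      refine h3.congr fun g => ?_
      simp only [Function.comp_apply]
      rw [← hmul, mul_inv_cancel_left]
    have hmem : ∀ g, c₀ g ∈ continuousVectors π := fun g => by
      rw [mem_continuousVectors]
      -- The cocycle identity expresses orbits of the values of `c₀` through `c₀` itself, so
      -- continuity of `c₀` puts its values into `X`.
      have h2 : ∀ k, π k (c₀ g) = c₀ (k * g) - c₀ k := fun k => by
        rw [hmul, add_sub_cancel_left]
      simp only [h2]
      exact (hcont.comp (by fun_prop)).sub hcont
    exact ⟨fun g => (⟨c₀ g, hmem g⟩ : continuousVectors π),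
      ⟨Continuous.subtype_mk hcont _, fun g h => Subtype.ext (hmul g h)⟩, fun n g => rfl⟩
  · let p : Seminorm ℂ X.E := (ultraSeminorm (E := E) 𝒰).comp ι.toLinearMap
    have hp : ∀ x, p x = ultraSeminorm (E := E) 𝒰 (ι x) := fun x => rfl
    have hple : ∀ g x, ultraSeminorm (E := E) 𝒰 (π g x) ≤ ultraSeminorm (E := E) 𝒰 x := by
      intro g x
      obtain ⟨r, hr1, hr⟩ := hiso g
      have h := (hr1.mono_left h𝒰).mul (tendsto_ultraSeminorm (E := E) 𝒰 x)
      rw [one_mul] at h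
      exact le_of_tendsto_of_tendsto' (tendsto_ultraSeminorm 𝒰 _) h fun n =>
        ((ρ n).π g).le_of_opNorm_le (hr n) _
    -- In the limit both `g` and `g⁻¹` act by contractions, hence by isometries.
    have hpinv : ∀ g x, ultraSeminorm (E := E) 𝒰 (π g x) = ultraSeminorm (E := E) 𝒰 x := by
      intro g x
      refine le_antisymm (hple g x) ?_
      have h := hple g⁻¹ (π g x)
      rwa [map_inv_apply_apply] at h
    let π₀ : G →* (X.E →ₗ[ℂ] X.E) :=
      { toFun := fun g => (X.π g).toLinearMap
        map_one' := by rw [map_one]; rfl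
        map_mul' := fun g h => by rw [map_mul]; rfl }
    obtain ⟨ρ', hρ', T, hT, hTπ⟩ := exists_unitary_of_seminorm p
      (fun x y => by
        simp only [hp, map_add, map_sub]
        exact ultraSeminorm_parallelogram h𝒰 hε hE (ι x) (ι y)) π₀
      (fun g x => hpinv g (ι x)) (fun x => by
        have h1 : Tendsto (fun g => ‖X.π g x - x‖) (𝓝 1) (𝓝 0) := by
          have h := (((X.continuous_orbit x).sub continuous_const).norm (E := X.E)).tendsto
            (1 : G) (f := fun g => ‖X.π g x - x‖)
          simpa using h
        exact squeeze_zero (fun g => apply_nonneg p _)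
          (fun g => ultraSeminorm_le_norm 𝒰 (ι (X.π g x - x))) h1)
    refine ⟨ρ', hρ', T.mkContinuous 1 fun x => ?_, hTπ, fun x => ?_⟩
    · rw [hT, one_mul]
      exact ultraSeminorm_le_norm 𝒰 (ι x)
    · rw [LinearMap.mkContinuous_apply, hT]
      exact tendsto_ultraSeminorm 𝒰 (ι x)

end Limit

/-! ### Averages contract the displacement -/

section Contraction

variable {G : Type u} [Group G] [TopologicalSpace G] [IsTopologicalGroup G] [T2Space G]
  [LocallyCompactSpace G] [MeasurableSpace G] [BorelSpace G]
  (μ : Measure G) [μ.IsHaarMeasure]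

/-- The iterated convolution `f ∗ ⋯ ∗ f ∗ h`. -/
def convIter (f h : C_c(G, ℂ)) : ℕ → C_c(G, ℂ)
  | 0 => h
  | m + 1 => convolution μ f (convIter f h m)

theorem integral_convIter {f h : C_c(G, ℂ)} (hf : ∫ g, f g ∂μ = 1) (hh : ∫ g, h g ∂μ = 1)
    (m : ℕ) : ∫ g, convIter μ f h m g ∂μ = 1 := by
  induction m with
  | zero => exact hh
  | succ m ih => exact integral_convolution_eq_one μ hf ih

theorem norm_le_exp_one_of_mem_repFamily {S : Set G} (hS : IsCompactGeneratingSet S)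
    {𝓔 : BanachClass.{v}} {c : ℝ} (hc : c ≤ 1) {ρ : BanachRep.{u, v} G}
    (hρ : ρ ∈ (repFamily hS 𝓔 c).carrier) {s : G} (hs : s ∈ S) : ‖ρ.π s‖ ≤ Real.exp 1 := by
  refine (hρ.2 s).trans (Real.exp_le_exp.2 ?_)
  have h1 : (wordLength S s : ℝ) ≤ 1 := by
    exact_mod_cast wordLength_le (n := 1) (by simpa using hs)
  nlinarith [Nat.cast_nonneg (α := ℝ) (wordLength S s)]

/-- The contraction property for cocycles of norm at most one on the generating set. -/
theorem IsKazhdanPair.exists_contracting_average_unit {Q : Set G} {δ : ℝ}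
    (hK : IsKazhdanPair.{u, v} Q δ) (hQ : IsCompact Q) (hδ : 0 < δ) {S : Set G}
    (hS : IsCompactGeneratingSet S) :
    ∃ φ : C_c(G, ℂ), ∫ g, φ g ∂μ = 1 ∧ ∃ ε : ℝ, 0 < ε ∧ ε ≤ 1 ∧
      ∀ ρ ∈ (repFamily hS (nearHilbert.{v} ε) ε).carrier, ∀ b, ρ.IsCocycle b →
        (∀ s ∈ S, ‖b s‖ ≤ 1) →
        ∀ s ∈ S, ‖b s + ρ.π s (ρ.average μ b φ) - ρ.average μ b φ‖ ≤ 1 / 2 := by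
  have hA : (1 : ℝ) ≤ Real.exp 1 := Real.one_le_exp zero_le_one
  -- `f` provides the contraction in unitary representations; `h` below serves only to smooth
  -- cocycles. `C₃` bounds the average of a cocycle over `h`, and `M` bounds the smoothed cocycle on
  -- `S`.
  obtain ⟨f, hf, κ, hκ, hκ1, hgap⟩ := hK.exists_spectral_gap μ hQ hδ
  obtain ⟨h, hh⟩ := exists_integral_eq_one μ
  obtain ⟨C₁, hC₁0, hC₁⟩ := hS.exists_cocycle_bound.{u, v} h.hasCompactSupport hA
  obtain ⟨C₂, hC₂0, hC₂⟩ := hS.exists_cocycle_bound.{u, v} hQ hA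
  set C₃ := (∫ g, ‖h g‖ ∂μ) * C₁
  have hC₃0 : 0 ≤ C₃ := mul_nonneg (integral_nonneg fun _ => norm_nonneg _) hC₁0
  set M := 1 + Real.exp 1 * C₃ + C₃ with hM
  have hM0 : 0 ≤ M := by positivity
  -- `C₂M/δ` will bound the vector `y` whose coboundary is the limit cocycle. After `m` averagings
  -- less than `1/8` remains, so the displacement is at most `1/4`, below the threshold `1/2`.
  obtain ⟨m, hm⟩ : ∃ m : ℕ, (1 - κ) ^ m * (C₂ * M / δ) < 1 / 8 := by
    have h1 : Tendsto (fun m : ℕ => (1 - κ) ^ m * (C₂ * M / δ)) atTop (𝓝 0) := by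
      simpa using (tendsto_pow_atTop_nhds_zero_of_lt_one (r := 1 - κ) (by linarith)
        (by linarith)).mul_const (C₂ * M / δ)
    exact (h1.eventually (gt_mem_nhds (by norm_num))).exists
  refine ⟨convIter μ f h m, integral_convIter μ hf hh m, ?_⟩
  by_contra! hcon
  have hseq : ∀ n : ℕ, ∃ ρ ∈ (repFamily hS (nearHilbert.{v} (1 / ((n : ℝ) + 1)))
      (1 / ((n : ℝ) + 1))).carrier, ∃ b, ρ.IsCocycle b ∧ (∀ s ∈ S, ‖b s‖ ≤ 1) ∧
      ∃ s ∈ S, 1 / 2 < ‖b s + ρ.π s (ρ.average μ b (convIter μ f h m)) -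
        ρ.average μ b (convIter μ f h m)‖ := fun n =>
    hcon _ (by positivity) (by rw [div_le_one (by positivity)]; linarith [n.cast_nonneg (α := ℝ)])
  choose ρ hρ b hb hb1 s hs hbad using hseq
  set ε : ℕ → ℝ := fun n => 1 / ((n : ℝ) + 1) with hε_def
  have hε1 : ∀ n, ε n ≤ 1 := fun n => by
    simp only [hε_def]
    rw [div_le_one (by positivity)]
    linarith [n.cast_nonneg (α := ℝ)]
  have hε : Tendsto ε atTop (𝓝 0) := tendsto_one_div_add_atTop_nhds_zero_nat
  have hπS : ∀ n, ∀ s ∈ S, ‖(ρ n).π s‖ ≤ Real.exp 1 := fun n s hs =>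
    norm_le_exp_one_of_mem_repFamily hS (hε1 n) (hρ n) hs
  have hπ : ∀ n g, ‖(ρ n).π g‖ ≤ Real.exp (wordLength S g) := fun n g =>
    ((hρ n).2 g).trans (Real.exp_le_exp.2 (mul_le_of_le_one_left (Nat.cast_nonneg _) (hε1 n)))
  have hloc : ∃ C, ∀ᶠ g in 𝓝 (1 : G), ∀ n, ‖(ρ n).π g‖ ≤ C := by
    obtain ⟨V, hV, hV1⟩ := exists_compact_mem_nhds (1 : G)
    obtain ⟨N, hN⟩ := hS.wordLength_bounded hV
    refine ⟨Real.exp N, mem_of_superset hV1 fun g hg n => (hπ n g).trans (Real.exp_le_exp.2 ?_)⟩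
    exact_mod_cast hN g hg
  have hiso : ∀ g, ∃ r : ℕ → ℝ, Tendsto r atTop (𝓝 1) ∧ ∀ n, ‖(ρ n).π g‖ ≤ r n := fun g => by
    refine ⟨fun n => Real.exp (ε n * wordLength S g), ?_, fun n => (hρ n).2 g⟩
    have := (Real.continuous_exp.tendsto _).comp (hε.mul_const (wordLength S g : ℝ))
    rwa [zero_mul, Real.exp_zero] at this
  have h𝒰 : (hyperfilter ℕ : Filter ℕ) ≤ atTop := Nat.hyperfilter_le_atTop
  obtain ⟨X, ev, hevπ, hev, hlift, ρ', hρ', T, hTπ, hT⟩ := exists_unitary_limit ρ hε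
    (fun n => (hρ n).1) hloc (fun g => ⟨_, fun n => hπ n g⟩) hiso h𝒰
  -- the smoothed cocycles
  set a : ∀ n, (ρ n).E := fun n => (ρ n).average μ (b n) h with ha_def
  have ha : ∀ n, ‖a n‖ ≤ C₃ := fun n => norm_integral_smul_le μ h fun g hg => by
    simpa using hC₁ (ρ n) (hπS n) (b n) (hb n) 1 zero_le_one (hb1 n) g hg
  set b' : ∀ n, G → (ρ n).E := fun n g => b n g + (ρ n).π g (a n) - a n with hb'_def
  have hb' : ∀ n, (ρ n).IsCocycle (b' n) := fun n => (hb n).shift (a n)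
  have hb'S : ∀ n, ∀ s ∈ S, ‖b' n s‖ ≤ M := by
    intro n s hs
    have h1 : ‖(ρ n).π s (a n)‖ ≤ Real.exp 1 * C₃ :=
      (((ρ n).π s).le_of_opNorm_le (hπS n s hs) _).trans
        (mul_le_mul_of_nonneg_left (ha n) (by positivity))
    calc ‖b' n s‖ ≤ ‖b n s‖ + ‖(ρ n).π s (a n)‖ + ‖a n‖ :=
          (norm_sub_le _ _).trans (add_le_add_left (norm_add_le _ _) _)
      _ ≤ M := by linarith [hb1 n s hs, ha n]
  obtain ⟨c, hc, hevc⟩ := hlift b' hb' (fun g => by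
      obtain ⟨C, -, hC⟩ := hS.exists_cocycle_bound.{u, v} (isCompact_singleton (x := g)) hA
      exact ⟨C * M, fun n => hC (ρ n) (hπS n) _ (hb' n) M hM0 (hb'S n) g rfl⟩)
    (fun η hη => by
      obtain ⟨U, hU, hU'⟩ := hS.exists_nhds_smoothed_le.{u, v} μ hh hA hη
      refine mem_of_superset hU fun g hg n => ?_
      simpa using hU' (ρ n) (hπS n) (b n) (hb n) 1 zero_le_one (hb1 n) g hg)
  -- the limit cocycle
  have hTc : ρ'.IsCocycle fun g => T (c g) :=
    ⟨T.continuous.comp hc.continuous, fun g k => by rw [hc.map_mul, map_add, hTπ]⟩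
  have hTcS : ∀ s ∈ S, ‖T (c s)‖ ≤ M := fun s hs =>
    le_of_tendsto' (hT (c s)) fun n => by rw [hevc]; exact hb'S n s hs
  obtain ⟨x, hx⟩ := hK.exists_coboundary hQ hδ hρ' hTc
  -- Subtracting the invariant vector `z` does not change the coboundary, and it leaves a vector
  -- that is controlled by the cocycle on `Q` and contracted by `π'(f)`.
  obtain ⟨z, hz, ⟨r, hr, hrle⟩, hpow⟩ := hgap ρ' hρ' x
  set y := x - z with hy
  have hy_eq : ∀ g, T (c g) = ρ'.π g y - y := fun g => by
    rw [hx, hy, map_sub, hz g, sub_sub_sub_cancel_right]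
  have hy_norm : ‖y‖ ≤ C₂ * M / δ := by
    rw [le_div_iff₀ hδ, mul_comm]
    refine hrle.trans ?_
    rcases hr with rfl | ⟨g, hg, rfl⟩
    · positivity
    · rw [← hx]
      refine hC₂ ρ' (fun s _ => ?_) _ hTc M hM0 hTcS g hg
      exact ContinuousLinearMap.opNorm_le_bound _ (by positivity) fun w => by
        rw [hρ'.norm_map]
        exact le_mul_of_one_le_left (norm_nonneg _) hA
  clear_value y
  -- the iterated averages
  let w : ℕ → X.E := fun k => Nat.rec 0 (fun _ w => X.average μ c f + X.integrate μ f w) k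
  have hw0 : w 0 = 0 := rfl
  have hws : ∀ k, w (k + 1) = X.average μ c f + X.integrate μ f (w k) := fun k => rfl
  have hevw : ∀ n k, ev n (w k) = (ρ n).average μ (b n) (convIter μ f h k) - a n := by
    intro n k
    have h1 : ev n (X.average μ c f) = (ρ n).average μ (b' n) f := by
      rw [BanachRep.average, BanachRep.average, ← ContinuousLinearMap.integral_comp_comm _
        (integrable_smul_of_continuous μ f hc.continuous)]
      simp [hevc]
    induction k with
    | zero =>
      rw [hw0, map_zero]
      exact (sub_self _).symm
    | succ k ih =>
      rw [hws, map_add, h1, BanachRep.map_integrate μ (ev n) (hevπ n), ih,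
        (hb n).average_shift μ (a n) hf, convIter,
        (hb n).average_convolution μ f (integral_convIter μ hf hh k), map_sub]
      abel
  have hTw : ∀ k, T (w k) = (ρ'.integrate μ f ^ k) y - y := by
    intro k
    have h1 : T (X.average μ c f) = ρ'.integrate μ f y - y := by
      rw [BanachRep.average, ← ContinuousLinearMap.integral_comp_comm _
        (integrable_smul_of_continuous μ f hc.continuous), ← ρ'.average_coboundary μ y hf,
        BanachRep.average]
      simp [hy_eq]
    induction k with
    | zero => simp [hw0]
    | succ k ih =>
      rw [hws, map_add, h1, BanachRep.map_integrate μ T hTπ, ih, map_sub, pow_succ',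
        mul_apply_eq_comp]
      abel
  -- the displacement of the last average
  let d : G → X.E := fun g => c g + X.π g (w m) - w m
  have hd_cont : Continuous d := (hc.shift (w m)).continuous
  have hevd : ∀ n g, ev n (d g) = b n g + (ρ n).π g ((ρ n).average μ (b n) (convIter μ f h m)) -
      (ρ n).average μ (b n) (convIter μ f h m) := by
    intro n g
    simp only [d, map_add, map_sub, hevπ, hevw, hevc, hb'_def]
    abel
  have hTd : ∀ g, ‖T (d g)‖ ≤ 1 / 4 := by
    intro g
    set q := (ρ'.integrate μ f ^ m) y with hq
    have h1 : T (d g) = ρ'.π g q - q := by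
      simp only [d, map_add, map_sub, hTπ, hTw, hy_eq]
      abel
    have h2 : ‖q‖ ≤ 1 / 8 :=
      (hpow m).trans ((mul_le_mul_of_nonneg_left hy_norm (pow_nonneg (by linarith) m)).trans hm.le)
    rw [h1]
    refine (norm_sub_le _ _).trans ?_
    rw [hρ'.norm_map]
    linarith
  clear_value d
  -- The generators at which the contraction fails vary with `n`. By compactness they converge to
  -- `s₀` along the ultrafilter, and continuity of `d` in the sup norm allows replacing them by
  -- `s₀`.
  obtain ⟨s₀, -, hs₀⟩ := hS.isCompact.ultrafilter_le_nhds ((hyperfilter ℕ).map s) (by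
    rw [le_principal_iff]
    exact univ_mem' (f := (hyperfilter ℕ : Filter ℕ)) hs)
  have hs_lim : Tendsto s (hyperfilter ℕ : Filter ℕ) (𝓝 s₀) := hs₀
  have hd_lim : Tendsto (fun n => ‖d (s n) - d s₀‖) (hyperfilter ℕ : Filter ℕ) (𝓝 0) :=
    tendsto_iff_norm_sub_tendsto_zero.1 ((hd_cont.tendsto s₀).comp hs_lim)
  have hlim := hd_lim.add (hT (d s₀))
  rw [zero_add] at hlim
  have hle : (1 / 2 : ℝ) ≤ ‖T (d s₀)‖ := by
    refine ge_of_tendsto' hlim fun n => ?_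
    have h1 : ‖ev n (d (s n))‖ ≤ ‖ev n (d (s n) - d s₀)‖ + ‖ev n (d s₀)‖ := by
      calc ‖ev n (d (s n))‖ = ‖ev n (d (s n) - d s₀) + ev n (d s₀)‖ := by
            rw [map_sub, sub_add_cancel]
        _ ≤ _ := norm_add_le _ _
    have h2 := hbad n
    rw [← hevd] at h2
    linarith [hev n (d (s n) - d s₀)]
  linarith [hTd s₀]

theorem BanachRep.IsCocycle.smul {ρ : BanachRep.{u, v} G} {b : G → ρ.E} (hb : ρ.IsCocycle b)
    (t : ℂ) : ρ.IsCocycle fun g => t • b g where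
  continuous := hb.continuous.const_smul t
  map_mul g h := by rw [hb.map_mul, smul_add, map_smul]

theorem BanachRep.average_smul (ρ : BanachRep.{u, v} G) (b : G → ρ.E) (f : C_c(G, ℂ)) (t : ℂ) :
    ρ.average μ (fun g => t • b g) f = t • ρ.average μ b f := by
  simp only [BanachRep.average, smul_comm _ t]
  exact integral_smul t _

/-- For a group with a Kazhdan pair, averaging over a fixed function halves the displacement of
affine actions whose linear part is close to being unitary. -/
theorem IsKazhdanPair.exists_displacement_contraction {Q : Set G} {δ : ℝ}
    (hK : IsKazhdanPair.{u, v} Q δ) (hQ : IsCompact Q) (hδ : 0 < δ) {S : Set G}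
    (hS : IsCompactGeneratingSet S) :
    ∃ φ : C_c(G, ℂ), ∫ g, φ g ∂μ = 1 ∧ ∃ ε : ℝ, 0 < ε ∧ ε ≤ 1 ∧
      ∀ ρ ∈ (repFamily hS (nearHilbert.{v} ε) ε).carrier, ∀ b, ρ.IsCocycle b →
        ∀ M : ℝ, 0 ≤ M → (∀ s ∈ S, ‖b s‖ ≤ M) →
        ∀ s ∈ S, ‖b s + ρ.π s (ρ.average μ b φ) - ρ.average μ b φ‖ ≤ M / 2 := by
  obtain ⟨φ, hφ, ε, hε, hε1, h⟩ := hK.exists_contracting_average_unit μ hQ hδ hS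
  refine ⟨φ, hφ, ε, hε, hε1, fun ρ hρ b hb M hM0 hM s hs => ?_⟩
  -- Rescaling to displacement one requires a positive bound, so `M` is first enlarged to cover `M =
  -- 0`.
  have hpos : ∀ M' : ℝ, 0 < M' → M ≤ M' →
      ‖b s + ρ.π s (ρ.average μ b φ) - ρ.average μ b φ‖ ≤ M' / 2 := by
    intro M' hM' hMM'
    have hn : ‖((M'⁻¹ : ℝ) : ℂ)‖ = M'⁻¹ := by
      rw [Complex.norm_real, Real.norm_of_nonneg (by positivity)]
    have h1 := h ρ hρ _ (hb.smul ((M'⁻¹ : ℝ) : ℂ)) (fun s hs => by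
      rw [norm_smul, hn, inv_mul_le_iff₀ hM', mul_one]
      exact (hM s hs).trans hMM') s hs
    rw [ρ.average_smul μ, map_smul, ← smul_add, ← smul_sub, norm_smul, hn,
      inv_mul_le_iff₀ hM'] at h1
    linarith
  by_contra! hlt
  -- The midpoint of `M` and twice the new displacement: it exceeds `M`, yet its half is smaller
  -- than the displacement.
  have h1 := hpos (M / 2 + ‖b s + ρ.π s (ρ.average μ b φ) - ρ.average μ b φ‖)
    (by linarith) (by linarith)
  linarith

end Contraction

/-! ### The algebra `C_F(G)` and its representations -/

section CFLemmas

variable {G : Type u} [Group G] [TopologicalSpace G] [IsTopologicalGroup G] [T2Space G]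
  [LocallyCompactSpace G] [MeasurableSpace G] [BorelSpace G]
  {μ : Measure G} [μ.IsHaarMeasure] {F : RepFamily.{u, v} G}

theorem BanachRep.integrate_sub (ρ : BanachRep.{u, v} G) (f h : C_c(G, ℂ)) :
    ρ.integrate μ (f - h) = ρ.integrate μ f - ρ.integrate μ h := by
  have h1 := ρ.integrate_add μ (f - h) h
  rw [sub_add_cancel] at h1
  rw [h1, add_sub_cancel_right]

theorem CF.dist_of (f h : C_c(G, ℂ)) :
    dist (CF.of μ F f) (CF.of μ F h) = familyNorm μ F (f - h) := by
  change dist ((PreAlgebra.of μ F f : PreAlgebra μ F) : UniformSpace.Completion (PreAlgebra μ F))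
    (PreAlgebra.of μ F h : PreAlgebra μ F) = _
  rw [UniformSpace.Completion.dist_eq, dist_eq_norm]
  rfl

theorem CF.induction_on {P : CF μ F → Prop} (a : CF μ F) (hP : IsClosed {a | P a})
    (h : ∀ f : C_c(G, ℂ), P (CF.of μ F f)) : P a :=
  UniformSpace.Completion.induction_on a hP fun f => h f.out

theorem CF.of_mul (f h : C_c(G, ℂ)) :
    CF.of μ F f * CF.of μ F h = CF.of μ F (convolution μ f h) :=
  (CF.coe_mul μ F (PreAlgebra.of μ F f) (PreAlgebra.of μ F h)).symm

theorem CF.dist_rep_le (ρ : F.carrier) (a b : CF μ F) :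
    dist (CF.rep μ ρ a) (CF.rep μ ρ b) ≤ dist a b := by
  have hc := CF.continuous_rep μ ρ
  induction a using CF.induction_on with
  | hP => exact isClosed_le (by fun_prop) (by fun_prop)
  | h f => ?_
  induction b using CF.induction_on with
  | hP => exact isClosed_le (by fun_prop) (by fun_prop)
  | h h => ?_
  rw [CF.rep_of, CF.rep_of, CF.dist_of, dist_eq_norm, ← BanachRep.integrate_sub]
  exact norm_integrate_le_familyNorm μ ρ.2 _

theorem CF.rep_mul (ρ : F.carrier) (a b : CF μ F) :
    CF.rep μ ρ (a * b) = CF.rep μ ρ a * CF.rep μ ρ b := by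
  have hc := CF.continuous_rep μ ρ
  induction a using CF.induction_on with
  | hP => exact isClosed_eq (by fun_prop) (by fun_prop)
  | h f => ?_
  induction b using CF.induction_on with
  | hP => exact isClosed_eq (by fun_prop) (by fun_prop)
  | h h => ?_
  rw [CF.of_mul, CF.rep_of, CF.rep_of, CF.rep_of, BanachRep.integrate_convolution]

/-- The representations in `F` separate the points of `C_F(G)`. -/
theorem CF.ext_rep {a b : CF μ F} (h : ∀ ρ : F.carrier, CF.rep μ ρ a = CF.rep μ ρ b) : a = b := by
  have hdense : ∀ (a : CF μ F) (η : ℝ), 0 < η → ∃ f : C_c(G, ℂ), dist a (CF.of μ F f) < η := by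
    intro a η hη
    obtain ⟨f, hf⟩ := (UniformSpace.Completion.denseRange_coe (α := PreAlgebra μ F)).exists_dist_lt
      a hη
    exact ⟨f.out, hf⟩
  refine eq_of_forall_dist_le fun η hη => ?_
  -- The norm is known as a supremum over representations only on `C_c(G)`, so `a` and `b` are
  -- replaced by nearby functions, whose images differ by at most `η/2` in every representation.
  obtain ⟨f, hf⟩ := hdense a (η / 4) (by positivity)
  obtain ⟨k, hk⟩ := hdense b (η / 4) (by positivity)
  have h1 : dist (CF.of μ F f) (CF.of μ F k) ≤ η / 2 := by
    rw [CF.dist_of]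
    refine familyNorm_le μ F _ (by positivity) fun ρ hρ => ?_
    have h2 := CF.dist_rep_le (μ := μ) ⟨ρ, hρ⟩ a (CF.of μ F f)
    have h3 := CF.dist_rep_le (μ := μ) ⟨ρ, hρ⟩ b (CF.of μ F k)
    rw [CF.rep_of] at h2 h3
    rw [← h ⟨ρ, hρ⟩] at h3
    rw [BanachRep.integrate_sub, ← dist_eq_norm]
    linarith [dist_triangle_left (ρ.integrate μ f) (ρ.integrate μ k) (CF.rep μ ⟨ρ, hρ⟩ a)]
  linarith [dist_triangle4_right a b (CF.of μ F f) (CF.of μ F k)]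

end CFLemmas

/-! ### Robust property (T) implies property (T) -/

section Converse

variable {G : Type u} [Group G] [TopologicalSpace G] [IsTopologicalGroup G] [T2Space G]
  [LocallyCompactSpace G] [MeasurableSpace G] [BorelSpace G]
  {μ : Measure G} [μ.IsHaarMeasure]

theorem propertyT_of_robust {S : Set G} {hS : IsCompactGeneratingSet S} {ε : ℝ} (hε : 0 ≤ ε)
    (h : RobustPropertyT μ hS (nearHilbert.{v} ε)) : PropertyT.{u, v} G := by
  obtain ⟨s, hs, p, hp⟩ := h
  obtain ⟨_, ⟨f, hf, rfl⟩, hpf⟩ := Metric.mem_closure_iff.1 hp.mem_closure (1 / 2) (by norm_num)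
  have hf1 : ∫ g, f g ∂μ = 1 := hf
  set I := ∫ g, ‖f g‖ ∂μ
  have hI0 : 0 ≤ I := integral_nonneg fun _ => norm_nonneg _
  -- With this `δ`, `‖π(f)x - x‖ ≤ Iδ‖x‖ < ‖x‖/2`, while `π(p)x` lies within `‖x‖/2` of `π(f)x`;
  -- hence `π(p)x ≠ 0`.
  refine ⟨tsupport f, f.hasCompactSupport, 1 / (2 * (I + 1)), by positivity, ?_⟩
  intro H _ _ _ π hπ ⟨x, hx0, hx⟩
  let ρ : BanachRep.{u, v} G :=
    { E := H, π := (unitary (H →L[ℂ] H)).subtype.comp π, continuous_orbit := hπ }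
  have hρ : ρ ∈ (repFamily hS (nearHilbert.{v} ε) s).carrier := by
    refine ⟨fun (x y : H) => ?_, fun g => ?_⟩
    · have h1 := parallelogram_law_with_norm ℂ x y
      nlinarith [mul_nonneg hε (add_nonneg (sq_nonneg ‖x‖) (sq_nonneg ‖y‖))]
    · have h1 : ‖(π g : H →L[ℂ] H)‖ ≤ 1 :=
        ContinuousLinearMap.opNorm_le_bound _ zero_le_one fun x => by
          rw [one_mul]
          exact (Unitary.norm_map (π g) x).le
      exact h1.trans (Real.one_le_exp (by positivity))
  set y : H := CF.rep μ ⟨ρ, hρ⟩ p x with hy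
  have hy_inv : y ∈ ρ.invariants := by
    have : y ∈ Set.range (CF.rep μ ⟨ρ, hρ⟩ p) := ⟨x, rfl⟩
    rwa [hp.range_rep ⟨ρ, hρ⟩] at this
  refine ⟨y, fun hy0 => ?_, hy_inv⟩
  have hxn : 0 < ‖x‖ := norm_pos_iff.2 hx0
  have h1 : ‖ρ.integrate μ f x - x‖ ≤ I * (1 / (2 * (I + 1)) * ‖x‖) := by
    rw [← ρ.average_coboundary μ x hf1]
    exact norm_integral_smul_le μ f fun g hg => (hx g hg).le
  have h2 : ‖CF.rep μ ⟨ρ, hρ⟩ p x - ρ.integrate μ f x‖ ≤ 1 / 2 * ‖x‖ := by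
    have h3 := CF.dist_rep_le (μ := μ) ⟨ρ, hρ⟩ p (CF.of μ _ f)
    rw [CF.rep_of, dist_eq_norm] at h3
    exact (CF.rep μ ⟨ρ, hρ⟩ p - ρ.integrate μ f).le_of_opNorm_le (h3.trans hpf.le) x
  have h3 : I * (1 / (2 * (I + 1)) * ‖x‖) < 1 / 2 * ‖x‖ := by
    rw [← mul_assoc, mul_one_div]
    refine mul_lt_mul_of_pos_right ?_ hxn
    rw [div_lt_div_iff₀ (by positivity) (by norm_num)]
    linarith
  have h4 : ‖x‖ ≤ ‖CF.rep μ ⟨ρ, hρ⟩ p x - ρ.integrate μ f x‖ + ‖ρ.integrate μ f x - x‖ := by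
    have h5 : x = -((CF.rep μ ⟨ρ, hρ⟩ p x - ρ.integrate μ f x) + (ρ.integrate μ f x - x)) := by
      have h6 : CF.rep μ ⟨ρ, hρ⟩ p x = (0 : H) := hy0
      rw [sub_add_sub_cancel, h6]
      change x = -((0 : H) - x)
      rw [zero_sub, neg_neg]
    calc ‖x‖ = ‖(CF.rep μ ⟨ρ, hρ⟩ p x - ρ.integrate μ f x) + (ρ.integrate μ f x - x)‖ := by
          rw [← norm_neg (_ + _), ← h5]
      _ ≤ _ := norm_add_le _ _
  linarith

end Converse

/-! ### The contragredient representation -/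

section Dual

theorem exists_almost_norming {E : Type v} [NormedAddCommGroup E] [NormedSpace ℂ E]
    (ξ : E →L[ℂ] ℂ) {t : ℝ} (ht : t < 1) :
    ∃ x, ‖x‖ ≤ 1 ∧ ∃ c : ℝ, t * ‖ξ‖ ≤ c ∧ ξ x = (c : ℂ) := by
  rcases (norm_nonneg ξ).eq_or_lt with h0 | h0
  · exact ⟨0, by simp, 0, by rw [← h0, mul_zero], by simp⟩
  · obtain ⟨x, hx1, hx⟩ := ξ.exists_lt_apply_of_lt_opNorm
      (show t * ‖ξ‖ < ‖ξ‖ from mul_lt_of_lt_one_left h0 ht)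
    obtain ⟨c, hc, hcx⟩ := Complex.exists_norm_mul_eq_self (ξ x)
    have hc0 : c ≠ 0 := by rw [← norm_ne_zero_iff, hc]; exact one_ne_zero
    refine ⟨c⁻¹ • x, ?_, ‖ξ x‖, hx.le, ?_⟩
    · rw [norm_smul, norm_inv, hc, inv_one, one_mul]
      exact hx1.le
    · rw [map_smul, smul_eq_mul, inv_mul_eq_iff_eq_mul₀ hc0, mul_comm, mul_comm, hcx]

/-- The inequality says that `(x, y) ↦ (x + y, x - y)` has squared norm at most `2(1 + ε)` on the
`ℓ²`-sum `E ⊕ E`. The adjoint is given by the same formula on the dual and has the same norm. -/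
theorem nearHilbert_dual {E : Type v} [NormedAddCommGroup E] [NormedSpace ℂ E] [CompleteSpace E]
    {ε : ℝ} (hε : 0 ≤ ε) (hE : nearHilbert ε E) : nearHilbert ε (E →L[ℂ] ℂ) := by
  intro ξ η
  set N := ‖ξ‖ ^ 2 + ‖η‖ ^ 2 with hN
  set A := ‖ξ + η‖
  set B := ‖ξ - η‖
  have hN0 : 0 ≤ N := by positivity
  have key : ∀ t : ℝ, 0 ≤ t → t < 1 → t ^ 2 * (A ^ 2 + B ^ 2) ≤ 2 * (1 + ε) * N := by
    intro t ht0 ht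
    obtain ⟨x, hx, r, hr, hxr⟩ := exists_almost_norming (ξ + η) ht
    obtain ⟨y, hy, s, hs, hys⟩ := exists_almost_norming (ξ - η) ht
    have hr0 : 0 ≤ r := (mul_nonneg ht0 (norm_nonneg _)).trans hr
    have hs0 : 0 ≤ s := (mul_nonneg ht0 (norm_nonneg _)).trans hs
    -- Scaling the almost norming vectors by `r` and `s` makes the pairing with `(ξ + η, ξ - η)`
    -- equal to `r² + s²`, the equality case of Cauchy–Schwarz.
    set x' : E := (r : ℂ) • x
    set y' : E := (s : ℂ) • y
    have hx' : ‖x'‖ ≤ r := by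
      rw [norm_smul, Complex.norm_real, Real.norm_of_nonneg hr0]
      exact mul_le_of_le_one_right hr0 hx
    have hy' : ‖y'‖ ≤ s := by
      rw [norm_smul, Complex.norm_real, Real.norm_of_nonneg hs0]
      exact mul_le_of_le_one_right hs0 hy
    have h1 : ((r ^ 2 + s ^ 2 : ℝ) : ℂ) = ξ (x' + y') + η (x' - y') := by
      have h2 : ξ (x' + y') + η (x' - y') = (ξ + η) x' + (ξ - η) y' := by
        simp only [map_add, map_sub, _root_.add_apply, _root_.sub_apply]
        ring
      rw [h2, map_smul, map_smul, hxr, hys]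
      push_cast
      simp only [smul_eq_mul]
      ring
    have h2 : r ^ 2 + s ^ 2 ≤ ‖ξ‖ * ‖x' + y'‖ + ‖η‖ * ‖x' - y'‖ := by
      calc r ^ 2 + s ^ 2 = ‖((r ^ 2 + s ^ 2 : ℝ) : ℂ)‖ := by
            rw [Complex.norm_real, Real.norm_of_nonneg (by positivity)]
        _ ≤ ‖ξ (x' + y')‖ + ‖η (x' - y')‖ := by rw [h1]; exact norm_add_le _ _
        _ ≤ _ := add_le_add (ξ.le_opNorm _) (η.le_opNorm _)
    have h3 := hE x' y'
    have h4 : ‖x' + y'‖ ^ 2 + ‖x' - y'‖ ^ 2 ≤ 2 * (1 + ε) * (r ^ 2 + s ^ 2) := by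
      have h5 : ‖x'‖ ^ 2 + ‖y'‖ ^ 2 ≤ r ^ 2 + s ^ 2 :=
        add_le_add (pow_le_pow_left₀ (norm_nonneg _) hx' 2)
          (pow_le_pow_left₀ (norm_nonneg _) hy' 2)
      nlinarith [mul_le_mul_of_nonneg_left h5 (show 0 ≤ 1 + ε by linarith)]
    have h5 : (r ^ 2 + s ^ 2) ^ 2 ≤ N * (2 * (1 + ε) * (r ^ 2 + s ^ 2)) := by
      calc (r ^ 2 + s ^ 2) ^ 2 ≤ (‖ξ‖ * ‖x' + y'‖ + ‖η‖ * ‖x' - y'‖) ^ 2 :=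
            pow_le_pow_left₀ (by positivity) h2 2
        _ ≤ N * (‖x' + y'‖ ^ 2 + ‖x' - y'‖ ^ 2) := by
            nlinarith [sq_nonneg (‖ξ‖ * ‖x' - y'‖ - ‖η‖ * ‖x' + y'‖)]
        _ ≤ _ := mul_le_mul_of_nonneg_left h4 hN0
    have h6 : r ^ 2 + s ^ 2 ≤ 2 * (1 + ε) * N := by
      rcases (show 0 ≤ r ^ 2 + s ^ 2 by positivity).eq_or_lt with h0 | h0
      · rw [← h0]; positivity
      · refine le_of_mul_le_mul_right ?_ h0
        linarith
    calc t ^ 2 * (A ^ 2 + B ^ 2) = (t * A) ^ 2 + (t * B) ^ 2 := by ring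
      _ ≤ r ^ 2 + s ^ 2 := add_le_add
          (pow_le_pow_left₀ (mul_nonneg ht0 (norm_nonneg _)) hr 2)
          (pow_le_pow_left₀ (mul_nonneg ht0 (norm_nonneg _)) hs 2)
      _ ≤ _ := h6
  have hlim : Tendsto (fun t : ℝ => t ^ 2 * (A ^ 2 + B ^ 2)) (𝓝[<] 1)
      (𝓝 (1 ^ 2 * (A ^ 2 + B ^ 2))) :=
    ((continuous_id.pow 2).mul continuous_const).continuousAt.tendsto.mono_left
      nhdsWithin_le_nhds
  have hfin : 1 ^ 2 * (A ^ 2 + B ^ 2) ≤ 2 * (1 + ε) * N := by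
    refine le_of_tendsto hlim ?_
    filter_upwards [Ioo_mem_nhdsLT (show (0 : ℝ) < 1 by norm_num)] with t ht
    exact key t ht.1.le ht.2
  linarith

variable {G : Type u} [Group G]

/-- The dual action `ξ ↦ ξ ∘ π(g⁻¹)` on continuous functionals. -/
def dualHom {E : Type v} [NormedAddCommGroup E] [NormedSpace ℂ E] (π : G →* (E →L[ℂ] E)) :
    G →* ((E →L[ℂ] ℂ) →L[ℂ] (E →L[ℂ] ℂ)) where
  toFun g := (ContinuousLinearMap.compL ℂ E E ℂ).flip (π g⁻¹)
  map_one' := by ext ξ x; simp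
  map_mul' g h := by ext ξ x; simp

theorem dualHom_apply {E : Type v} [NormedAddCommGroup E] [NormedSpace ℂ E]
    (π : G →* (E →L[ℂ] E)) (g : G) (ξ : E →L[ℂ] ℂ) (x : E) : dualHom π g ξ x = ξ (π g⁻¹ x) := rfl

theorem norm_dualHom_le {E : Type v} [NormedAddCommGroup E] [NormedSpace ℂ E]
    (π : G →* (E →L[ℂ] E)) (g : G) : ‖dualHom π g‖ ≤ ‖π g⁻¹‖ :=
  ContinuousLinearMap.opNorm_le_bound _ (norm_nonneg _) fun ξ => by
    rw [mul_comm]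
    exact ContinuousLinearMap.opNorm_comp_le ξ (π g⁻¹)

variable [TopologicalSpace G]

theorem IsCompactGeneratingSet.wordLength_inv_le {S : Set G} (hS : IsCompactGeneratingSet S)
    (g : G) : wordLength S g⁻¹ ≤ wordLength S g := by
  have hmem : g ∈ S ^ wordLength S g := Nat.sInf_mem (hS.exists_mem_pow g)
  have hinv : S⁻¹ = S := by
    ext s
    exact ⟨fun h => by simpa using hS.inv_mem _ h, fun h => hS.inv_mem _ h⟩
  have h : g⁻¹ ∈ S⁻¹ ^ wordLength S g := by
    rw [inv_pow]
    simpa using hmem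
  rw [hinv] at h
  exact wordLength_le h

variable [IsTopologicalGroup G] [T2Space G] [LocallyCompactSpace G]

/-- For `(π, E)` in the family, the contragredient representation on continuous vectors of the
dual space is in the family. -/
theorem exists_contragredient {S : Set G} (hS : IsCompactGeneratingSet S) {ε : ℝ} (hε : 0 ≤ ε)
    {ρ : BanachRep.{u, v} G} (hρ : ρ ∈ (repFamily hS (nearHilbert.{v} ε) ε).carrier) :
    ∃ D ∈ (repFamily hS (nearHilbert.{v} ε) ε).carrier,
      ∃ ι : D.E →L[ℂ] (ρ.E →L[ℂ] ℂ), (∀ g ξ x, ι (D.π g ξ) x = ι ξ (ρ.π g⁻¹ x)) ∧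
        ∀ ξ, ξ ∈ continuousVectors (dualHom ρ.π) → ∃ η, ι η = ξ := by
  -- Symmetry of `S` enters here: the dual action involves `g⁻¹`, which is no longer than `g`.
  have hbd : ∀ g, ‖dualHom ρ.π g‖ ≤ Real.exp (ε * wordLength S g) := fun g => by
    refine (norm_dualHom_le ρ.π g).trans ((hρ.2 g⁻¹).trans (Real.exp_le_exp.2 ?_))
    exact mul_le_mul_of_nonneg_left (by exact_mod_cast hS.wordLength_inv_le g) hε
  obtain ⟨C, hC⟩ : ∃ C, ∀ᶠ g in 𝓝 (1 : G), ‖dualHom ρ.π g‖ ≤ C := by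
    obtain ⟨V, hV, hV1⟩ := exists_compact_mem_nhds (1 : G)
    obtain ⟨N, hN⟩ := hS.wordLength_bounded hV
    refine ⟨Real.exp (ε * N), mem_of_superset hV1 fun g hg =>
      (hbd g).trans (Real.exp_le_exp.2 ?_)⟩
    exact mul_le_mul_of_nonneg_left (by exact_mod_cast hN g hg) hε
  refine ⟨continuousPart (dualHom ρ.π) hC, ⟨fun ξ η => ?_, fun g => ?_⟩,
    (continuousVectors (dualHom ρ.π)).subtypeL, fun g ξ x => rfl, fun ξ hξ => ⟨⟨ξ, hξ⟩, rfl⟩⟩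
  · exact nearHilbert_dual hε hρ.1 (ξ : continuousVectors (dualHom ρ.π)).1
      (η : continuousVectors (dualHom ρ.π)).1
  · refine ContinuousLinearMap.opNorm_le_bound _ (Real.exp_pos _).le fun ξ => ?_
    exact (dualHom ρ.π g).le_of_opNorm_le (hbd g) (ξ : continuousVectors (dualHom ρ.π)).1

variable [MeasurableSpace G] [BorelSpace G] (μ : Measure G) [μ.IsHaarMeasure]

/-- The average `x ↦ ∫ f(k) ξ(π(k⁻¹) x) dk` of a functional has a continuous orbit. -/
theorem exists_smoothed_functional (ρ : BanachRep.{u, v} G) (ξ : ρ.E →L[ℂ] ℂ) (f : C_c(G, ℂ)) :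
    ∃ η ∈ continuousVectors (dualHom ρ.π),
      ∀ x, η x = ∫ k, f k * ξ (ρ.π k⁻¹ x) ∂μ := by
  have hfc := f.continuous
  have hcont : ∀ x, Continuous fun k : G => ξ (ρ.π k⁻¹ x) := fun x =>
    ξ.continuous.comp ((ρ.continuous_orbit x).comp continuous_inv)
  have h_integ : ∀ (h : G → ℂ), Continuous h → HasCompactSupport h → ∀ x,
      Integrable (fun k => h k * ξ (ρ.π k⁻¹ x)) μ := fun h hc hs x =>
    (hc.mul (hcont x)).integrable_of_hasCompactSupport hs.mul_right
  have hbound : ∀ K : Set G, IsCompact K → ∃ C, 0 ≤ C ∧ ∀ (h : G → ℂ), Continuous h →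
      HasCompactSupport h → (∀ k ∉ K, h k = 0) → ∀ x,
      ‖∫ k, h k * ξ (ρ.π k⁻¹ x) ∂μ‖ ≤ (∫ k, ‖h k‖ ∂μ) * (C * ‖x‖) := by
    intro K hK
    obtain ⟨C, hC⟩ := ρ.exists_bound hK.inv
    refine ⟨‖ξ‖ * max C 0, by positivity, fun h hc hs hK0 x => ?_⟩
    rw [← integral_mul_const]
    refine norm_integral_le_of_norm_le
      ((hc.integrable_of_hasCompactSupport hs).norm.mul_const _) (.of_forall fun k => ?_)
    by_cases hk : k ∈ K
    · rw [norm_mul, mul_assoc]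
      refine mul_le_mul_of_nonneg_left ((ξ.le_opNorm _).trans ?_) (norm_nonneg _)
      refine mul_le_mul_of_nonneg_left ?_ (norm_nonneg _)
      exact (ρ.π k⁻¹).le_of_opNorm_le ((hC k⁻¹ (by simpa using hk)).trans (le_max_left _ _)) x
    · simp [hK0 k hk]
  obtain ⟨C, hC0, hC⟩ := hbound _ f.hasCompactSupport
  let η : ρ.E →L[ℂ] ℂ := LinearMap.mkContinuous
    { toFun := fun x => ∫ k, f k * ξ (ρ.π k⁻¹ x) ∂μ
      map_add' := fun x y => by
        simp only [map_add, mul_add]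
        exact integral_add (h_integ f hfc f.hasCompactSupport x) (h_integ f hfc f.hasCompactSupport y)
      map_smul' := fun c x => by
        simp only [map_smul, smul_eq_mul, RingHom.id_apply, mul_left_comm _ c]
        exact integral_const_mul c _ } ((∫ k, ‖f k‖ ∂μ) * C) fun x => by
          rw [mul_assoc]
          exact hC f hfc f.hasCompactSupport
            (fun k hk => image_eq_zero_of_notMem_tsupport hk) x
  have hη : ∀ x, η x = ∫ k, f k * ξ (ρ.π k⁻¹ x) ∂μ := fun x => rfl
  refine ⟨η, ?_, hη⟩
  refine continuous_orbit_of_tendsto_one _ ?_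
  obtain ⟨V, hV, hV1⟩ := exists_compact_mem_nhds (1 : G)
  obtain ⟨C', hC'0, hC'⟩ := hbound _ ((hV.mul f.hasCompactSupport).union f.hasCompactSupport)
  rw [tendsto_iff_norm_sub_tendsto_zero]
  have hlim := (tendsto_integral_norm_translate_sub μ f).mul_const C'
  rw [zero_mul] at hlim
  refine squeeze_zero' (.of_forall fun g => norm_nonneg _) ?_ hlim
  filter_upwards [hV1] with g hg
  have hsupp1 : HasCompactSupport fun k => f (g⁻¹ * k) :=
    f.hasCompactSupport.comp_homeomorph (Homeomorph.mulLeft g⁻¹)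
  refine ContinuousLinearMap.opNorm_le_bound _
    (mul_nonneg (integral_nonneg fun _ => norm_nonneg _) hC'0) fun x => ?_
  -- Acting on the average translates `f`, so norm continuity follows from `L¹` continuity of
  -- translation, with no continuity of the orbit of `ξ`.
  have h1 : (dualHom ρ.π g η - η) x = ∫ k, (f (g⁻¹ * k) - f k) * ξ (ρ.π k⁻¹ x) ∂μ := by
    simp only [sub_mul]
    rw [integral_sub (h_integ (fun k => f (g⁻¹ * k)) (by fun_prop) hsupp1 x)
      (h_integ f hfc f.hasCompactSupport x), _root_.sub_apply, dualHom_apply, hη, hη]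
    congr 1
    rw [← integral_mul_left_eq_self (fun k => f (g⁻¹ * k) * ξ (ρ.π k⁻¹ x)) g]
    refine integral_congr_ae (.of_forall fun k => ?_)
    simp
  rw [h1, mul_assoc]
  refine hC' (fun k => f (g⁻¹ * k) - f k) (by fun_prop) (hsupp1.sub f.hasCompactSupport)
    (fun k hk => ?_) x
  rw [Set.mem_union, not_or] at hk
  have h2 : g⁻¹ * k ∉ tsupport f := fun h => hk.1 ⟨g, hg, g⁻¹ * k, h, by group⟩
  simp [image_eq_zero_of_notMem_tsupport h2, image_eq_zero_of_notMem_tsupport hk.2]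

end Dual

/-! ### Kazhdan projections and fixed points from the contraction property -/

section Projection

variable {G : Type u} [Group G] [TopologicalSpace G] [IsTopologicalGroup G] [T2Space G]
  [LocallyCompactSpace G] [MeasurableSpace G] [BorelSpace G]
  {μ : Measure G} [μ.IsHaarMeasure] {S : Set G} {hS : IsCompactGeneratingSet S}

variable (μ S) in
/-- Averaging over `φ` halves the displacement on `S` of every affine action with linear part in
`F`. -/
def ContractsDisplacement (F : RepFamily.{u, v} G) (φ : C_c(G, ℂ)) : Prop :=
  ∀ ρ ∈ F.carrier, ∀ b, ρ.IsCocycle b → ∀ M : ℝ, 0 ≤ M → (∀ s ∈ S, ‖b s‖ ≤ M) →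
    ∀ s ∈ S, ‖b s + ρ.π s (ρ.average μ b φ) - ρ.average μ b φ‖ ≤ M / 2

theorem exists_average_bound (hS : IsCompactGeneratingSet S) (𝓔 : BanachClass.{v}) {c : ℝ}
    (hc : c ≤ 1) (φ : C_c(G, ℂ)) :
    ∃ C : ℝ, 0 ≤ C ∧ ∀ ρ ∈ (repFamily hS 𝓔 c).carrier, ∀ b, ρ.IsCocycle b → ∀ M : ℝ, 0 ≤ M →
      (∀ s ∈ S, ‖b s‖ ≤ M) → ‖ρ.average μ b φ‖ ≤ C * M := by
  obtain ⟨C, hC0, hC⟩ := hS.exists_cocycle_bound.{u, v} φ.hasCompactSupport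
    (Real.one_le_exp zero_le_one)
  refine ⟨(∫ g, ‖φ g‖ ∂μ) * C, mul_nonneg (integral_nonneg fun _ => norm_nonneg _) hC0,
    fun ρ hρ b hb M hM0 hM => ?_⟩
  rw [mul_assoc]
  exact norm_integral_smul_le μ φ
    (hC ρ (fun s hs => norm_le_exp_one_of_mem_repFamily hS hc hρ hs) b hb M hM0 hM)

/-- Repeatedly moving the base point to its average halves the displacement each time. The moves are
bounded by a multiple of the displacement, so they are summable and the base points converge to a
fixed point. -/
theorem ContractsDisplacement.exists_coboundary {𝓔 : BanachClass.{v}} {c : ℝ} (hc : c ≤ 1)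
    {φ : C_c(G, ℂ)} (hφ : ContractsDisplacement μ S (repFamily hS 𝓔 c) φ)
    {ρ : BanachRep.{u, v} G} (hρ : ρ ∈ (repFamily hS 𝓔 c).carrier) {b : G → ρ.E}
    (hb : ρ.IsCocycle b) : ∃ x, ∀ g, b g + ρ.π g x - x = 0 := by
  obtain ⟨C, hC0, hC⟩ := exists_average_bound (μ := μ) hS 𝓔 hc φ
  obtain ⟨M₀, hM₀⟩ := hS.isCompact.exists_bound_of_continuousOn hb.continuous.continuousOn
  have hM₀0 : 0 ≤ M₀ := (norm_nonneg _).trans (hM₀ 1 hS.one_mem)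
  let x : ℕ → ρ.E := fun n =>
    Nat.rec 0 (fun _ y => y + ρ.average μ (fun g => b g + ρ.π g y - y) φ) n
  have hx : ∀ n, x (n + 1) = x n + ρ.average μ (fun g => b g + ρ.π g (x n) - x n) φ :=
    fun n => rfl
  have hM : ∀ n, ∀ s ∈ S, ‖b s + ρ.π s (x n) - x n‖ ≤ M₀ / 2 ^ n := by
    intro n
    induction n with
    | zero =>
      intro s hs
      simpa [x] using hM₀ s hs
    | succ n ih =>
      intro s hs
      have h := hφ ρ hρ _ (hb.shift (x n)) _ (by positivity) ih s hs
      rw [pow_succ, ← div_div, hx, map_add]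
      refine le_trans (le_of_eq ?_) h
      congr 1
      abel
  have hcauchy : CauchySeq x := by
    refine cauchySeq_of_le_geometric (1 / 2) (C * M₀) (by norm_num) fun n => ?_
    rw [dist_comm, dist_eq_norm, hx, add_sub_cancel_left]
    refine (hC ρ hρ _ (hb.shift (x n)) _ (by positivity) (hM n)).trans (le_of_eq ?_)
    rw [one_div, inv_pow]
    ring
  obtain ⟨y, hy⟩ := cauchySeq_tendsto_of_complete hcauchy
  refine ⟨y, hS.eq_zero_of_cocycle (hb.shift y) fun s hs => ?_⟩
  have h1 : Tendsto (fun n => ‖b s + ρ.π s (x n) - x n‖) atTop (𝓝 ‖b s + ρ.π s y - y‖) :=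
    (((((ρ.π s).continuous.tendsto y).comp hy).const_add (b s)).sub hy).norm
  have h2 : Tendsto (fun n : ℕ => M₀ / 2 ^ n) atTop (𝓝 0) := by
    have := (tendsto_pow_atTop_nhds_zero_of_lt_one (r := (1 / 2 : ℝ)) (by norm_num)
      (by norm_num)).const_mul M₀
    rw [mul_zero] at this
    refine this.congr fun n => ?_
    rw [one_div, inv_pow, div_eq_mul_inv]
  exact norm_le_zero_iff.1 (le_of_tendsto_of_tendsto' h1 h2 fun n => hM n s hs)

theorem ContractsDisplacement.hasFixedPoint {𝓔 : BanachClass.{v}} {c : ℝ} (hc : c ≤ 1)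
    {φ : C_c(G, ℂ)} (hφ : ContractsDisplacement μ S (repFamily hS 𝓔 c) φ)
    {ρ : BanachRep.{u, v} G} (hρ : ρ ∈ (repFamily hS 𝓔 c).carrier) (a : AffineAction ρ) :
    a.HasFixedPoint := by
  have hσ : ∀ g x, a.σ g x = ρ.π g x + a.σ g 0 := fun g x => by
    have h := (a.σ g).map_vadd 0 x
    rw [vadd_eq_add, add_zero, a.linear_eq, vadd_eq_add] at h
    exact h
  have hb : ρ.IsCocycle fun g => a.σ g 0 := by
    refine ⟨a.continuous_orbit 0, fun g h => ?_⟩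
    rw [map_mul, AffineEquiv.coe_mul, Function.comp_apply, hσ g, add_comm]
  obtain ⟨x, hx⟩ := hφ.exists_coboundary hc hρ hb
  refine ⟨x, fun g => ?_⟩
  rw [hσ, add_comm, ← sub_eq_zero]
  exact hx g

theorem integrate_of_invariant (ρ : BanachRep.{u, v} G) (f : C_c(G, ℂ)) {x : ρ.E}
    (hx : x ∈ ρ.invariants) : ρ.integrate μ f x = (∫ g, f g ∂μ) • x := by
  rw [BanachRep.integrate_apply, ← integral_smul_const]
  refine integral_congr_ae (.of_forall fun g => ?_)
  simp only
  rw [hx g]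

/-- The iterates of a contracting average converge in `C_F(G)`, and the image of the limit consists
of invariant vectors. -/
theorem ContractsDisplacement.exists_limit {𝓔 : BanachClass.{v}} {c : ℝ} (hc : c ≤ 1)
    {φ : C_c(G, ℂ)} (hφ1 : ∫ g, φ g ∂μ = 1)
    (hφ : ContractsDisplacement μ S (repFamily hS 𝓔 c) φ) :
    ∃ p : CF μ (repFamily hS 𝓔 c),
      Tendsto (fun n => CF.of μ (repFamily hS 𝓔 c) (convIter μ φ φ n)) atTop (𝓝 p) ∧
      ∀ (ρ : (repFamily hS 𝓔 c).carrier) (x : ρ.1.E), CF.rep μ ρ p x ∈ ρ.1.invariants := by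
  set F := repFamily hS 𝓔 c
  obtain ⟨C, hC0, hC⟩ := exists_average_bound (μ := μ) hS 𝓔 hc φ
  set B := Real.exp 1 + 1
  have hB0 : 0 ≤ B := by positivity
  -- The contraction is applied to the coboundaries `g ↦ π(g)y - y`, whose average is `π(φ)y - y`.
  -- The constant `B` bounds `‖π(s) - 1‖`; as `convIter φ φ n` has `n + 1` factors, one factor `1/2`
  -- is given away.
  have hdisp : ∀ ρ ∈ F.carrier, ∀ (x : ρ.E) (n : ℕ), ∀ s ∈ S,
      ‖ρ.π s (ρ.integrate μ (convIter μ φ φ n) x) - ρ.integrate μ (convIter μ φ φ n) x‖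
        ≤ B * ‖x‖ / 2 ^ n := by
    intro ρ hρ x n
    have hstep : ∀ (y : ρ.E) (M : ℝ), 0 ≤ M → (∀ s ∈ S, ‖ρ.π s y - y‖ ≤ M) →
        ∀ s ∈ S, ‖ρ.π s (ρ.integrate μ φ y) - ρ.integrate μ φ y‖ ≤ M / 2 := by
      intro y M hM0 hM s hs
      have h := hφ ρ hρ _ (ρ.isCocycle_coboundary y) M hM0 hM s hs
      rw [ρ.average_coboundary μ y hφ1, map_sub] at h
      refine le_trans (le_of_eq ?_) h
      congr 1
      abel
    induction n with
    | zero =>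
      have h0 : ∀ s ∈ S, ‖ρ.π s x - x‖ ≤ B * ‖x‖ := fun s hs => by
        refine (norm_sub_le _ _).trans ?_
        rw [add_mul, one_mul]
        gcongr
        exact (ρ.π s).le_of_opNorm_le (norm_le_exp_one_of_mem_repFamily hS hc hρ hs) x
      intro s hs
      refine (hstep x _ (by positivity) h0 s hs).trans ?_
      rw [pow_zero, div_one]
      exact half_le_self (by positivity)
    | succ n ih =>
      intro s hs
      rw [convIter, ρ.integrate_convolution_apply μ, pow_succ, ← div_div]
      exact hstep _ _ (by positivity) ih s hs
  -- Consecutive terms differ, on `x`, by the average of the coboundary of `π(φₙ)x`, where `φₙ` is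
  -- the `n`-th term; this is small uniformly over the family.
  have hcauchy : CauchySeq fun n => CF.of μ F (convIter μ φ φ n) := by
    refine cauchySeq_of_le_geometric (1 / 2) (C * B) (by norm_num) fun n => ?_
    rw [dist_comm, CF.dist_of]
    refine familyNorm_le μ F _ (by positivity) fun ρ hρ => ?_
    refine ContinuousLinearMap.opNorm_le_bound _ (by positivity) fun x => ?_
    rw [BanachRep.integrate_sub, _root_.sub_apply, convIter, ρ.integrate_convolution_apply μ,
      ← ρ.average_coboundary μ _ hφ1]
    refine (hC ρ hρ _ (ρ.isCocycle_coboundary _) _ (by positivity)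
      (hdisp ρ hρ x n)).trans (le_of_eq ?_)
    rw [one_div, inv_pow]
    ring
  obtain ⟨p, hp⟩ := cauchySeq_tendsto_of_complete hcauchy
  refine ⟨p, hp, fun ρ x => ?_⟩
  have hrep : Tendsto (fun n => ρ.1.integrate μ (convIter μ φ φ n) x) atTop
      (𝓝 (CF.rep μ ρ p x)) := by
    have h1 := ((CF.continuous_rep μ ρ).tendsto p).comp hp
    have h2 := ((ContinuousLinearMap.apply ℂ ρ.1.E x).continuous.tendsto (CF.rep μ ρ p)).comp h1
    refine h2.congr fun n => ?_
    simp only [Function.comp_apply, CF.rep_of, ContinuousLinearMap.apply_apply]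
  intro g
  refine sub_eq_zero.1 (hS.eq_zero_of_cocycle (ρ.1.isCocycle_coboundary (CF.rep μ ρ p x))
    (fun s hs => ?_) g)
  have h1 := ((((ρ.1.π s).continuous.tendsto _).comp hrep).sub hrep).norm
  have h2 : Tendsto (fun n : ℕ => B * ‖x‖ / 2 ^ n) atTop (𝓝 0) := by
    have := (tendsto_pow_atTop_nhds_zero_of_lt_one (r := (1 / 2 : ℝ)) (by norm_num)
      (by norm_num)).const_mul (B * ‖x‖)
    rw [mul_zero] at this
    refine this.congr fun n => ?_
    rw [one_div, inv_pow, div_eq_mul_inv]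
  exact norm_le_zero_iff.1 (le_of_tendsto_of_tendsto' h1 h2 fun n => hdisp ρ.1 ρ.2 x n s hs)

variable {F : RepFamily.{u, v} G}

/-- If a functional is constant on the orbit of `x`, it does not distinguish `x` from `π(p) x`. -/
theorem apply_rep_eq_of_mem_closure {p : CF μ F}
    (hp : p ∈ closure (CF.of μ F '' {f : C_c(G, ℂ) | ∫ g, f g ∂μ = 1})) (ρ : F.carrier)
    {E' : Type*} [NormedAddCommGroup E'] [NormedSpace ℂ E'] [CompleteSpace E']
    (ξ : ρ.1.E →L[ℂ] E') {x : ρ.1.E} (hx : ∀ g, ξ (ρ.1.π g x) = ξ x) :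
    ξ (CF.rep μ ρ p x) = ξ x := by
  have hclosed : IsClosed {a : CF μ F | ξ (CF.rep μ ρ a x) = ξ x} := by
    refine isClosed_eq ?_ continuous_const
    have := CF.continuous_rep μ ρ
    fun_prop
  refine closure_minimal (t := {a : CF μ F | ξ (CF.rep μ ρ a x) = ξ x}) ?_ hclosed hp
  rintro _ ⟨f, hf, rfl⟩
  have hf1 : ∫ g, f g ∂μ = 1 := hf
  change ξ (CF.rep μ ρ (CF.of μ F f) x) = ξ x
  rw [CF.rep_of, BanachRep.integrate_apply,
    ← ContinuousLinearMap.integral_comp_comm _ (ρ.1.integrable_orbit μ f x)]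
  simp only [map_smul, hx]
  rw [integral_smul_const, hf1, one_smul]

/-- An element of the closure of the functions of integral 1 acts as the identity on invariant
vectors, so having image in them already makes each `π(p)` a projection onto them. Idempotence of
`p` itself follows because the representations separate points. -/
theorem isKazhdanProjection_of_rep_mem {p : CF μ F}
    (hp : p ∈ closure (CF.of μ F '' {f : C_c(G, ℂ) | ∫ g, f g ∂μ = 1}))
    (hinv : ∀ (ρ : F.carrier) (x : ρ.1.E), CF.rep μ ρ p x ∈ ρ.1.invariants) :
    IsKazhdanProjection p := by
  have hfix : ∀ (ρ : F.carrier) (x : ρ.1.E), x ∈ ρ.1.invariants → CF.rep μ ρ p x = x :=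
    fun ρ x hx => apply_rep_eq_of_mem_closure hp ρ (ContinuousLinearMap.id ℂ ρ.1.E)
      fun g => hx g
  have hidem : ∀ ρ : F.carrier, IsIdempotentElem (CF.rep μ ρ p) := fun ρ => by
    ext x
    exact hfix ρ _ (hinv ρ x)
  refine ⟨CF.ext_rep fun ρ => ?_, hp, hidem, fun ρ => ?_⟩
  · rw [CF.rep_mul]
    exact hidem ρ
  · ext x
    exact ⟨by rintro ⟨y, rfl⟩; exact hinv ρ y, fun hx => ⟨x, hfix ρ x hx⟩⟩

theorem IsKazhdanProjection.rep_mem {p : CF μ F} (hp : IsKazhdanProjection p) (ρ : F.carrier)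
    (x : ρ.1.E) : CF.rep μ ρ p x ∈ ρ.1.invariants := by
  have : CF.rep μ ρ p x ∈ Set.range (CF.rep μ ρ p) := ⟨x, rfl⟩
  rwa [hp.range_rep ρ] at this

/-- `π(f)π(p) = (∫ f) π(p)` always holds because `π(p)` takes invariant values; the hypothesis gives
the same value for `π(p)π(f)`. -/
theorem IsKazhdanProjection.central_of_rep_comp {p : CF μ F} (hp : IsKazhdanProjection p)
    (h : ∀ (ρ : F.carrier) (g : G) (x : ρ.1.E), CF.rep μ ρ p (ρ.1.π g x) = CF.rep μ ρ p x) :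
    IsCentralKazhdanProjection p := by
  refine ⟨hp, Semigroup.mem_center_iff.2 fun a => ?_⟩
  induction a using CF.induction_on with
  | hP => exact isClosed_eq (by fun_prop) (by fun_prop)
  | h f =>
    refine CF.ext_rep fun ρ => ?_
    rw [CF.rep_mul, CF.rep_mul, CF.rep_of]
    ext x
    rw [mul_apply_eq_comp, mul_apply_eq_comp, integrate_of_invariant ρ.1 f (hp.rep_mem ρ x),
      BanachRep.integrate_apply, ← ContinuousLinearMap.integral_comp_comm _
        (ρ.1.integrable_orbit μ f x)]
    simp only [map_smul, h]
    rw [integral_smul_const]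

/-- A Kazhdan projection for representations on almost Hilbertian spaces is central. -/
theorem IsKazhdanProjection.central {ε : ℝ} (hε : 0 ≤ ε)
    {p : CF μ (repFamily hS (nearHilbert.{v} ε) ε)} (hp : IsKazhdanProjection p) :
    IsCentralKazhdanProjection p := by
  refine hp.central_of_rep_comp fun ρ g x => ?_
  by_contra hne
  -- A nonzero invariant vector. The contradiction comes from an invariant functional `ζ`: it must
  -- kill `y`, since `ζ ∘ π(p) = ζ`, yet it is built to take the value `‖y‖` there.
  set y := CF.rep μ ρ p (ρ.1.π g x) - CF.rep μ ρ p x with hy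
  have hy0 : y ≠ 0 := sub_ne_zero.2 hne
  have hy_inv : y ∈ ρ.1.invariants := Submodule.sub_mem _ (hp.rep_mem ρ _) (hp.rep_mem ρ _)
  obtain ⟨ξ₀, -, hξ₀⟩ := exists_dual_vector ℂ y (norm_ne_zero_iff.2 hy0)
  obtain ⟨f, hf⟩ := exists_integral_eq_one μ
  -- Smoothing moves the norming functional into the contragredient representation, where `p` acts.
  -- Neither smoothing nor the action of `p` changes its value at the invariant vector `y`.
  obtain ⟨ξ₁, hξ₁, hξ₁f⟩ := exists_smoothed_functional μ ρ.1 ξ₀ f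
  obtain ⟨D, hD, ι, hι, hsurj⟩ := exists_contragredient hS hε ρ.2
  obtain ⟨η, rfl⟩ := hsurj ξ₁ hξ₁
  set ζ := CF.rep μ ⟨D, hD⟩ p η
  have hζ : ζ ∈ D.invariants := hp.rep_mem ⟨D, hD⟩ η
  have hζinv : ∀ g x, ι ζ (ρ.1.π g x) = ι ζ x := fun g x => by
    have h := hι g⁻¹ ζ x
    rw [hζ g⁻¹, inv_inv] at h
    exact h.symm
  have h1 : ι ζ y = ι η y :=
    apply_rep_eq_of_mem_closure hp.mem_closure ⟨D, hD⟩
      ((ContinuousLinearMap.apply ℂ ℂ y).comp ι) (x := η) fun k => by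
        change ι (D.π k η) y = ι η y
        rw [hι, hy_inv]
  have h2 : ι η y = ξ₀ y := by
    rw [hξ₁f]
    simp only [hy_inv _]
    rw [integral_mul_const, hf, one_mul]
  have h3 : ∀ z, ι ζ (CF.rep μ ρ p z) = ι ζ z := fun z =>
    apply_rep_eq_of_mem_closure hp.mem_closure ρ (ι ζ) fun k => hζinv k z
  have h4 : ι ζ y = 0 := by
    rw [hy, map_sub, h3, h3, hζinv, sub_self]
  rw [h1, h2, hξ₀] at h4
  exact hy0 (norm_eq_zero.1 (RCLike.ofReal_eq_zero.1 h4))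

end Projection

end

end KazhdanRobust

/-! ### Assembly of the theorem -/

open MeasureTheory KazhdanRobust

theorem corollary4p6 {G : Type u} [Group G] [TopologicalSpace G] [IsTopologicalGroup G]
    [T2Space G] [LocallyCompactSpace G] [MeasurableSpace G] [BorelSpace G]
    (μ : MeasureTheory.Measure G) [μ.IsHaarMeasure]
    (S : Set G) (hS : IsCompactGeneratingSet S) :
    (PropertyT.{u, v} G →
      ∃ ε : ℝ, 0 < ε ∧
        (∃ p : CF μ (repFamily hS (nearHilbert.{v} ε) ε), IsCentralKazhdanProjection p) ∧
        ∀ ρ ∈ (repFamily hS (nearHilbert.{v} ε) ε).carrier, ∀ a : AffineAction ρ,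
          a.HasFixedPoint) ∧
    (PropertyT.{u, v} G ↔
      ∃ ε : ℝ, 0 < ε ∧ RobustPropertyT μ hS (nearHilbert.{v} ε)) := by
  have h1 : PropertyT.{u, v} G →
      ∃ ε : ℝ, 0 < ε ∧
        (∃ p : CF μ (repFamily hS (nearHilbert.{v} ε) ε), IsCentralKazhdanProjection p) ∧
        ∀ ρ ∈ (repFamily hS (nearHilbert.{v} ε) ε).carrier, ∀ a : AffineAction ρ,
          a.HasFixedPoint := by
    rintro ⟨Q, hQ, δ, hδ, hK⟩
    have hK' : IsKazhdanPair.{u, v} Q δ := hK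
    obtain ⟨φ, hφ1, ε, hε, hε1, hφ⟩ := hK'.exists_displacement_contraction μ hQ hδ hS
    have hφ' : ContractsDisplacement μ S (repFamily hS (nearHilbert.{v} ε) ε) φ := hφ
    obtain ⟨p, hp, hinv⟩ := hφ'.exists_limit hε1 hφ1
    have hmem : p ∈ closure (CF.of μ (repFamily hS (nearHilbert.{v} ε) ε) ''
        {f | ∫ g, f g ∂μ = 1}) :=
      mem_closure_of_tendsto hp (.of_forall fun n => ⟨_, integral_convIter μ hφ1 hφ1 n, rfl⟩)
    exact ⟨ε, hε, ⟨p, (isKazhdanProjection_of_rep_mem hmem hinv).central hε.le⟩,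
      fun ρ hρ a => hφ'.hasFixedPoint hε1 hρ a⟩
  refine ⟨h1, fun hT => ?_, fun ⟨ε, hε, h⟩ => propertyT_of_robust hε.le h⟩
  obtain ⟨ε, hε, ⟨p, hp⟩, -⟩ := h1 hT
  exact ⟨ε, hε, ε, hε, p, hp.toIsKazhdanProjection⟩
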